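/- All graphs are finite and simple (no self-loops, no multiple edges; a directed graph may contain both $uv$ and $vu$). An elimination forest of a graph $G=(V,E)$ is a rooted forest $T$ on the vertex set $V$ such that for every edge $uv\in E$ one of $u,v$ is an ancestor of the other in $T$; its depth is the maximum number of vertices on a path from a root to a leaf. A cycle is a closed walk with no repeated vertex (apart from its two ends) and, in the undirected case, no repeated edge, so that an undirected cycle has length at least $3$ and a directed cycle has length at least $2$; its weight is the sum of the weights of its edges. Theorem 6 (minimum weight cycle). There is an algorithm that, given an undirected graph $G=(V,E)$ with $n$ vertices and $m$ edges, an edge-weight function $w:E\to\mathbb{R}_{\ge 0}$ and an elimination forest of $G$ of depth $k$, computes a cycle of $G$ of minimum weight, or reports that $G$ has no cycle, in $O(k(m+n\log n)+1)$ time. There is likewise such an algorithm for directed graphs. Here the input consists of the list of weighted edges in arbitrary order and the parent pointers of the forest, and time is the number of elementary steps of a random access machine whose operations on integers are constants, copying, successor, predecessor, comparison and indirect addressing, and whose operations on real numbers are copying, addition and comparison; the program and the constant in the $O$ do not depend on the input. -/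

import Mathlib

namespace TreeDepthCycle

/-! ## The machine: a uniform successor random access machine with real registers

The machine has integer registers, real registers, integer arrays and real arrays. On integers it
can only use constants, copy, successor, predecessor and comparison (so that within `T` steps no
integer exceeds the input by more than `O(T)`; in particular integers stay `O(log n)`-bit words in
polynomial time). On reals it can only copy, add and compare. A program is a finite piece of syntax
that does not depend on the input. -/

/-- Integer expressions. -/
inductive IExpr : Type
  | const (c : ℕ)
  | reg (x : ℕ)
  | read (a : ℕ) (i : IExpr)
  | succ (e : IExpr)
  | pred (e : IExpr)

/-- Real expressions. -/
inductive RExpr : Type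
  | reg (x : ℕ)
  | read (a : ℕ) (i : IExpr)
  | add (e f : RExpr)

/-- Tests. -/
inductive Test : Type
  | ieq (e f : IExpr)
  | ilt (e f : IExpr)
  | rle (e f : RExpr)
  | rlt (e f : RExpr)
  | not (b : Test)
  | and (b c : Test)
  | or (b c : Test)

/-- Programs. -/
inductive Prog : Type
  | skip
  | setI (x : ℕ) (e : IExpr)
  | setR (x : ℕ) (e : RExpr)
  | writeI (a : ℕ) (i e : IExpr)
  | writeR (a : ℕ) (i : IExpr) (e : RExpr)
  | seq (p q : Prog)
  | ite (b : Test) (p q : Prog)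
  | while (b : Test) (p : Prog)

/-- Memory contents: `ireg x` and `rreg x` are the registers, `iarr a i` and `rarr a i` the cells
with index `i` of the arrays number `a`. -/
@[ext] structure State : Type where
  ireg : ℕ → ℕ
  rreg : ℕ → ℝ
  iarr : ℕ → ℕ → ℕ
  rarr : ℕ → ℕ → ℝ

/-- Value of an integer expression (the predecessor of `0` is `0`). -/
def IExpr.eval (s : State) : IExpr → ℕ
  | .const c => c
  | .reg x => s.ireg x
  | .read a i => s.iarr a (i.eval s)
  | .succ e => e.eval s + 1
  | .pred e => e.eval s - 1

/-- Number of elementary operations of an integer expression. -/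
def IExpr.cost : IExpr → ℕ
  | .const _ => 1
  | .reg _ => 1
  | .read _ i => i.cost + 1
  | .succ e => e.cost + 1
  | .pred e => e.cost + 1

/-- Value of a real expression. -/
noncomputable def RExpr.eval (s : State) : RExpr → ℝ
  | .reg x => s.rreg x
  | .read a i => s.rarr a (i.eval s)
  | .add e f => e.eval s + f.eval s

/-- Number of elementary operations of a real expression. -/
def RExpr.cost : RExpr → ℕ
  | .reg _ => 1
  | .read _ i => i.cost + 1
  | .add e f => e.cost + f.cost + 1

/-- Truth of a test. -/
def Test.Holds (s : State) : Test → Prop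
  | .ieq e f => e.eval s = f.eval s
  | .ilt e f => e.eval s < f.eval s
  | .rle e f => e.eval s ≤ f.eval s
  | .rlt e f => e.eval s < f.eval s
  | .not b => ¬ b.Holds s
  | .and b c => b.Holds s ∧ c.Holds s
  | .or b c => b.Holds s ∨ c.Holds s

/-- Number of elementary operations of a test. -/
def Test.cost : Test → ℕ
  | .ieq e f => e.cost + f.cost + 1
  | .ilt e f => e.cost + f.cost + 1
  | .rle e f => e.cost + f.cost + 1
  | .rlt e f => e.cost + f.cost + 1
  | .not b => b.cost + 1
  | .and b c => b.cost + c.cost + 1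
  | .or b c => b.cost + c.cost + 1

/-- `Exec p s t s'`: started in the state `s`, the program `p` halts in the state `s'` after `t`
elementary steps. -/
inductive Exec : Prog → State → ℕ → State → Prop
  | skip (s : State) : Exec .skip s 1 s
  | setI (s : State) (x : ℕ) (e : IExpr) :
      Exec (.setI x e) s (e.cost + 1) { s with ireg := Function.update s.ireg x (e.eval s) }
  | setR (s : State) (x : ℕ) (e : RExpr) :
      Exec (.setR x e) s (e.cost + 1) { s with rreg := Function.update s.rreg x (e.eval s) }
  | writeI (s : State) (a : ℕ) (i e : IExpr) :
      Exec (.writeI a i e) s (i.cost + e.cost + 1)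
        { s with iarr := Function.update s.iarr a
                          (Function.update (s.iarr a) (i.eval s) (e.eval s)) }
  | writeR (s : State) (a : ℕ) (i : IExpr) (e : RExpr) :
      Exec (.writeR a i e) s (i.cost + e.cost + 1)
        { s with rarr := Function.update s.rarr a
                          (Function.update (s.rarr a) (i.eval s) (e.eval s)) }
  | seq {p q : Prog} {s₁ s₂ s₃ : State} {t u : ℕ} (hp : Exec p s₁ t s₂) (hq : Exec q s₂ u s₃) :
      Exec (.seq p q) s₁ (t + u) s₃
  | ite_true {b : Test} {p q : Prog} {s s' : State} {t : ℕ} (hb : b.Holds s) (hp : Exec p s t s') :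
      Exec (.ite b p q) s (b.cost + t) s'
  | ite_false {b : Test} {p q : Prog} {s s' : State} {t : ℕ} (hb : ¬ b.Holds s)
      (hq : Exec q s t s') : Exec (.ite b p q) s (b.cost + t) s'
  | while_false {b : Test} {p : Prog} {s : State} (hb : ¬ b.Holds s) :
      Exec (.while b p) s b.cost s
  | while_true {b : Test} {p : Prog} {s₁ s₂ s₃ : State} {t u : ℕ} (hb : b.Holds s₁)
      (hp : Exec p s₁ t s₂) (hw : Exec (.while b p) s₂ u s₃) :
      Exec (.while b p) s₁ (b.cost + t + u) s₃

/-! ## Elimination forests -/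

/-- A rooted forest on the vertex set `V`, given by parent pointers; `parent v = none` means that
`v` is a root. Well-foundedness excludes cycles. -/
structure RootedForest (V : Type*) where
  parent : V → Option V
  wf : WellFounded fun u v => parent v = some u

/-- `u` is `v` or a proper ancestor of `v`. -/
def RootedForest.IsAncestor {V : Type*} (F : RootedForest V) (u v : V) : Prop :=
  Relation.ReflTransGen (fun a b => F.parent b = some a) u v

/-- The largest number of vertices on a path from a root down to a vertex (equivalently, down to a
leaf): the vertices on the path from the root to `v` are the ancestors of `v`, with `v` itself. -/
noncomputable def RootedForest.depth {V : Type*} [Fintype V] (F : RootedForest V) : ℕ :=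
  Finset.univ.sup fun v => {u | F.IsAncestor u v}.ncard

/-- `F` is an elimination forest of the graph with adjacency relation `adj`. -/
def RootedForest.IsElimination {V : Type*} (F : RootedForest V) (adj : V → V → Prop) : Prop :=
  ∀ u v, adj u v → F.IsAncestor u v ∨ F.IsAncestor v u

/-! ## Minimum-weight cycles -/

/-- The weight of a walk in an edge-weighted undirected graph. -/
def walkWeight {V : Type*} {G : SimpleGraph V} (w : Sym2 V → ℝ) {u v : V} (p : G.Walk u v) : ℝ :=
  (p.edges.map w).sum

/-- A cycle of minimum weight of an edge-weighted undirected graph. -/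
def IsMinWeightCycle {V : Type*} (G : SimpleGraph V) (w : Sym2 V → ℝ) {u : V} (p : G.Walk u u) :
    Prop :=
  p.IsCycle ∧ ∀ (v : V) (q : G.Walk v v), q.IsCycle → walkWeight w p ≤ walkWeight w q

/-- `c 0 → c 1 → ⋯ → c l → c 0` is a cycle of the directed graph `G` with `l + 1` distinct
vertices (addition in `Fin (l + 1)` wraps around). -/
def IsDiCycle {V : Type*} (G : Digraph V) {l : ℕ} (c : Fin (l + 1) → V) : Prop :=
  Function.Injective c ∧ ∀ i, G.Adj (c i) (c (i + 1))

/-- The weight of a directed cycle. -/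
def diCycleWeight {V : Type*} (w : V → V → ℝ) {l : ℕ} (c : Fin (l + 1) → V) : ℝ :=
  ∑ i, w (c i) (c (i + 1))

/-- A cycle of minimum weight of an edge-weighted directed graph. -/
def IsMinWeightDiCycle {V : Type*} (G : Digraph V) (w : V → V → ℝ) {l : ℕ} (c : Fin (l + 1) → V) :
    Prop :=
  IsDiCycle G c ∧
    ∀ (l' : ℕ) (c' : Fin (l' + 1) → V), IsDiCycle G c' → diCycleWeight w c ≤ diCycleWeight w c'

/-! ## Input and output -/

/-- The `m` pairs `(src i, dst i)` list every edge of the undirected graph `G` exactly once (in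
any order, each edge in one of its two orientations). -/
def ListsEdges {V : Type*} (G : SimpleGraph V) {m : ℕ} (src dst : Fin m → V) : Prop :=
  Function.Injective (fun i => s(src i, dst i)) ∧
    Set.range (fun i => s(src i, dst i)) = G.edgeSet

/-- The `m` pairs `(src i, dst i)` list every edge of the directed graph `G` exactly once. -/
def ListsArcs {V : Type*} (G : Digraph V) {m : ℕ} (src dst : Fin m → V) : Prop :=
  Function.Injective (fun i => (src i, dst i)) ∧
    Set.range (fun i => (src i, dst i)) = {e : V × V | G.Adj e.1 e.2}

/-- The initial memory. Integer registers `0` and `1` hold the number `n` of vertices and the number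
`m` of edges; integer arrays `0` and `1` and real array `0` hold the two ends and the weights of the
edges; integer array `2` holds the parents of the vertices, where a root is its own parent.
Everything else is zero. -/
noncomputable def inputState {n m : ℕ} (src dst : Fin m → Fin n) (wt : Fin m → ℝ)
    (parent : Fin n → Option (Fin n)) : State where
  ireg x := if x = 0 then n else if x = 1 then m else 0
  rreg _ := 0
  iarr a j :=
    if a = 0 then (if h : j < m then (src ⟨j, h⟩ : ℕ) else 0)
    else if a = 1 then (if h : j < m then (dst ⟨j, h⟩ : ℕ) else 0)
    else if a = 2 then (if h : j < n then (((parent ⟨j, h⟩).getD ⟨j, h⟩ : Fin n) : ℕ) else 0)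
    else 0
  rarr a j := if a = 0 then (if h : j < m then wt ⟨j, h⟩ else 0) else 0

/-- The final memory answers the undirected problem: integer register `0` holds the length of a
minimum-weight cycle and integer array `0` its vertices in order, or the graph has no cycle and
integer register `0` holds `0`. -/
def OutputsMinCycle {n : ℕ} (G : SimpleGraph (Fin n)) (w : Sym2 (Fin n) → ℝ) (s : State) : Prop :=
  (G.IsAcyclic ∧ s.ireg 0 = 0) ∨
    ∃ (u : Fin n) (p : G.Walk u u), IsMinWeightCycle G w p ∧ s.ireg 0 = p.length ∧
      ∀ i < p.length, s.iarr 0 i = (p.getVert i : ℕ)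

/-- The final memory answers the directed problem, in the same format. -/
def OutputsMinDiCycle {n : ℕ} (G : Digraph (Fin n)) (w : Fin n → Fin n → ℝ) (s : State) : Prop :=
  ((∀ (l : ℕ) (c : Fin (l + 1) → Fin n), ¬ IsDiCycle G c) ∧ s.ireg 0 = 0) ∨
    ∃ (l : ℕ) (c : Fin (l + 1) → Fin n), IsMinWeightDiCycle G w c ∧ s.ireg 0 = l + 1 ∧
      ∀ i : Fin (l + 1), s.iarr 0 i = (c i : ℕ)

end TreeDepthCycle

namespace TreeDepthCycle

/-! ## A weakest precondition calculus with a clock -/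

/-! Delete the vertices one by one, ancestors before descendants. Before a vertex `r` is deleted,
find a lightest cycle through `r` that avoids the vertices deleted so far. Every cycle is considered
when the first of its vertices is deleted, so the best cycle over all rounds is a lightest cycle of
the graph. When the turn of `r` comes, its proper ancestors are gone. An edge joins a vertex to an
ancestor or a descendant, so a search from `r` meets only descendants of `r`
(`ForestOK.descendant`). Each vertex is therefore visited by at most one search per ancestor, that
is, by at most `k` searches, and exchanging the two sums (`ForestOK.sum_charge_le`) bounds all
searches by `k` times the cost of one.

The search is Dijkstra's algorithm, with distances `d` and a shortest path tree. In a directed graph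
a lightest cycle through `r` is given by an arc `u → r` with `d u + w` least. In an undirected
graph, call the subtree below a child of `r` a branch, and let `r` be a branch of its own. The
candidates are the edges `uv` outside the tree that join different branches, with weight `d u + w +
d v`. Such an edge closes a genuine cycle, because the two tree paths meet only in `r`
(`RunInv.cyc_of_tour`). Conversely every cycle through `r` contains such an edge, and its weight
bounds the candidate's because distances are at most the weights of its two arcs from `r`
(`RunInv.le_cycle`). Without such an edge the cycle would leave and re-enter `r` along tree edges of
one branch, so the two neighbours of `r` on it would coincide.

For the time bound the priority queue must decrease keys in constant amortised time. A hollow heap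
is used whose nodes never change. Linking two roots and decreasing a key both create a new node, and
the old node of the element is no longer current. On a decrease the new node takes all children of
the old one but the first two, by following two pointers (`HInv.push`). Since the first two
children, of the two highest ranks, always stay, a node of rank `r` has at least `2 ^ (r / 2)` nodes
below it (`Shape.two_pow_le`), so ranks of roots are logarithmic.

Correctness and time are proved together, in a weakest precondition calculus with a clock.
Amortisation means that loop invariants bound the clock plus a potential: 400 for each node of the
heap, 200 for each root on the stack, 100 for each occupied slot of the table of ranks. `wp_insert`,
`wp_extract`, `wp_search`, `wp_round` and `wp_rounds` lead to `wp_main`; `time_bound` turns its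
explicit bound into the required order of growth. -/

def State.setI (s : State) (x v : ℕ) : State :=
  { s with ireg := Function.update s.ireg x v }

def State.setR (s : State) (x : ℕ) (v : ℝ) : State :=
  { s with rreg := Function.update s.rreg x v }

def State.putI (s : State) (a i v : ℕ) : State :=
  { s with iarr := Function.update s.iarr a (Function.update (s.iarr a) i v) }

def State.putR (s : State) (a i : ℕ) (v : ℝ) : State :=
  { s with rarr := Function.update s.rarr a (Function.update (s.rarr a) i v) }

section StateLemmas

variable (s : State) (x y a b i v : ℕ) (r : ℝ)

@[simp] theorem setI_ireg : (s.setI x v).ireg y = if y = x then v else s.ireg y := by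
  simp [State.setI, Function.update_apply]
@[simp] theorem setI_rreg : (s.setI x v).rreg = s.rreg := rfl
@[simp] theorem setI_iarr : (s.setI x v).iarr = s.iarr := rfl
@[simp] theorem setI_rarr : (s.setI x v).rarr = s.rarr := rfl
@[simp] theorem setR_ireg : (s.setR x r).ireg = s.ireg := rfl
@[simp] theorem setR_rreg : (s.setR x r).rreg y = if y = x then r else s.rreg y := by
  simp [State.setR, Function.update_apply]
@[simp] theorem setR_iarr : (s.setR x r).iarr = s.iarr := rfl
@[simp] theorem setR_rarr : (s.setR x r).rarr = s.rarr := rfl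
@[simp] theorem putI_ireg : (s.putI a i v).ireg = s.ireg := rfl
@[simp] theorem putI_rreg : (s.putI a i v).rreg = s.rreg := rfl
@[simp] theorem putI_iarr : (s.putI a i v).iarr b =
    if b = a then Function.update (s.iarr a) i v else s.iarr b := by
  simp [State.putI, Function.update_apply]
@[simp] theorem putI_rarr : (s.putI a i v).rarr = s.rarr := rfl
@[simp] theorem putR_ireg : (s.putR a i r).ireg = s.ireg := rfl
@[simp] theorem putR_rreg : (s.putR a i r).rreg = s.rreg := rfl
@[simp] theorem putR_iarr : (s.putR a i r).iarr = s.iarr := rfl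
@[simp] theorem putR_rarr : (s.putR a i r).rarr b =
    if b = a then Function.update (s.rarr a) i r else s.rarr b := by
  simp [State.putR, Function.update_apply]

end StateLemmas

/-- Started in `s` when the clock shows `t`, the program `p` halts, and then `Q` holds of the clock
and the state. -/
def wp (p : Prog) (s : State) (t : ℕ) (Q : ℕ → State → Prop) : Prop :=
  ∃ u s', Exec p s u s' ∧ Q (t + u) s'

theorem wp.mono {p : Prog} {s : State} {t : ℕ} {Q Q' : ℕ → State → Prop} (h : wp p s t Q)
    (hQ : ∀ t' s', Q t' s' → Q' t' s') : wp p s t Q' := by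
  obtain ⟨u, s', he, hq⟩ := h
  exact ⟨u, s', he, hQ _ _ hq⟩

section Rules

variable {s : State} {t : ℕ} {Q : ℕ → State → Prop}

theorem wp_skip : wp .skip s t Q ↔ Q (t + 1) s := by
  constructor
  · rintro ⟨u, s', he, hq⟩; cases he; exact hq
  · intro h; exact ⟨_, _, .skip s, h⟩

theorem wp_setI {x : ℕ} {e : IExpr} :
    wp (.setI x e) s t Q ↔ Q (t + (e.cost + 1)) (s.setI x (e.eval s)) := by
  constructor
  · rintro ⟨u, s', he, hq⟩; cases he; exact hq
  · intro h; exact ⟨_, _, .setI s x e, h⟩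

theorem wp_setR {x : ℕ} {e : RExpr} :
    wp (.setR x e) s t Q ↔ Q (t + (e.cost + 1)) (s.setR x (e.eval s)) := by
  constructor
  · rintro ⟨u, s', he, hq⟩; cases he; exact hq
  · intro h; exact ⟨_, _, .setR s x e, h⟩

theorem wp_writeI {a : ℕ} {i e : IExpr} : wp (.writeI a i e) s t Q ↔
    Q (t + (i.cost + e.cost + 1)) (s.putI a (i.eval s) (e.eval s)) := by
  constructor
  · rintro ⟨u, s', he, hq⟩; cases he; exact hq
  · intro h; exact ⟨_, _, .writeI s a i e, h⟩

theorem wp_writeR {a : ℕ} {i : IExpr} {e : RExpr} : wp (.writeR a i e) s t Q ↔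
    Q (t + (i.cost + e.cost + 1)) (s.putR a (i.eval s) (e.eval s)) := by
  constructor
  · rintro ⟨u, s', he, hq⟩; cases he; exact hq
  · intro h; exact ⟨_, _, .writeR s a i e, h⟩

theorem wp_seq {p q : Prog} : wp (.seq p q) s t Q ↔ wp p s t fun t' s' => wp q s' t' Q := by
  constructor
  · rintro ⟨u, s', he, hq⟩
    cases he with
    | seq hp hq' => exact ⟨_, _, hp, _, _, hq', by rwa [add_assoc]⟩
  · rintro ⟨u, s', hp, u', s'', hq', h⟩
    exact ⟨_, _, .seq hp hq', by rwa [← add_assoc]⟩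

theorem wp_ite {b : Test} {p q : Prog} : wp (.ite b p q) s t Q ↔
    (b.Holds s → wp p s (t + b.cost) Q) ∧ (¬ b.Holds s → wp q s (t + b.cost) Q) := by
  constructor
  · rintro ⟨u, s', he, hq⟩
    cases he with
    | ite_true hb hp => exact ⟨fun _ => ⟨_, _, hp, by rwa [add_assoc]⟩, fun h => absurd hb h⟩
    | ite_false hb hp => exact ⟨fun h => absurd h hb, fun _ => ⟨_, _, hp, by rwa [add_assoc]⟩⟩
  · rintro ⟨h1, h2⟩
    by_cases hb : b.Holds s
    · obtain ⟨u, s', he, hq⟩ := h1 hb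
      exact ⟨_, _, .ite_true hb he, by rwa [← add_assoc]⟩
    · obtain ⟨u, s', he, hq⟩ := h2 hb
      exact ⟨_, _, .ite_false hb he, by rwa [← add_assoc]⟩

end Rules

/-! ### Frames -/

/-- The parts of the memory that a program can write: integer registers, real registers, integer
arrays, real arrays. -/
def Prog.mods : Prog → List ℕ × List ℕ × List ℕ × List ℕ
  | .skip => ([], [], [], [])
  | .setI x _ => ([x], [], [], [])
  | .setR x _ => ([], [x], [], [])
  | .writeI a _ _ => ([], [], [a], [])
  | .writeR a _ _ => ([], [], [], [a])
  | .seq p q => (p.mods.1 ++ q.mods.1, p.mods.2.1 ++ q.mods.2.1, p.mods.2.2.1 ++ q.mods.2.2.1,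
      p.mods.2.2.2 ++ q.mods.2.2.2)
  | .ite _ p q => (p.mods.1 ++ q.mods.1, p.mods.2.1 ++ q.mods.2.1, p.mods.2.2.1 ++ q.mods.2.2.1,
      p.mods.2.2.2 ++ q.mods.2.2.2)
  | .while _ p => p.mods

/-- `s'` agrees with `s` on everything that `p` cannot write. -/
structure Frame (p : Prog) (s s' : State) : Prop where
  ireg : ∀ x, x ∉ p.mods.1 → s'.ireg x = s.ireg x
  rreg : ∀ x, x ∉ p.mods.2.1 → s'.rreg x = s.rreg x
  iarr : ∀ x, x ∉ p.mods.2.2.1 → s'.iarr x = s.iarr x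
  rarr : ∀ x, x ∉ p.mods.2.2.2 → s'.rarr x = s.rarr x

theorem Frame.refl (p : Prog) (s : State) : Frame p s s :=
  ⟨fun _ _ => rfl, fun _ _ => rfl, fun _ _ => rfl, fun _ _ => rfl⟩

theorem Frame.trans {p : Prog} {s s' s'' : State} (h : Frame p s s') (h' : Frame p s' s'') :
    Frame p s s'' :=
  ⟨fun x hx => (h'.ireg x hx).trans (h.ireg x hx), fun x hx => (h'.rreg x hx).trans (h.rreg x hx),
    fun x hx => (h'.iarr x hx).trans (h.iarr x hx), fun x hx => (h'.rarr x hx).trans (h.rarr x hx)⟩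

/-- Specifications then need to mention only what changes. For a concrete program the side condition
is membership in an explicit list, which is why its uses end in `decide`. -/
theorem Exec.frame {p : Prog} {s s' : State} {t : ℕ} (h : Exec p s t s') : Frame p s s' := by
  induction h with
  | skip s => exact Frame.refl _ _
  | setI s x e => constructor <;> simp +contextual [Prog.mods]
  | setR s x e => constructor <;> simp +contextual [Prog.mods]
  | writeI s a i e => constructor <;> simp +contextual [Prog.mods]
  | writeR s a i e => constructor <;> simp +contextual [Prog.mods]
  | seq _ _ h1 h2 =>
    constructor <;> intro x hx <;> simp only [Prog.mods, List.mem_append, not_or] at hx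
    · rw [h2.ireg x hx.2, h1.ireg x hx.1]
    · rw [h2.rreg x hx.2, h1.rreg x hx.1]
    · rw [h2.iarr x hx.2, h1.iarr x hx.1]
    · rw [h2.rarr x hx.2, h1.rarr x hx.1]
  | ite_true _ _ h1 =>
    constructor <;> intro x hx <;> simp only [Prog.mods, List.mem_append, not_or] at hx
    · rw [h1.ireg x hx.1]
    · rw [h1.rreg x hx.1]
    · rw [h1.iarr x hx.1]
    · rw [h1.rarr x hx.1]
  | ite_false _ _ h1 =>
    constructor <;> intro x hx <;> simp only [Prog.mods, List.mem_append, not_or] at hx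
    · rw [h1.ireg x hx.2]
    · rw [h1.rreg x hx.2]
    · rw [h1.iarr x hx.2]
    · rw [h1.rarr x hx.2]
  | while_false _ => exact Frame.refl _ _
  | while_true _ _ _ h1 h2 => exact Frame.trans (p := Prog.while _ _) ⟨h1.1, h1.2, h1.3, h1.4⟩ h2

theorem wp.frame {p : Prog} {s : State} {t : ℕ} {Q : ℕ → State → Prop} (h : wp p s t Q) :
    wp p s t fun t' s' => Q t' s' ∧ Frame p s s' := by
  obtain ⟨u, s', he, hq⟩ := h
  exact ⟨u, s', he, hq, he.frame⟩

/-- Sequencing with a specification of the first program, whose frame comes for free. -/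
theorem wp_seq_of {p q : Prog} {s : State} {t : ℕ} {Q Q' : ℕ → State → Prop} (h : wp p s t Q')
    (hq : ∀ t' s', Frame p s s' → Q' t' s' → wp q s' t' Q) : wp (.seq p q) s t Q := by
  rw [wp_seq]
  exact h.frame.mono fun t' s' h' => hq t' s' h'.2 h'.1

/-- The rule for loops: the clock is bounded as long as the invariant holds, hence the loop
halts. -/
theorem wp_while {b : Test} {p : Prog} {s : State} {t : ℕ} {Q : ℕ → State → Prop}
    (I : ℕ → State → Prop) (T : ℕ) (h0 : I t s) (hT : ∀ t' s', I t' s' → t' ≤ T)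
    (hstep : ∀ t' s', Frame p s s' → I t' s' → b.Holds s' → wp p s' (t' + b.cost) I)
    (hexit : ∀ t' s', Frame p s s' → I t' s' → ¬ b.Holds s' → Q (t' + b.cost) s') :
    wp (.while b p) s t Q := by
  -- Evaluating the test already advances the clock, so the remaining time `T - t'` decreases in
  -- every pass and can drive the induction.
  have hcost : 0 < b.cost := by cases b <;> simp [Test.cost]
  have key : ∀ k t' s', T - t' ≤ k → t' ≤ T → Frame p s s' → I t' s' →
      wp (.while b p) s' t' Q := by
    intro k
    induction k using Nat.strong_induction_on with
    | _ k ih =>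
      intro t' s' hk hle hf hI
      by_cases hb : b.Holds s'
      · obtain ⟨u, s₁, he, hI'⟩ := hstep t' s' hf hI hb
        have hle' := hT _ _ hI'
        obtain ⟨u', s₂, he', hq⟩ := ih (T - (t' + b.cost + u)) (by omega) _ _ le_rfl hle'
          (hf.trans he.frame) hI'
        exact ⟨_, _, .while_true hb he he', by convert hq using 1; omega⟩
      · exact ⟨_, _, .while_false hb, hexit t' s' hf hI hb⟩
  exact key _ t s le_rfl (hT _ _ h0) (Frame.refl _ _) h0

/-! ## Hollow heaps

Nodes are numbered in the order of their creation and never change: `kids x` lists the children of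
the node `x`, `item x` is the element it was created for and `key x` its key. The node `nd v` is the
current node of the element `v` (`0` if `v` is not in the heap). A node that is not current is
*hollow*; only its first two children count, the others have been given to another node. -/

section Heap

variable {kids kids' : ℕ → List ℕ} {item nd : ℕ → ℕ} {key d : ℕ → ℝ} {cnt : ℕ} {L : Multiset ℕ}

/-- The children of a node that count. -/
def lk (kids : ℕ → List ℕ) (item nd : ℕ → ℕ) (x : ℕ) : List ℕ :=
  if nd (item x) = x then kids x else (kids x).take 2

/-- The ranks in a list of siblings are `l - 1, …, 1, 0`. -/
def Ranked (kids : ℕ → List ℕ) : List ℕ → Prop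
  | [] => True
  | y :: l => (kids y).length = l.length ∧ Ranked kids l

/-- Number of nodes of the tree with root `x`. -/
def lsize (c : ℕ → List ℕ) (x : ℕ) : ℕ :=
  if x = 0 then 0
  -- The guard makes the recursion terminate. In a heap it always holds, because children are
  -- created before their parents.
  else 1 + ((c x).attach.map fun y => if _ : y.1 < x then lsize c y.1 else 0).sum
termination_by x

/-- Number of nodes of the trees with roots in `L`. -/
def lsum (c : ℕ → List ℕ) (L : Multiset ℕ) : ℕ := (L.map (lsize c)).sum

def Reach (c : ℕ → List ℕ) : ℕ → ℕ → Prop := Relation.ReflTransGen fun a b => b ∈ c a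

/-- Ranks count down to 0, so a suffix of a list of siblings is again such a list. Hence a new node
may take over all children but the first two. -/
theorem Ranked.drop {l : List ℕ} (h : Ranked kids l) (i : ℕ) : Ranked kids (l.drop i) := by
  induction l generalizing i with
  | nil => simpa using h
  | cons y l ih =>
    cases i with
    | zero => exact h
    | succ i => exact ih h.2 i

theorem Ranked.congr {l : List ℕ} (h : Ranked kids l) (hk : ∀ y ∈ l, kids' y = kids y) :
    Ranked kids' l := by
  induction l with
  | nil => trivial
  | cons y l ih =>
    exact ⟨by rw [hk y (by simp)]; exact h.1, ih h.2 fun z hz => hk z (by simp [hz])⟩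

/-! ### Sizes and reachability in the trees of the heap. -/

theorem lsize_zero (c : ℕ → List ℕ) : lsize c 0 = 0 := by
  rw [lsize]; simp

theorem lsize_eq {c : ℕ → List ℕ} {x : ℕ} (hx : x ≠ 0) (h : ∀ y ∈ c x, y < x) :
    lsize c x = 1 + ((c x).map (lsize c)).sum := by
  rw [lsize, if_neg hx]
  congr 2
  rw [← List.attach_map_subtype_val (c x), List.map_map, List.attach_map_subtype_val]
  exact List.map_congr_left fun y _ => by simp [h y.1 y.2]

theorem sum_map_add_le {f g : ℕ → ℕ} {y S : ℕ} (hy : y ∈ L) (h : ∀ z ∈ L, f z ≤ g z)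
    (hS : f y + S ≤ g y) : (L.map f).sum + S ≤ (L.map g).sum := by
  obtain ⟨L', rfl⟩ := Multiset.exists_cons_of_mem hy
  have := Multiset.sum_map_le_sum_map (s := L') f g fun z hz => h z (by simp [hz])
  simp only [Multiset.map_cons, Multiset.sum_cons]
  omega

/-- A node that becomes hollow loses some of its counting children, and old nodes gain none. The
hypotheses stop at `x` because the newest node is an exception: it had no children before. -/
theorem lsize_le {c c' : ℕ → List ℕ} {x : ℕ} (hlt : ∀ y ≤ x, ∀ z ∈ c y, z < y)
    (h : ∀ y ≤ x, (c' y).Sublist (c y)) : lsize c' x ≤ lsize c x := by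
  induction x using Nat.strong_induction_on with
  | _ x ih =>
    rcases Nat.eq_zero_or_pos x with rfl | hx
    · simp [lsize_zero]
    rw [lsize_eq hx.ne' (hlt x le_rfl),
      lsize_eq hx.ne' fun y hy => hlt x le_rfl y ((h x le_rfl).subset hy)]
    have h1 : ((c' x).map (lsize c')).sum ≤ ((c' x).map (lsize c)).sum :=
      List.sum_le_sum fun y hy => by
        have hyx := hlt x le_rfl y ((h x le_rfl).subset hy)
        exact ih y hyx (fun z hz => hlt z (by omega)) fun z hz => h z (by omega)
    have h2 : ((c' x).map (lsize c)).sum ≤ ((c x).map (lsize c)).sum :=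
      ((h x le_rfl).map _).sum_le_sum fun _ _ => Nat.zero_le _
    omega

theorem Reach.le {c : ℕ → List ℕ} (hlt : ∀ x, ∀ y ∈ c x, y < x) {x y : ℕ} (h : Reach c x y) :
    y ≤ x := by
  induction h with
  | refl => exact le_rfl
  | tail _ h2 ih => exact (hlt _ _ h2).le.trans ih

/-- A loss of `S` nodes at `u` is felt in full at every node above `u`. When `u` hands children over
to a new root, this loss pays for them there, so that the heap grows by the new root only. -/
theorem lsize_add_le {c c' : ℕ → List ℕ} {x u S : ℕ} (hlt : ∀ x, ∀ y ∈ c x, 0 < y ∧ y < x)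
    (hc : ∀ y ≤ x, y ≠ u → c' y = c y) (hle : ∀ y ≤ x, lsize c' y ≤ lsize c y)
    (hS : lsize c' u + S ≤ lsize c u) (h : Reach c x u) : lsize c' x + S ≤ lsize c x := by
  induction h using Relation.ReflTransGen.head_induction_on with
  | refl => exact hS
  | @head x y hxy hyu ih =>
    have hyx := hlt _ _ hxy
    have huy : u ≤ y := Reach.le (fun x y h => (hlt x y h).2) hyu
    have hcx := hc x le_rfl (by omega)
    rw [lsize_eq (by omega) fun z hz => (hlt x z hz).2,
      lsize_eq (by omega) fun z hz => (hlt x z (hcx ▸ hz)).2, hcx]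
    have := sum_map_add_le (L := (c x : Multiset ℕ)) (f := lsize c') (g := lsize c) (y := y)
      (S := S) (by simpa using hxy) (fun z hz => hle z (hlt x z (by simpa using hz)).2.le)
      (ih (fun z hz => hc z (by omega)) fun z hz => hle z (by omega))
    simp only [Multiset.map_coe, Multiset.sum_coe] at this
    omega

/-- Follow the old path: edges that do not start at `x₀` survive, and edges out of `x₀` end in a
node that is covered anew. In this way each operation shows that current nodes, other than the one
it replaces, stay below a root. -/
theorem reach_transfer {c c' : ℕ → List ℕ} {L' : Multiset ℕ} {x₀ : ℕ}
    (h1 : ∀ a, a ≠ x₀ → ∀ b ∈ c a, b ∈ c' a)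
    (h2 : ∀ b ∈ c x₀, ∃ x ∈ L', Reach c' x b)
    (h3 : ∀ x ∈ L, x = x₀ ∨ ∃ x' ∈ L', Reach c' x' x) {y : ℕ}
    (h : ∃ x ∈ L, Reach c x y) : y = x₀ ∨ ∃ x' ∈ L', Reach c' x' y := by
  obtain ⟨x, hx, hr⟩ := h
  induction hr with
  | refl => exact h3 x hx
  | @tail a b _ hab ih =>
    by_cases ha : a = x₀
    · subst ha; exact .inr (h2 b hab)
    · obtain ⟨x', hx', hr'⟩ := ih.resolve_left ha
      exact .inr ⟨x', hx', hr'.tail (h1 a ha b hab)⟩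

/-- The facts about nodes that never change. -/
structure Shape (kids : ℕ → List ℕ) (key : ℕ → ℝ) (cnt : ℕ) : Prop where
  lt : ∀ x, ∀ y ∈ kids x, 0 < y ∧ y < x
  fresh : ∀ x, cnt ≤ x → kids x = []
  key_le : ∀ x, ∀ y ∈ kids x, key x ≤ key y
  ranked : ∀ x, Ranked kids (kids x)

/-- A hollow heap with roots `L` (the number `0` stands for no root) in which the element `v` has
the key `d v`. -/
structure HInv (kids : ℕ → List ℕ) (item nd : ℕ → ℕ) (key d : ℕ → ℝ) (cnt : ℕ) (L : Multiset ℕ) :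
    Prop extends Shape kids key cnt where
  cnt_pos : 0 < cnt
  roots : ∀ x ∈ L, x < cnt
  live : ∀ v, nd v ≠ 0 → item (nd v) = v ∧ nd v < cnt ∧ key (nd v) = d v ∧
    ∃ x ∈ L, Reach (lk kids item nd) x (nd v)

theorem lk_subset {x y : ℕ} (h : y ∈ lk kids item nd x) : y ∈ kids x := by
  unfold lk at h
  split_ifs at h
  · exact h
  · exact List.mem_of_mem_take h

theorem Shape.lk_lt (h : Shape kids key cnt) {x y : ℕ} (hy : y ∈ lk kids item nd x) :
    0 < y ∧ y < x :=
  h.lt x y (lk_subset hy)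

theorem Shape.kids_zero (h : Shape kids key cnt) : kids 0 = [] :=
  List.eq_nil_iff_forall_not_mem.2 fun y hy => by have := h.lt 0 y hy; omega

theorem Shape.key_le_of_reach (h : Shape kids key cnt) {x y : ℕ}
    (hr : Reach (lk kids item nd) x y) : key x ≤ key y := by
  induction hr with
  | refl => exact le_rfl
  | tail _ h2 ih => exact ih.trans (h.key_le _ _ (lk_subset h2))

/-- A tree whose root has rank `r` has at least `2 ^ (r / 2)` nodes. -/
theorem Shape.two_pow_le (h : Shape kids key cnt) {x : ℕ} (hx : x ≠ 0) :
    2 ^ ((kids x).length / 2) ≤ lsize (lk kids item nd) x := by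
  induction x using Nat.strong_induction_on with
  | _ x ih =>
    rw [lsize_eq hx fun y hy => (h.lk_lt hy).2]
    have hsub : ((kids x).take 2).Sublist (lk kids item nd x) := by
      unfold lk
      split_ifs
      · exact List.take_sublist _ _
      · exact List.Sublist.refl _
    have h1 := (hsub.map (lsize (lk kids item nd))).sum_le_sum fun _ _ => Nat.zero_le _
    have hlt := h.lt x
    have hr := h.ranked x
    match hk : kids x with
    | [] => simp
    | [y] => simp
    -- The first two children count whether or not `x` is hollow. Their ranks are `l.length + 1` and
    -- `l.length`, so each of their trees has at least `2 ^ (l.length / 2)` nodes, and the two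
    -- together give the factor 2.
    | y :: z :: l =>
      rw [hk] at h1 hlt hr
      have hy := hlt y (by simp)
      have hz := hlt z (by simp)
      have iy := ih y hy.2 hy.1.ne'
      have iz := ih z hz.2 hz.1.ne'
      rw [hr.1, List.length_cons] at iy
      rw [hr.2.1] at iz
      simp only [List.take_succ_cons, List.take_zero, List.map_cons, List.map_nil, List.sum_cons,
        List.sum_nil] at h1
      have e : (y :: z :: l).length / 2 = l.length / 2 + 1 := by
        simp only [List.length_cons]; omega
      have : 2 ^ (l.length / 2) ≤ 2 ^ ((l.length + 1) / 2) :=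
        Nat.pow_le_pow_right (by norm_num) (by omega)
      rw [e, pow_succ]
      omega

theorem HInv.two_pow_le (h : HInv kids item nd key d cnt L) {x : ℕ} (hx : x ≠ 0) (hL : x ∈ L) :
    2 ^ ((kids x).length / 2) ≤ lsum (lk kids item nd) L := by
  refine (h.toShape.two_pow_le (item := item) (nd := nd) hx).trans ?_
  exact Multiset.single_le_sum (fun _ _ => Nat.zero_le _) _ (Multiset.mem_map_of_mem _ hL)

/-- If all roots are full, the root with the least key has the least key of all. -/
theorem HInv.key_min (h : HInv kids item nd key d cnt L) {k : ℝ} (hk : ∀ x ∈ L, x ≠ 0 → k ≤ key x)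
    {v : ℕ} (hv : nd v ≠ 0) : k ≤ d v := by
  obtain ⟨_, _, h3, x, hx, hr⟩ := h.live v hv
  have hx0 : x ≠ 0 := by
    have := Reach.le (fun a b hb => (h.lk_lt hb).2) hr
    omega
  rw [← h3]
  exact (hk x hx hx0).trans (h.key_le_of_reach hr)

theorem HInv.eq_zero_of_roots (h : HInv kids item nd key d cnt L) (hL : ∀ x ∈ L, x = 0) (v : ℕ) :
    nd v = 0 := by
  by_contra hv
  obtain ⟨_, _, _, x, hx, hr⟩ := h.live v hv
  have := Reach.le (fun a b hb => (h.lk_lt hb).2) hr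
  have := hL x hx
  omega

/-- A hollow root is replaced by its children. -/
theorem HInv.pop {x : ℕ} (h : HInv kids item nd key d cnt (x ::ₘ L)) (hx : nd (item x) ≠ x) :
    HInv kids item nd key d cnt (↑((kids x).take 2) + L) := by
  have hlk : lk kids item nd x = (kids x).take 2 := if_neg hx
  refine ⟨h.toShape, h.cnt_pos, fun y hy => ?_, fun v hv => ?_⟩
  · rcases Multiset.mem_add.1 hy with hy | hy
    · have := h.lt x y (List.mem_of_mem_take (by simpa using hy))
      have := h.roots x (by simp)
      omega
    · exact h.roots y (by simp [hy])
  · obtain ⟨h1, h2, h3, h4⟩ := h.live v hv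
    refine ⟨h1, h2, h3, ?_⟩
    refine (reach_transfer (x₀ := x) (fun a _ b hb => hb) (fun b hb => ?_) (fun y hy => ?_)
      h4).resolve_left ?_
    · exact ⟨b, by rw [hlk] at hb; simp [hb], .refl⟩
    · rcases Multiset.mem_cons.1 hy with hy | hy
      · exact .inl hy
      · exact .inr ⟨y, by simp [hy], .refl⟩
    · intro e; rw [← e, h1] at hx; exact hx rfl

/-- Exactly the counting children of the hollow root become roots, so only the root itself
disappears. This unit of size pays for the removal. -/
theorem HInv.lsum_pop {x : ℕ} (h : HInv kids item nd key d cnt (x ::ₘ L)) (hx0 : x ≠ 0)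
    (hx : nd (item x) ≠ x) :
    lsum (lk kids item nd) (↑((kids x).take 2) + L) + 1 = lsum (lk kids item nd) (x ::ₘ L) := by
  have hlk : lk kids item nd x = (kids x).take 2 := if_neg hx
  simp only [lsum, Multiset.map_add, Multiset.sum_add, Multiset.map_cons, Multiset.sum_cons,
    Multiset.map_coe, Multiset.sum_coe]
  rw [lsize_eq hx0 fun y hy => (h.lk_lt hy).2, hlk]
  omega

/-- Of two full roots of equal rank, the one with the larger key becomes a child of a new node that
replaces the other one. -/
theorem HInv.link {x y : ℕ} (h : HInv kids item nd key d cnt (x ::ₘ y ::ₘ L)) (hx0 : x ≠ 0)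
    (hy0 : y ≠ 0) (hx : nd (item x) = x) (hr : (kids x).length = (kids y).length)
    (hk : key x ≤ key y) :
    HInv (Function.update kids cnt (y :: kids x)) (Function.update item cnt (item x))
      (Function.update nd (item x) cnt) (Function.update key cnt (key x)) d (cnt + 1)
      (cnt ::ₘ L) ∧
    lsum (lk (Function.update kids cnt (y :: kids x)) (Function.update item cnt (item x))
      (Function.update nd (item x) cnt)) (cnt ::ₘ L) ≤
      lsum (lk kids item nd) (x ::ₘ y ::ₘ L) := by
  have hxc := h.roots x (by simp)
  have hyc := h.roots y (by simp)
  set kids' := Function.update kids cnt (y :: kids x) with hkids'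
  set item' := Function.update item cnt (item x) with hitem'
  set nd' := Function.update nd (item x) cnt with hnd'
  set key' := Function.update key cnt (key x) with hkey'
  have ekids : ∀ a, a ≠ cnt → kids' a = kids a := fun a ha => by simp [hkids', ha]
  have ekey : ∀ a, a ≠ cnt → key' a = key a := fun a ha => by simp [hkey', ha]
  have eitem : ∀ a, a ≠ cnt → item' a = item a := fun a ha => by simp [hitem', ha]
  have kcnt : kids' cnt = y :: kids x := by simp [hkids']
  have lcnt : lk kids' item' nd' cnt = y :: kids x := by
    rw [lk, if_pos (by simp [hitem', hnd']), kcnt]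
  have hlt : ∀ a, ∀ b ∈ kids' a, 0 < b ∧ b < a := by
    intro a b hb
    by_cases ha : a = cnt
    · subst ha
      rw [kcnt] at hb
      rcases List.mem_cons.1 hb with rfl | hb
      · omega
      · have := h.lt x b hb; omega
    · rw [ekids a ha] at hb; exact h.lt a b hb
  have hltc : ∀ a, ∀ b ∈ kids a, b ≠ cnt := by
    intro a b hb e
    by_cases ha : cnt ≤ a
    · rw [h.fresh a ha] at hb; simp at hb
    · have := h.lt a b hb; omega
  have hsub : ∀ a, a ≠ cnt → (lk kids' item' nd' a).Sublist (lk kids item nd a) := by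
    intro a ha
    unfold lk
    rw [ekids a ha, eitem a ha]
    by_cases he : item a = item x
    · rw [he, show nd' (item x) = cnt by simp [hnd'], if_neg (Ne.symm ha)]
      split_ifs
      · exact List.take_sublist _ _
      · exact List.Sublist.refl _
    · rw [show nd' (item a) = nd (item a) by simp [hnd', he]]
  have hle : ∀ a < cnt, lsize (lk kids' item' nd') a ≤ lsize (lk kids item nd) a := fun a ha =>
    lsize_le (fun b _ z hz => (h.lk_lt hz).2) fun b hb => hsub b (by omega)
  have hxcov : ∀ b ∈ lk kids item nd x, ∃ z ∈ cnt ::ₘ L, Reach (lk kids' item' nd') z b :=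
    fun b hb => ⟨cnt, by simp, .single (by rw [lcnt]; simp [lk_subset hb])⟩
  refine ⟨⟨⟨hlt, fun a ha => ?_, fun a b hb => ?_, fun a => ?_⟩, by omega, fun a ha => ?_,
    fun v hv => ?_⟩, ?_⟩
  · rw [ekids a (by omega)]; exact h.fresh a (by omega)
  · by_cases ha : a = cnt
    · subst ha
      rw [kcnt] at hb
      rw [show key' a = key x by simp [hkey']]
      rcases List.mem_cons.1 hb with rfl | hb
      · rw [ekey b (by omega)]; exact hk
      · rw [ekey b (hltc x b hb)]; exact h.key_le x b hb
    · rw [ekids a ha] at hb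
      rw [ekey a ha, ekey b (hltc a b hb)]; exact h.key_le a b hb
  · by_cases ha : a = cnt
    · subst ha
      rw [kcnt]
      exact ⟨by rw [ekids y (by omega), hr], (h.ranked x).congr fun b hb => ekids b (hltc x b hb)⟩
    · rw [ekids a ha]
      exact (h.ranked a).congr fun b hb => ekids b (hltc a b hb)
  · rcases Multiset.mem_cons.1 ha with rfl | ha
    · omega
    · have := h.roots a (by simp [ha]); omega
  · by_cases hvx : v = item x
    · have e : nd' v = cnt := by simp [hnd', hvx]
      rw [e]
      refine ⟨by simp [hitem', hvx], by omega, ?_, cnt, by simp, .refl⟩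
      have := (h.live v (by rw [hvx, hx]; exact hx0)).2.2.1
      rw [← this, hvx, hx]
      simp [hkey']
    · have e : nd' v = nd v := by simp [hnd', hvx]
      rw [e] at hv ⊢
      obtain ⟨h1, h2, h3, h4⟩ := h.live v hv
      refine ⟨by rw [eitem _ (by omega), h1], by omega, by rw [ekey _ (by omega), h3], ?_⟩
      refine (reach_transfer (x₀ := x) (fun a ha b hb => ?_) hxcov (fun a ha => ?_)
        h4).resolve_left ?_
      · have hac : a ≠ cnt := by
          rintro rfl
          have := lk_subset hb
          rw [h.fresh a le_rfl] at this
          simp at this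
        unfold lk at hb ⊢
        rw [ekids a hac, eitem a hac]
        -- A node other than `x` made for the same element is hollow before and after the link, so
        -- its counting children stay the same.
        by_cases he : item a = item x
        · rw [he, show nd' (item x) = cnt by simp [hnd'], if_neg (Ne.symm hac)]
          rw [he, hx, if_neg (Ne.symm ha)] at hb
          exact hb
        · rw [show nd' (item a) = nd (item a) by simp [hnd', he]]
          exact hb
      · rcases Multiset.mem_cons.1 ha with ha | ha
        · exact .inl ha
        rcases Multiset.mem_cons.1 ha with rfl | ha
        · exact .inr ⟨cnt, by simp, .single (by rw [lcnt]; simp)⟩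
        · exact .inr ⟨a, by simp [ha], .refl⟩
      · intro e'; rw [e'] at h1; exact hvx h1.symm
  · have e1 : lsize (lk kids' item' nd') cnt =
        1 + (lsize (lk kids' item' nd') y + ((kids x).map (lsize (lk kids' item' nd'))).sum) := by
      rw [lsize_eq (by omega) fun b hb => (hlt _ b (lk_subset hb)).2, lcnt]
      simp
    have e2 : lsize (lk kids item nd) x = 1 + ((kids x).map (lsize (lk kids item nd))).sum := by
      rw [lsize_eq hx0 fun y hy => (h.lk_lt hy).2, lk, if_pos hx]
    have e3 := hle y hyc
    have e4 : ((kids x).map (lsize (lk kids' item' nd'))).sum ≤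
        ((kids x).map (lsize (lk kids item nd))).sum :=
      List.sum_le_sum fun b hb => hle b (by have := h.lt x b hb; omega)
    have e5 := Multiset.sum_map_le_sum_map (s := L) (lsize (lk kids' item' nd'))
      (lsize (lk kids item nd)) fun b hb => hle b (h.roots b (by simp [hb]))
    simp only [lsum, Multiset.map_cons, Multiset.sum_cons]
    omega

/-- The element `v` is inserted with the key `k`, or its key is decreased to `k`: a new node takes
over all but two children of the old one. -/
theorem HInv.push {v : ℕ} {k : ℝ} (h : HInv kids item nd key d cnt L)
    (hk : nd v ≠ 0 → k ≤ d v) :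
    HInv (Function.update kids cnt ((kids (nd v)).drop 2)) (Function.update item cnt v)
      (Function.update nd v cnt) (Function.update key cnt k) (Function.update d v k) (cnt + 1)
      (cnt ::ₘ L) ∧
    lsum (lk (Function.update kids cnt ((kids (nd v)).drop 2)) (Function.update item cnt v)
      (Function.update nd v cnt)) (cnt ::ₘ L) ≤ lsum (lk kids item nd) L + 1 := by
  set y := nd v with hy
  set kids' := Function.update kids cnt ((kids y).drop 2) with hkids'
  set item' := Function.update item cnt v with hitem'
  set nd' := Function.update nd v cnt with hnd'
  set key' := Function.update key cnt k with hkey'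
  set d' := Function.update d v k with hd'
  have hyc : y < cnt := by
    by_cases e : y = 0
    · rw [e]; exact h.cnt_pos
    · exact (h.live v e).2.1
  have ekids : ∀ a, a ≠ cnt → kids' a = kids a := fun a ha => by simp [hkids', ha]
  have ekey : ∀ a, a ≠ cnt → key' a = key a := fun a ha => by simp [hkey', ha]
  have eitem : ∀ a, a ≠ cnt → item' a = item a := fun a ha => by simp [hitem', ha]
  have kcnt : kids' cnt = (kids y).drop 2 := by simp [hkids']
  have lcnt : lk kids' item' nd' cnt = (kids y).drop 2 := by
    rw [lk, if_pos (by simp [hitem', hnd']), kcnt]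
  have hlt : ∀ a, ∀ b ∈ kids' a, 0 < b ∧ b < a := by
    intro a b hb
    by_cases ha : a = cnt
    · subst ha
      rw [kcnt] at hb
      have := h.lt y b (List.mem_of_mem_drop hb); omega
    · rw [ekids a ha] at hb; exact h.lt a b hb
  have hltc : ∀ a, ∀ b ∈ kids a, b ≠ cnt := by
    intro a b hb e
    by_cases ha : cnt ≤ a
    · rw [h.fresh a ha] at hb; simp at hb
    · have := h.lt a b hb; omega
  have heq : ∀ a, a ≠ cnt → a ≠ y → (lk kids' item' nd' a) = (lk kids item nd a) := by
    intro a ha hay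
    unfold lk
    rw [ekids a ha, eitem a ha]
    by_cases he : item a = v
    · rw [he, show nd' v = cnt by simp [hnd'], if_neg (Ne.symm ha), ← hy, if_neg (Ne.symm hay)]
    · rw [show nd' (item a) = nd (item a) by simp [hnd', he]]
  have hyl : y ≠ 0 → lk kids' item' nd' y = (kids y).take 2 ∧ lk kids item nd y = kids y := by
    intro hy0
    have hi := (h.live v hy0).1
    rw [← hy] at hi
    unfold lk
    rw [ekids y (by omega), eitem y (by omega), hi, show nd' v = cnt by simp [hnd'], ← hy]
    exact ⟨if_neg (by omega), if_pos rfl⟩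
  have hsub : ∀ a, a ≠ cnt → (lk kids' item' nd' a).Sublist (lk kids item nd a) := by
    intro a ha
    by_cases hay : a = y
    · by_cases hy0 : y = 0
      · have : kids' a = [] := by rw [ekids a ha, hay, hy0]; exact h.kids_zero
        unfold lk
        rw [this]; simp
      · rw [hay, (hyl hy0).1, (hyl hy0).2]
        exact List.take_sublist _ _
    · rw [heq a ha hay]
  have hle : ∀ a < cnt, lsize (lk kids' item' nd') a ≤ lsize (lk kids item nd) a := fun a ha =>
    lsize_le (fun b _ z hz => (h.lk_lt hz).2) fun b hb => hsub b (by omega)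
  refine ⟨⟨⟨hlt, fun a ha => ?_, fun a b hb => ?_, fun a => ?_⟩, by omega, fun a ha => ?_,
    fun u hu => ?_⟩, ?_⟩
  · rw [ekids a (by omega)]; exact h.fresh a (by omega)
  · by_cases ha : a = cnt
    · subst ha
      rw [kcnt] at hb
      have hb' := List.mem_of_mem_drop hb
      rw [show key' a = k by simp [hkey'], ekey b (hltc y b hb')]
      have hy0 : y ≠ 0 := by
        intro e; rw [e, h.kids_zero] at hb'; simp at hb'
      refine (hk hy0).trans ?_
      rw [← (h.live v hy0).2.2.1]
      exact h.key_le _ b hb'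
    · rw [ekids a ha] at hb
      rw [ekey a ha, ekey b (hltc a b hb)]; exact h.key_le a b hb
  · by_cases ha : a = cnt
    · subst ha
      rw [kcnt]
      exact ((h.ranked y).drop 2).congr fun b hb => ekids b (hltc y b (List.mem_of_mem_drop hb))
    · rw [ekids a ha]
      exact (h.ranked a).congr fun b hb => ekids b (hltc a b hb)
  · rcases Multiset.mem_cons.1 ha with rfl | ha
    · omega
    · have := h.roots a ha; omega
  · by_cases huv : u = v
    · have e : nd' u = cnt := by simp [hnd', huv]
      rw [e]
      exact ⟨by simp [hitem', huv], by omega, by simp [hkey', hd', huv], cnt, by simp, .refl⟩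
    · have e : nd' u = nd u := by simp [hnd', huv]
      rw [e] at hu ⊢
      obtain ⟨h1, h2, h3, h4⟩ := h.live u hu
      refine ⟨by rw [eitem _ (by omega), h1], by omega,
        by rw [ekey _ (by omega), h3]; simp [hd', huv], ?_⟩
      by_cases hy0 : y = 0
      · obtain ⟨r, hr, hp⟩ := h4
        refine ⟨r, by simp [hr], Relation.ReflTransGen.mono (fun a b hb => ?_) _ _ hp⟩
        have hac : a ≠ cnt := by
          rintro rfl
          have := lk_subset hb
          rw [h.fresh a le_rfl] at this
          simp at this
        have hay : a ≠ y := by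
          rintro rfl
          have := lk_subset hb
          rw [hy0, h.kids_zero] at this
          simp at this
        rw [heq a hac hay]; exact hb
      obtain ⟨r, hr, hry⟩ := (h.live v hy0).2.2.2
      rw [← hy] at hry
      -- The nodes above `y` on the path have larger numbers than `y`, and their lists of children
      -- are untouched.
      have hyreach : Reach (lk kids' item' nd') r y := by
        clear h4
        have hrc := h.roots r hr
        clear hr
        induction hry using Relation.ReflTransGen.head_induction_on with
        | refl => exact .refl
        | @head a b hab hbu ih =>
          have hba := h.lk_lt hab
          have hyb : y ≤ b := Reach.le (fun x y h' => (h.lk_lt h').2) hbu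
          refine .head ?_ (ih (by omega))
          rw [heq a (by omega) (by omega)]
          exact hab
      refine (reach_transfer (x₀ := y) (fun a ha b hb => ?_) (fun b hb => ?_) (fun a ha => ?_)
        h4).resolve_left ?_
      · have hac : a ≠ cnt := by
          rintro rfl
          have := lk_subset hb
          rw [h.fresh a le_rfl] at this
          simp at this
        rw [heq a hac ha]; exact hb
      · rw [(hyl hy0).2, ← List.take_append_drop 2 (kids y)] at hb
        rcases List.mem_append.1 hb with hb | hb
        · exact ⟨r, by simp [hr], hyreach.tail (by rw [(hyl hy0).1]; exact hb)⟩
        · exact ⟨cnt, by simp, .single (by rw [lcnt]; exact hb)⟩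
      · exact .inr ⟨a, by simp [ha], .refl⟩
      · intro e'
        rw [e'] at h1
        have := (h.live v hy0).1
        rw [← hy, h1] at this
        exact huv this
  · have e1 : lsize (lk kids' item' nd') cnt =
        1 + (((kids y).drop 2).map (lsize (lk kids' item' nd'))).sum := by
      rw [lsize_eq (by omega) fun b hb => (hlt _ b (lk_subset hb)).2, lcnt]
    have e2 := Multiset.sum_map_le_sum_map (s := L) (lsize (lk kids' item' nd'))
      (lsize (lk kids item nd)) fun b hb => hle b (h.roots b hb)
    simp only [lsum, Multiset.map_cons, Multiset.sum_cons]
    by_cases hy0 : y = 0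
    · rw [hy0, h.kids_zero] at e1
      simp only [List.drop_nil, List.map_nil, List.sum_nil] at e1
      omega
    obtain ⟨r, hr, hry⟩ := (h.live v hy0).2.2.2
    rw [← hy] at hry
    -- The list of children of `y` is split between `y` and the new node, so what the new node gains
    -- is lost by the tree of `y`.
    have e3 : lsize (lk kids' item' nd') y + (((kids y).drop 2).map (lsize (lk kids' item' nd'))).sum
        ≤ lsize (lk kids item nd) y := by
      rw [lsize_eq hy0 fun b hb => (hlt _ b (lk_subset hb)).2,
        lsize_eq hy0 fun b hb => (h.lk_lt hb).2, (hyl hy0).1, (hyl hy0).2, add_assoc,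
        ← List.sum_append, ← List.map_append, List.take_append_drop]
      exact Nat.add_le_add_left (List.sum_le_sum fun b hb => hle b (by
        have := h.lt y b hb; omega)) 1
    have hrc := h.roots r hr
    have e4 := lsize_add_le (fun x y h' => h.lk_lt h') (fun a ha hay => heq a (by omega) hay)
      (fun a ha => hle a (by omega)) e3 hry
    have e5 := sum_map_add_le hr (fun a ha => hle a (h.roots a ha)) e4
    omega

/-- A full root is removed from the heap. -/
theorem HInv.extract {x : ℕ} (h : HInv kids item nd key d cnt (x ::ₘ L)) (hx0 : x ≠ 0)
    (hx : nd (item x) = x) :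
    HInv kids item (Function.update nd (item x) 0) key d cnt (↑(kids x) + L) ∧
    lsum (lk kids item (Function.update nd (item x) 0)) (↑(kids x) + L) + 1 ≤
      lsum (lk kids item nd) (x ::ₘ L) := by
  set nd' := Function.update nd (item x) 0 with hnd'
  have hsub : ∀ a, (lk kids item nd' a).Sublist (lk kids item nd a) := by
    intro a
    unfold lk
    by_cases he : item a = item x
    · rw [he, show nd' (item x) = 0 by simp [hnd']]
      by_cases ha : a = 0
      · rw [ha, h.kids_zero]; simp
      rw [if_neg (Ne.symm ha)]
      split_ifs
      · exact List.take_sublist _ _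
      · exact List.Sublist.refl _
    · rw [show nd' (item a) = nd (item a) by simp [hnd', he]]
  have hle : ∀ a, lsize (lk kids item nd') a ≤ lsize (lk kids item nd) a := fun a =>
    lsize_le (fun b _ z hz => (h.lk_lt hz).2) fun b _ => hsub b
  refine ⟨⟨h.toShape, h.cnt_pos, fun y hy => ?_, fun v hv => ?_⟩, ?_⟩
  · rcases Multiset.mem_add.1 hy with hy | hy
    · have := h.lt x y (by simpa using hy)
      have := h.roots x (by simp)
      omega
    · exact h.roots y (by simp [hy])
  · have hvx : v ≠ item x := by rintro rfl; simp [hnd'] at hv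
    have e : nd' v = nd v := by simp [hnd', hvx]
    rw [e] at hv ⊢
    obtain ⟨h1, h2, h3, h4⟩ := h.live v hv
    refine ⟨h1, h2, h3, ?_⟩
    refine (reach_transfer (x₀ := x) (fun a ha b hb => ?_) (fun b hb => ?_) (fun y hy => ?_)
      h4).resolve_left ?_
    · unfold lk at hb ⊢
      by_cases he : item a = item x
      · rw [he, hx, if_neg (Ne.symm ha)] at hb
        rw [he, show nd' (item x) = 0 by simp [hnd']]
        split_ifs
        · exact List.mem_of_mem_take hb
        · exact hb
      · rw [show nd' (item a) = nd (item a) by simp [hnd', he]]; exact hb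
    · exact ⟨b, by simp [lk_subset hb], .refl⟩
    · rcases Multiset.mem_cons.1 hy with hy | hy
      · exact .inl hy
      · exact .inr ⟨y, by simp [hy], .refl⟩
    · intro e'; rw [e'] at h1; exact hvx h1.symm
  · have e1 : lsize (lk kids item nd) x = 1 + ((kids x).map (lsize (lk kids item nd))).sum := by
      rw [lsize_eq hx0 fun y hy => (h.lk_lt hy).2, lk, if_pos hx]
    have e2 : ((kids x).map (lsize (lk kids item nd'))).sum ≤
        ((kids x).map (lsize (lk kids item nd))).sum := List.sum_le_sum fun b _ => hle b
    have e3 := Multiset.sum_map_le_sum_map (s := L) (lsize (lk kids item nd'))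
      (lsize (lk kids item nd)) fun b _ => hle b
    simp only [lsum, Multiset.map_add, Multiset.sum_add, Multiset.map_cons, Multiset.sum_cons,
      Multiset.map_coe, Multiset.sum_coe]
    omega

end Heap

/-! ## Registers and arrays -/

infixr:60 ";;" => Prog.seq

-- Integer arrays 0 to 2 and real array 0 are the input, and `aSrc` is reused for the output once
-- the adjacency lists are built. The heap owns `aNd` and all integer arrays from 12 on, the
-- registers `iCnt`, `iSp`, `iMax`, and the real arrays `aD` and `aKey`. The number 0 is the null
-- node, the null list cell and the null arc.
local notation "iN" => 0
local notation "iM" => 1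
local notation "iCnt" => 2
local notation "iSp" => 3
local notation "iMax" => 4
local notation "iV" => 5
local notation "iR" => 6
local notation "iX" => 7
local notation "iY" => 8
local notation "iRk" => 9
local notation "iMn" => 10
local notation "iU" => 11
local notation "iA" => 12
local notation "iW" => 13
local notation "iImp" => 14
local notation "iCu" => 15
local notation "iCv" => 16
local notation "iHas" => 17
local notation "iLen" => 18
local notation "iP" => 19
local notation "iJ" => 20
local notation "iArc" => 21
local notation "iZ" => 23
local notation "rBest" => 0
local notation "rK" => 1
local notation "rZero" => 2
local notation "aSrc" => 0
local notation "aDst" => 1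
local notation "aForest" => 2
local notation "aTo" => 3
local notation "aHead" => 4
local notation "aNext" => 5
local notation "aDel" => 6
local notation "aScn" => 7
local notation "aNd" => 8
local notation "aPar" => 9
local notation "aHop" => 10
local notation "aBr" => 11
local notation "aItem" => 12
local notation "aKp" => 13
local notation "aRk" => 14
local notation "aHd" => 15
local notation "aTl" => 16
local notation "aStk" => 17
local notation "aTab" => 18
local notation "aIn" => 0
local notation "aWt" => 1
local notation "aD" => 2
local notation "aKey" => 3

/-! ## The heap in memory -/

/-- `p` points to a linked list with the entries `l`. -/
def LRep (hd tl : ℕ → ℕ) (cnt : ℕ) : ℕ → List ℕ → Prop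
  | p, [] => p = 0
  | p, y :: l => p ≠ 0 ∧ p < cnt ∧ hd p = y ∧ LRep hd tl cnt (tl p) l

theorem LRep.alloc {hd tl : ℕ → ℕ} {cnt p a b : ℕ} {l : List ℕ} (h : LRep hd tl cnt p l) :
    LRep (Function.update hd cnt a) (Function.update tl cnt b) (cnt + 1) p l := by
  induction l generalizing p with
  | nil => exact h
  | cons y l ih =>
    obtain ⟨h1, h2, h3, h4⟩ := h
    refine ⟨h1, by omega, ?_, ?_⟩
    · rw [Function.update_of_ne (by omega)]; exact h3
    · rw [Function.update_of_ne (by omega)]; exact ih h4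

theorem LRep.mono {hd tl : ℕ → ℕ} {cnt p : ℕ} {l : List ℕ} (h : LRep hd tl cnt p l) :
    LRep hd tl (cnt + 1) p l := by
  induction l generalizing p with
  | nil => exact h
  | cons y l ih => exact ⟨h.1, by have := h.2.1; omega, h.2.2.1, ih h.2.2.2⟩

/-- As the null pointer is its own successor, two children can be skipped without testing whether
there are two. -/
theorem LRep.tail {hd tl : ℕ → ℕ} {cnt p : ℕ} {l : List ℕ} (h : LRep hd tl cnt p l)
    (h0 : tl 0 = 0) : LRep hd tl cnt (tl p) l.tail := by
  cases l with
  | nil => rw [show p = 0 from h, h0]; rfl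
  | cons y l => exact h.2.2.2

/-- The arrays of child pointers, ranks and list cells represent `kids`. -/
structure Mem (kids : ℕ → List ℕ) (kp rk hd tl : ℕ → ℕ) (cnt : ℕ) : Prop where
  rep : ∀ x < cnt, LRep hd tl cnt (kp x) (kids x)
  rk : ∀ x < cnt, rk x = (kids x).length
  tl_zero : tl 0 = 0

/-- The state holds a hollow heap with the roots `L`. -/
structure HeapAt (s : State) (kids : ℕ → List ℕ) (L : Multiset ℕ) : Prop where
  mem : Mem kids (s.iarr aKp) (s.iarr aRk) (s.iarr aHd) (s.iarr aTl) (s.ireg iCnt)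
  inv : HInv kids (s.iarr aItem) (s.iarr aNd) (s.rarr aKey) (s.rarr aD) (s.ireg iCnt) L

/-- The number of nodes of the heap. -/
def hsize (s : State) (kids : ℕ → List ℕ) (L : Multiset ℕ) : ℕ :=
  lsum (lk kids (s.iarr aItem) (s.iarr aNd)) L

/-- The first `n` entries of an array. -/
def img (f : ℕ → ℕ) (n : ℕ) : Multiset ℕ := (Multiset.range n).map f

theorem img_succ (f : ℕ → ℕ) (n : ℕ) : img f (n + 1) = f n ::ₘ img f n := by
  simp [img, Multiset.range_succ]

theorem img_zero (f : ℕ → ℕ) : img f 0 = 0 := by simp [img]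

theorem img_update_le (f : ℕ → ℕ) {n i : ℕ} (v : ℕ) (h : n ≤ i) :
    img (Function.update f i v) n = img f n := by
  refine Multiset.map_congr rfl fun x hx => ?_
  rw [Function.update_of_ne]
  have := Multiset.mem_range.1 hx
  omega

theorem img_push (f : ℕ → ℕ) (n v : ℕ) : img (Function.update f n v) (n + 1) = v ::ₘ img f n := by
  rw [img_succ, img_update_le f v le_rfl, Function.update_self]

/-- Adding the old entry on one side and the new one on the other avoids subtraction of multisets.
When one of the two is 0, `HeapAt.cons_zero` removes it. -/
theorem img_update_lt (f : ℕ → ℕ) {n i : ℕ} (v : ℕ) (h : i < n) :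
    f i ::ₘ img (Function.update f i v) n = v ::ₘ img f n := by
  induction n with
  | zero => omega
  | succ n ih =>
    rw [img_succ, img_succ]
    by_cases hi : i = n
    · subst hi
      rw [img_update_le f v le_rfl, Function.update_self, Multiset.cons_swap]
    · rw [Function.update_of_ne (by omega), Multiset.cons_swap, ih (by omega), Multiset.cons_swap]

theorem mem_img {f : ℕ → ℕ} {n x : ℕ} : x ∈ img f n ↔ ∃ i < n, f i = x := by
  simp [img]

/-- Number of nonzero entries. -/
def nz (L : Multiset ℕ) : ℕ := L.countP (· ≠ 0)

theorem nz_cons (x : ℕ) (L : Multiset ℕ) : nz (x ::ₘ L) = nz L + if x = 0 then 0 else 1 := by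
  by_cases h : x = 0 <;> simp [nz, h]

theorem lsum_cons (c : ℕ → List ℕ) (x : ℕ) (L : Multiset ℕ) :
    lsum c (x ::ₘ L) = lsize c x + lsum c L := by simp [lsum]

/-- Nothing current hangs below 0, so the whole table may be counted among the roots, empty slots
included. -/
theorem HInv.cons_zero {kids : ℕ → List ℕ} {item nd : ℕ → ℕ} {key d : ℕ → ℝ} {cnt : ℕ}
    {L : Multiset ℕ} : HInv kids item nd key d cnt (0 ::ₘ L) ↔ HInv kids item nd key d cnt L := by
  constructor
  · intro h
    refine ⟨h.toShape, h.cnt_pos, fun x hx => h.roots x (by simp [hx]), fun v hv => ?_⟩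
    obtain ⟨h1, h2, h3, x, hx, hr⟩ := h.live v hv
    rcases Multiset.mem_cons.1 hx with rfl | hx
    · have := Reach.le (fun a b hb => (h.lk_lt hb).2) hr
      omega
    · exact ⟨h1, h2, h3, x, hx, hr⟩
  · intro h
    refine ⟨h.toShape, h.cnt_pos, fun x hx => ?_, fun v hv => ?_⟩
    · rcases Multiset.mem_cons.1 hx with rfl | hx
      · exact h.cnt_pos
      · exact h.roots x hx
    · obtain ⟨h1, h2, h3, x, hx, hr⟩ := h.live v hv
      exact ⟨h1, h2, h3, x, by simp [hx], hr⟩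

/-! ### Insertion and decrease of a key -/

/-- Gives the element in the register `iW` the key in the register `rK`. -/
def pInsert : Prog :=
  .setI iY (.read aNd (.reg iW)) ;;
  .writeI aItem (.reg iCnt) (.reg iW) ;;
  .writeR aKey (.reg iCnt) (.reg rK) ;;
  .writeI aKp (.reg iCnt) (.read aTl (.read aTl (.read aKp (.reg iY)))) ;;
  .writeI aRk (.reg iCnt) (.pred (.pred (.read aRk (.reg iY)))) ;;
  .writeI aNd (.reg iW) (.reg iCnt) ;;
  .writeR aD (.reg iW) (.reg rK) ;;
  .writeI aStk (.reg iSp) (.reg iCnt) ;;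
  .setI iSp (.succ (.reg iSp)) ;;
  .setI iCnt (.succ (.reg iCnt))

/-- The heap between two operations: all roots are on the stack, the table is empty. -/
structure Heap (s : State) (kids : ℕ → List ℕ) : Prop where
  at_ : HeapAt s kids (img (s.iarr aStk) (s.ireg iSp))
  ne_zero : 0 ∉ img (s.iarr aStk) (s.ireg iSp)
  tab : ∀ i, s.iarr aTab i = 0
  max : s.ireg iMax = 0

/-- The number of nodes of the heap between two operations. -/
def size (s : State) (kids : ℕ → List ℕ) : ℕ := hsize s kids (img (s.iarr aStk) (s.ireg iSp))

/-- Insertion and decrease of a key run the same code. For an element outside the heap the old node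
is 0, which has no children and rank 0; following two pointers and taking two truncated predecessors
then does nothing. -/
theorem wp_insert {s : State} {t : ℕ} {kids : ℕ → List ℕ} (h : Heap s kids)
    (hk : s.iarr aNd (s.ireg iW) ≠ 0 → s.rreg rK ≤ s.rarr aD (s.ireg iW)) :
    wp pInsert s t fun t' s' => ∃ kids', Heap s' kids' ∧ t' ≤ t + 60 ∧
      s'.ireg iSp = s.ireg iSp + 1 ∧ size s' kids' ≤ size s kids + 1 ∧
      s'.iarr aNd = Function.update (s.iarr aNd) (s.ireg iW) (s.ireg iCnt) ∧
      s'.rarr aD = Function.update (s.rarr aD) (s.ireg iW) (s.rreg rK) ∧ 0 < s.ireg iCnt := by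
  simp only [pInsert, wp_seq, wp_setI, wp_writeI, wp_writeR, IExpr.eval, RExpr.eval, IExpr.cost,
    RExpr.cost]
  obtain ⟨h1, h2⟩ := h.at_.inv.push hk
  set y := s.iarr aNd (s.ireg iW) with hy
  have hyc : y < s.ireg iCnt := by
    by_cases e : y = 0
    · rw [e]; exact h.at_.inv.cnt_pos
    · exact (h.at_.inv.live _ e).2.1
  refine ⟨Function.update kids (s.ireg iCnt) ((kids y).drop 2), ⟨⟨⟨?_, ?_, ?_⟩, ?_⟩, ?_, ?_, ?_⟩,
    ?_, ?_, ?_, ?_, ?_, h.at_.inv.cnt_pos⟩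
  · simp only [setI_ireg, setI_iarr, putI_ireg, putI_iarr, putR_ireg, putR_iarr]
    simp
    intro x hx
    by_cases hxc : x = s.ireg iCnt
    · subst hxc
      simp only [Function.update_self]
      have := ((h.at_.mem.rep y hyc).tail h.at_.mem.tl_zero).tail h.at_.mem.tl_zero
      rw [← List.drop_one, ← List.drop_one, List.drop_drop] at this
      exact this.mono
    · rw [Function.update_of_ne hxc, Function.update_of_ne hxc]
      exact (h.at_.mem.rep x (by omega)).mono
  · simp
    intro x hx
    by_cases hxc : x = s.ireg iCnt
    · subst hxc
      simp only [Function.update_self, List.length_drop, h.at_.mem.rk y hyc]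
      omega
    · rw [Function.update_of_ne hxc, Function.update_of_ne hxc]
      exact h.at_.mem.rk x (by omega)
  · simpa using h.at_.mem.tl_zero
  · simpa [img_push] using h1
  · simpa [img_push] using ⟨h.at_.inv.cnt_pos.ne, h.ne_zero⟩
  · simpa using h.tab
  · simpa using h.max
  · omega
  · simp
  · simpa [size, hsize, img_push] using h2
  · simp
  · simp

/-! ### Extraction of the minimum -/

/-- The root `iY` becomes a child of a new node that replaces the root `iX`. -/
def pLink : Prog :=
  .writeI aItem (.reg iCnt) (.read aItem (.reg iX)) ;;
  .writeR aKey (.reg iCnt) (.read aKey (.reg iX)) ;;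
  .writeI aHd (.reg iCnt) (.reg iY) ;;
  .writeI aTl (.reg iCnt) (.read aKp (.reg iX)) ;;
  .writeI aKp (.reg iCnt) (.reg iCnt) ;;
  .writeI aRk (.reg iCnt) (.succ (.read aRk (.reg iX))) ;;
  .writeI aNd (.read aItem (.reg iX)) (.reg iCnt) ;;
  .setI iX (.reg iCnt) ;;
  .setI iCnt (.succ (.reg iCnt))

/-- One counter numbers nodes and list cells alike. The new node gets the cell of the same number,
whose tail is the list of children of `x`; this list is shared and not copied, so a link takes
constant time. -/
theorem wp_link {s : State} {t x y : ℕ} {kids : ℕ → List ℕ} {L : Multiset ℕ}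
    (h : HeapAt s kids (x ::ₘ y ::ₘ L)) (ex : s.ireg iX = x) (ey : s.ireg iY = y) (hx0 : x ≠ 0)
    (hy0 : y ≠ 0) (hx : s.iarr aNd (s.iarr aItem x) = x)
    (hr : (kids x).length = (kids y).length) (hk : s.rarr aKey x ≤ s.rarr aKey y) :
    wp pLink s t fun t' s' => t' ≤ t + 40 ∧ ∃ kids', HeapAt s' kids' (s'.ireg iX ::ₘ L) ∧
      hsize s' kids' (s'.ireg iX ::ₘ L) ≤ hsize s kids (x ::ₘ y ::ₘ L) ∧
      s'.ireg iX = s.ireg iCnt ∧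
      kids' = Function.update kids (s.ireg iCnt) (y :: kids x) ∧
      s'.iarr aItem = Function.update (s.iarr aItem) (s.ireg iCnt) (s.iarr aItem x) ∧
      s'.iarr aNd = Function.update (s.iarr aNd) (s.iarr aItem x) (s.ireg iCnt) := by
  simp only [pLink, wp_seq, wp_setI, wp_writeI, wp_writeR, IExpr.eval, RExpr.eval, IExpr.cost,
    RExpr.cost]
  obtain ⟨h1, h2⟩ := h.inv.link hx0 hy0 hx hr hk
  have hxc := h.inv.roots x (by simp)
  have hyc := h.inv.roots y (by simp)
  simp [ex, ey, hxc.ne]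
  refine ⟨⟨?_, ?_⟩, ?_⟩
  · refine ⟨?_, ?_, ?_⟩
    · simp
      intro z hz
      by_cases hzc : z = s.ireg iCnt
      · subst hzc
        simp only [Function.update_self]
        refine ⟨by omega, by omega, by simp, ?_⟩
        simp only [Function.update_self]
        exact (h.mem.rep x hxc).alloc
      · rw [Function.update_of_ne hzc, Function.update_of_ne hzc]
        exact (h.mem.rep z (by omega)).alloc
    · simp
      intro z hz
      by_cases hzc : z = s.ireg iCnt
      · subst hzc
        simp [h.mem.rk x hxc]
      · rw [Function.update_of_ne hzc, Function.update_of_ne hzc]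
        exact h.mem.rk z (by omega)
    · simp
      rw [Function.update_of_ne h.inv.cnt_pos.ne]
      exact h.mem.tl_zero
  · simpa using h1
  · simpa [hsize] using h2

/-- While the table has a root of the rank of the full root `iX`, the two are linked. -/
def pLinks : Prog :=
  .while (.not (.ieq (.read aTab (.reg iRk)) (.const 0))) (
    .setI iY (.read aTab (.reg iRk)) ;;
    .writeI aTab (.reg iRk) (.const 0) ;;
    .setI iRk (.succ (.reg iRk)) ;;
    .ite (.rlt (.read aKey (.reg iY)) (.read aKey (.reg iX)))
      (.setI iZ (.reg iX) ;; .setI iX (.reg iY) ;; .setI iY (.reg iZ) ;; pLink) pLink)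

/-- The nonzero entries of the table are full roots with the right rank. -/
def TabOK (s : State) (kids : ℕ → List ℕ) : Prop :=
  ∀ i, s.iarr aTab i ≠ 0 → i < s.ireg iMax ∧
    s.iarr aNd (s.iarr aItem (s.iarr aTab i)) = s.iarr aTab i ∧ (kids (s.iarr aTab i)).length = i

theorem lsum_cons_zero (c : ℕ → List ℕ) (L : Multiset ℕ) : lsum c (0 ::ₘ L) = lsum c L := by
  rw [lsum_cons, lsize_zero, zero_add]

theorem HeapAt.cons_zero {s : State} {kids : ℕ → List ℕ} {L : Multiset ℕ} :
    HeapAt s kids (0 ::ₘ L) ↔ HeapAt s kids L :=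
  ⟨fun h => ⟨h.mem, HInv.cons_zero.1 h.inv⟩, fun h => ⟨h.mem, HInv.cons_zero.2 h.inv⟩⟩

/-- Invariant of `pLinks`. -/
structure LinksInv (s₀ : State) (B N T : ℕ) (S : Multiset ℕ) (kids : ℕ → List ℕ) (t : ℕ)
    (s : State) : Prop where
  at_ : HeapAt s kids (s.ireg iX ::ₘ (S + img (s.iarr aTab) B))
  tab : TabOK s kids
  max : s.ireg iMax ≤ B
  ne_zero : s.ireg iX ≠ 0
  full : s.iarr aNd (s.iarr aItem (s.ireg iX)) = s.ireg iX
  rank : (kids (s.ireg iX)).length = s.ireg iRk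
  size : hsize s kids (s.ireg iX ::ₘ (S + img (s.iarr aTab) B)) ≤ N
  nd : ∀ v, s.iarr aNd v = 0 ↔ s₀.iarr aNd v = 0
  time : t + 100 * nz (img (s.iarr aTab) B) +
    400 * hsize s kids (s.ireg iX ::ₘ (S + img (s.iarr aTab) B)) ≤ T

/-- The part of a pass that is common to both orders of the two keys. The slot just emptied has
released 100 units, of which 40 are kept for the link. -/
theorem LinksInv.step {s₀ s : State} {B N T t x y : ℕ} {S : Multiset ℕ} {kids : ℕ → List ℕ}
    (h : HeapAt s kids (x ::ₘ y ::ₘ (S + img (s.iarr aTab) B))) (ex : s.ireg iX = x)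
    (ey : s.ireg iY = y) (hx0 : x ≠ 0)
    (hy0 : y ≠ 0) (hx : s.iarr aNd (s.iarr aItem x) = x)
    (hr : (kids x).length = (kids y).length) (hk : s.rarr aKey x ≤ s.rarr aKey y)
    (htab : TabOK s kids) (hmax : s.ireg iMax ≤ B) (hrk : (kids x).length + 1 = s.ireg iRk)
    (h0 : s.iarr aTab (kids x).length = 0)
    (hsize : hsize s kids (x ::ₘ y ::ₘ (S + img (s.iarr aTab) B)) ≤ N)
    (hnd : ∀ v, s.iarr aNd v = 0 ↔ s₀.iarr aNd v = 0)
    (htime : t + 100 * nz (img (s.iarr aTab) B) + 40 +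
      400 * TreeDepthCycle.hsize s kids (x ::ₘ y ::ₘ (S + img (s.iarr aTab) B)) ≤ T) :
    wp pLink s t fun t' s' => ∃ kids, LinksInv s₀ B N T S kids t' s' := by
  refine (wp_link h ex ey hx0 hy0 hx hr hk).frame.mono ?_
  rintro t' s' ⟨⟨ht, kids', h1, h2, h3, h4, h5, h6⟩, hf⟩
  have etab : s'.iarr aTab = s.iarr aTab := hf.iarr _ (by decide)
  have emax : s'.ireg iMax = s.ireg iMax := hf.ireg _ (by decide)
  have erk : s'.ireg iRk = s.ireg iRk := hf.ireg _ (by decide)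
  have hcnt := h.inv.cnt_pos
  refine ⟨kids', by rw [etab]; exact h1, fun i hi => ?_, by rw [emax]; exact hmax,
    by rw [h3]; omega, by rw [h3, h5, h6]; simp, by rw [h3, h4, erk]; simp [hrk],
    by rw [etab]; exact h2.trans hsize, fun v => ?_, ?_⟩
  · rw [etab] at hi ⊢
    rw [emax]
    obtain ⟨a1, a2, a3⟩ := htab i hi
    have hlt : s.iarr aTab i < s.ireg iCnt := by
      refine h.inv.roots _ ?_
      simp only [Multiset.mem_cons, Multiset.mem_add, mem_img]
      exact .inr (.inr (.inr ⟨i, by omega, rfl⟩))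
    refine ⟨a1, ?_, ?_⟩
    · rw [h5, h6, Function.update_of_ne hlt.ne, Function.update_of_ne, a2]
      -- An entry made for the element of `x` would, being full, be `x` itself. It would then lie in
      -- the slot of the rank of `x`, which is empty.
      intro e
      rw [e, hx] at a2
      rw [← a2] at a3
      rw [← a3] at hi
      exact hi h0
    · rw [h4, Function.update_of_ne hlt.ne, a3]
  · rw [h6, ← hnd v]
    by_cases hv : v = s.iarr aItem x
    · rw [hv, Function.update_self, hx]; omega
    · rw [Function.update_of_ne hv]
  · rw [etab]; omega

/-- This is the carry in binary addition: each pass empties one slot and moves on to the next rank,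
and the 100 units released by the slot pay for the pass. -/
theorem wp_links {s : State} {B N T t : ℕ} {S : Multiset ℕ} {kids : ℕ → List ℕ}
    (h : LinksInv s B N T S kids t s) :
    wp pLinks s t fun t' s' => (∃ kids, LinksInv s B N (T + 10) S kids t' s') ∧
      s'.iarr aTab (s'.ireg iRk) = 0 := by
  refine wp_while (fun t' s' => ∃ kids, LinksInv s B N T S kids t' s') T ⟨kids, h⟩
    (fun t' s' ⟨_, h'⟩ => by have := h'.time; omega) ?_ ?_
  · rintro t' s' - ⟨kids, h⟩ hb
    simp only [Test.Holds, IExpr.eval] at hb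
    simp only [wp_seq, wp_setI, wp_writeI, wp_ite, IExpr.eval, RExpr.eval, IExpr.cost,
      RExpr.cost, Test.cost, Test.Holds]
    simp
    set x := s'.ireg iX with hx
    set ρ := s'.ireg iRk with hρ
    obtain ⟨a1, a2, a3⟩ := h.tab ρ hb
    have hρB : ρ < B := by have := h.max; omega
    set y := s'.iarr aTab ρ with hy
    have hM : y ::ₘ img (Function.update (s'.iarr aTab) ρ 0) B = 0 ::ₘ img (s'.iarr aTab) B :=
      img_update_lt _ 0 hρB
    have hM' : x ::ₘ y ::ₘ (S + img (Function.update (s'.iarr aTab) ρ 0) B) =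
        0 ::ₘ (x ::ₘ (S + img (s'.iarr aTab) B)) := by
      rw [← Multiset.add_cons, hM, Multiset.add_cons, Multiset.cons_swap]
    have hat : HeapAt s' kids (x ::ₘ y ::ₘ (S + img (Function.update (s'.iarr aTab) ρ 0) B)) := by
      rw [hM', HeapAt.cons_zero]; exact h.at_
    have hsz : hsize s' kids (x ::ₘ y ::ₘ (S + img (Function.update (s'.iarr aTab) ρ 0) B)) =
        hsize s' kids (x ::ₘ (S + img (s'.iarr aTab) B)) := by
      rw [hM', hsize, lsum_cons_zero, hsize]
    have hnz : nz (img (Function.update (s'.iarr aTab) ρ 0) B) + 1 = nz (img (s'.iarr aTab) B) := by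
      have := congrArg nz hM
      rw [nz_cons, nz_cons, if_neg hb, if_pos rfl] at this
      omega
    have htab : ∀ i, Function.update (s'.iarr aTab) ρ 0 i ≠ 0 → i < s'.ireg iMax ∧
        s'.iarr aNd (s'.iarr aItem (Function.update (s'.iarr aTab) ρ 0 i)) =
          Function.update (s'.iarr aTab) ρ 0 i ∧
        (kids (Function.update (s'.iarr aTab) ρ 0 i)).length = i := by
      intro i hi
      have : i ≠ ρ := by rintro rfl; simp at hi
      rw [Function.update_of_ne this] at hi ⊢
      exact h.tab i hi
    have htime := h.time
    have hsize := h.size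
    rw [← hx, ← hsz] at htime hsize
    have hrk : (kids x).length = ρ := h.rank
    constructor
    · intro hlt
      refine LinksInv.step (kids := kids) (x := y) (y := x) ⟨?_, ?_⟩ ?_ ?_ hb
        h.ne_zero ?_ ?_ ?_ ?_ ?_ ?_ ?_ ?_ ?_ ?_
      · simpa using hat.mem
      · rw [Multiset.cons_swap]; simpa using hat.inv
      · simp
      · simp
      · simpa using a2
      · omega
      · simpa using hlt.le
      · simpa [TabOK] using htab
      · simpa using h.max
      · simp [a3]
      · simp [a3]
      · rw [Multiset.cons_swap]; simpa [TreeDepthCycle.hsize] using hsize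
      · simpa using h.nd
      · rw [Multiset.cons_swap]; simp [TreeDepthCycle.hsize] at htime ⊢; omega
    · intro hlt
      refine LinksInv.step (kids := kids) (x := x) (y := y) ⟨?_, ?_⟩ ?_ ?_ h.ne_zero
        hb ?_ ?_ ?_ ?_ ?_ ?_ ?_ ?_ ?_ ?_
      · simpa using hat.mem
      · simpa using hat.inv
      · simp [hx]
      · simp
      · simpa using h.full
      · omega
      · simpa using hlt
      · simpa [TabOK] using htab
      · simpa using h.max
      · simpa using hrk
      · simp [hrk]
      · simpa [TreeDepthCycle.hsize] using hsize
      · simpa using h.nd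
      · simp [TreeDepthCycle.hsize] at htime ⊢; omega
  · rintro t' s' - ⟨kids, h⟩ hb
    simp only [Test.Holds, IExpr.eval, not_not] at hb
    refine ⟨⟨kids, h.at_, h.tab, h.max, h.ne_zero, h.full, h.rank, h.size, h.nd, ?_⟩, hb⟩
    have := h.time
    simp only [Test.cost, IExpr.cost]
    omega

def pPush (e : IExpr) : Prog := .writeI aStk (.reg iSp) e ;; .setI iSp (.succ (.reg iSp))

/-- The roots are moved from the stack to the table; hollow roots are replaced by their children,
and no two roots of the same rank remain. -/
def pConsolidate : Prog :=
  .while (.ilt (.const 0) (.reg iSp)) (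
    .setI iSp (.pred (.reg iSp)) ;;
    .setI iX (.read aStk (.reg iSp)) ;;
    .ite (.ieq (.read aNd (.read aItem (.reg iX))) (.reg iX))
      (.setI iRk (.read aRk (.reg iX)) ;; pLinks ;; .writeI aTab (.reg iRk) (.reg iX) ;;
        .ite (.ilt (.reg iRk) (.reg iMax)) .skip (.setI iMax (.succ (.reg iRk))))
      (.setI iY (.read aKp (.reg iX)) ;;
        .ite (.ieq (.reg iY) (.const 0)) .skip
          (pPush (.read aHd (.reg iY)) ;; .setI iY (.read aTl (.reg iY)) ;;
            .ite (.ieq (.reg iY) (.const 0)) .skip (pPush (.read aHd (.reg iY))))))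

/-- Invariant of `pConsolidate`. -/
structure ConsInv (s₀ : State) (B N T : ℕ) (kids : ℕ → List ℕ) (t : ℕ) (s : State) : Prop where
  at_ : HeapAt s kids (img (s.iarr aStk) (s.ireg iSp) + img (s.iarr aTab) B)
  ne_zero : 0 ∉ img (s.iarr aStk) (s.ireg iSp)
  tab : TabOK s kids
  max : s.ireg iMax ≤ B
  size : hsize s kids (img (s.iarr aStk) (s.ireg iSp) + img (s.iarr aTab) B) ≤ N
  nd : ∀ v, s.iarr aNd v = 0 ↔ s₀.iarr aNd v = 0
  time : t + 100 * nz (img (s.iarr aTab) B) + 200 * s.ireg iSp +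
    400 * hsize s kids (img (s.iarr aStk) (s.ireg iSp) + img (s.iarr aTab) B) ≤ T

/-- The clock plus the potential never rises. A full root leaves the stack for the table; a hollow
root destroys a node and puts at most two others on the stack. -/
theorem wp_consolidate {s : State} {B N T t : ℕ} {kids : ℕ → List ℕ}
    (hB : ∀ k, 2 ^ (k / 2) ≤ N → k < B) (h : ConsInv s B N T kids t s) :
    wp pConsolidate s t fun t' s' => (∃ kids, ConsInv s B N (T + 10) kids t' s') ∧
      s'.ireg iSp = 0 := by
  refine wp_while (fun t' s' => ∃ kids, ConsInv s B N T kids t' s') T ⟨kids, h⟩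
    (fun t' s' ⟨_, h'⟩ => by have := h'.time; omega) ?_ ?_
  · rintro t' s' - ⟨kids, h⟩ hb
    simp only [Test.Holds, IExpr.eval] at hb
    obtain ⟨sp, hsp⟩ : ∃ sp, s'.ireg iSp = sp + 1 := ⟨s'.ireg iSp - 1, by omega⟩
    simp only [wp_seq, wp_setI, wp_ite, IExpr.eval, IExpr.cost, Test.cost, Test.Holds]
    simp [hsp]
    set x := s'.iarr aStk sp with hx
    have hS : img (s'.iarr aStk) (s'.ireg iSp) = x ::ₘ img (s'.iarr aStk) sp := by
      rw [hsp, img_succ]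
    have hat := h.at_
    have hne := h.ne_zero
    have hsz := h.size
    have htime := h.time
    rw [hS] at hat hne hsz htime
    rw [Multiset.cons_add] at hat hsz htime
    have hx0 : x ≠ 0 := fun e => hne (by simp [e])
    have hne' : 0 ∉ img (s'.iarr aStk) sp := fun e => hne (by simp [e])
    have hxc := hat.inv.roots x (by simp)
    constructor
    · intro hfull
      refine (wp_links (s := (((s'.setI iSp sp).setI iX x).setI iRk (s'.iarr aRk x))) (B := B)
        (N := N) (S := img (s'.iarr aStk) sp) (kids := kids)
        -- The budget of the inner loop is its potential on entry. The 200 units of the root taken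
        -- from the stack cover the constants and the 100 units of the slot it will occupy.
        (T := t' + 40 + 100 * nz (img (s'.iarr aTab) B) +
          400 * hsize s' kids (x ::ₘ (img (s'.iarr aStk) sp + img (s'.iarr aTab) B)))
        ⟨⟨?_, ?_⟩, ?_, ?_, ?_, ?_, ?_, ?_, ?_, ?_⟩).frame.mono ?_
      · simpa using hat.mem
      · simpa using hat.inv
      · simpa [TabOK] using h.tab
      · simpa using h.max
      · simpa using hx0
      · simpa using hfull
      · simp [hat.mem.rk x hxc]
      · simpa [hsize] using hsz
      · simp
      · simp [hsize]
      · rintro t₁ s₁ ⟨⟨⟨kids₁, h₁⟩, htab0⟩, hf⟩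
        have estk : s₁.iarr aStk = s'.iarr aStk := (hf.iarr _ (by decide)).trans (by simp)
        have esp : s₁.ireg iSp = sp := (hf.ireg _ (by decide)).trans (by simp)
        have emax : s₁.ireg iMax = s'.ireg iMax := (hf.ireg _ (by decide)).trans (by simp)
        set y := s₁.ireg iX with hy
        set ρ := s₁.ireg iRk with hρ
        -- The root that remains has rank `ρ` in a heap of at most `N` nodes, so its slot lies in
        -- the part of the table that is counted.
        have hρB : ρ < B := by
          refine hB ρ ?_
          rw [hρ, ← h₁.rank]
          exact (h₁.at_.inv.two_pow_le h₁.ne_zero (by simp)).trans h₁.size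
        have hM : 0 ::ₘ img (Function.update (s₁.iarr aTab) ρ y) B =
            y ::ₘ img (s₁.iarr aTab) B := by
          rw [← htab0]; exact img_update_lt _ y hρB
        have hM' : 0 ::ₘ (img (s'.iarr aStk) sp + img (Function.update (s₁.iarr aTab) ρ y) B) =
            y ::ₘ (img (s'.iarr aStk) sp + img (s₁.iarr aTab) B) := by
          rw [← Multiset.add_cons, hM, Multiset.add_cons]
        have hat₁ : HeapAt s₁ kids₁
            (img (s'.iarr aStk) sp + img (Function.update (s₁.iarr aTab) ρ y) B) := by
          rw [← HeapAt.cons_zero, hM']; exact h₁.at_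
        have hsz₁ : hsize s₁ kids₁
            (img (s'.iarr aStk) sp + img (Function.update (s₁.iarr aTab) ρ y) B) =
            hsize s₁ kids₁ (y ::ₘ (img (s'.iarr aStk) sp + img (s₁.iarr aTab) B)) := by
          rw [← hM', hsize, hsize, lsum_cons_zero]
        have hnz : nz (img (Function.update (s₁.iarr aTab) ρ y) B) =
            nz (img (s₁.iarr aTab) B) + 1 := by
          have := congrArg nz hM
          rw [nz_cons, nz_cons, if_neg h₁.ne_zero, if_pos rfl] at this
          omega
        have htm := h₁.time
        have hsize₁ := h₁.size
        rw [← hy, ← hsz₁] at htm hsize₁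
        have htab₁ : ∀ i, Function.update (s₁.iarr aTab) ρ y i ≠ 0 →
            (i = ρ ∨ i < s₁.ireg iMax) ∧
            s₁.iarr aNd (s₁.iarr aItem (Function.update (s₁.iarr aTab) ρ y i)) =
              Function.update (s₁.iarr aTab) ρ y i ∧
            (kids₁ (Function.update (s₁.iarr aTab) ρ y i)).length = i := by
          intro i hi
          by_cases e : i = ρ
          · rw [e, Function.update_self]
            exact ⟨.inl rfl, h₁.full, h₁.rank⟩
          · rw [Function.update_of_ne e] at hi ⊢
            obtain ⟨b1, b2⟩ := h₁.tab i hi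
            exact ⟨.inr b1, b2⟩
        rw [wp_writeI]
        simp only [IExpr.eval, IExpr.cost, putI_ireg, ← hy, ← hρ]
        constructor
        · intro hlt
          rw [wp_skip]
          refine ⟨kids₁, ⟨?_, ?_⟩, ?_, ?_, ?_, ?_, ?_, ?_⟩
          · simpa using hat₁.mem
          · simpa [estk, esp] using hat₁.inv
          · simpa [estk, esp] using hne'
          · intro i hi
            simp at hi ⊢
            obtain ⟨b1, b2⟩ := htab₁ i hi
            exact ⟨b1.elim (fun e => e ▸ hlt) id, b2⟩
          · simpa using h₁.max
          · simpa [hsize, estk, esp] using hsize₁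
          · simpa using fun v => (h₁.nd v).trans (h.nd v)
          · simp only [hsize] at htime
            simp [hsize, estk, esp] at htm ⊢
            omega
        · intro hlt
          refine ⟨kids₁, ⟨?_, ?_⟩, ?_, ?_, ?_, ?_, ?_, ?_⟩
          · simpa using hat₁.mem
          · simpa [estk, esp] using hat₁.inv
          · simpa [estk, esp] using hne'
          · intro i hi
            simp at hi ⊢
            obtain ⟨b1, b2⟩ := htab₁ i hi
            exact ⟨by omega, b2⟩
          · simpa using hρB
          · simpa [hsize, estk, esp] using hsize₁
          · simpa using fun v => (h₁.nd v).trans (h.nd v)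
          · simp only [hsize] at htime
            simp [hsize, estk, esp] at htm ⊢
            omega
    -- The destroyed node releases 400 units and the removed stack entry 200. At most two new
    -- entries take 400 of them, and 200 are left for the running time.
    · intro hhol
      have hpop := hat.inv.pop hhol
      have hlsum := hat.inv.lsum_pop hx0 hhol
      have hrep := hat.mem.rep x hxc
      have hsz' := hsz
      simp only [hsize] at hsz' htime
      rw [← hlsum] at hsz' htime
      match hk : kids x with
      | [] =>
        rw [hk] at hrep hpop hsz' htime
        have hp0 : s'.iarr aKp x = 0 := hrep
        simp [hp0]
        simp at hpop hsz' htime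
        rw [wp_skip]
        refine ⟨kids, ⟨?_, ?_⟩, ?_, ?_, ?_, ?_, ?_, ?_⟩
        · simpa using hat.mem
        · simpa using hpop
        · simpa using hne'
        · simpa [TabOK] using h.tab
        · simpa using h.max
        · simp [hsize]; omega
        · simpa using h.nd
        · simp [hsize]; omega
      | [a] =>
        rw [hk] at hrep hpop hsz' htime
        obtain ⟨hp0, hp1, hp2, hp3⟩ := hrep
        have hp3 : s'.iarr aTl (s'.iarr aKp x) = 0 := hp3
        have ha := hat.inv.lt x a (by simp [hk])
        simp [hp0, hp2, hp3, pPush, wp_seq, wp_setI, wp_writeI, wp_skip,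
          IExpr.eval, IExpr.cost]
        simp at hpop hsz' htime
        refine ⟨kids, ⟨?_, ?_⟩, ?_, ?_, ?_, ?_, ?_, ?_⟩
        · simpa using hat.mem
        · simpa [img_push] using hpop
        · simpa [img_push] using ⟨ha.1.ne, hne'⟩
        · simpa [TabOK] using h.tab
        · simpa using h.max
        · simp [hsize, img_push]; omega
        · simpa using h.nd
        · simp [hsize, img_push]; omega
      | a :: b :: l =>
        rw [hk] at hrep hpop hsz' htime
        obtain ⟨hp0, hp1, hp2, hp3, hp4, hp5, -⟩ := hrep
        have ha := hat.inv.lt x a (by simp [hk])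
        have hb' := hat.inv.lt x b (by simp [hk])
        simp [hp0, hp2, hp3, hp5, pPush, wp_seq, wp_setI, wp_writeI, wp_skip,
          IExpr.eval, IExpr.cost]
        have e : ((List.take 2 (a :: b :: l) : List ℕ) : Multiset ℕ) = b ::ₘ a ::ₘ 0 := by
          rw [Multiset.cons_swap]; rfl
        simp only [e, Multiset.cons_add, zero_add] at hpop hsz' htime
        refine ⟨kids, ⟨?_, ?_⟩, ?_, ?_, ?_, ?_, ?_, ?_⟩
        · simpa using hat.mem
        · simpa [img_push] using hpop
        · simpa [img_push] using ⟨hb'.1.ne, ha.1.ne, hne'⟩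
        · simpa [TabOK] using h.tab
        · simpa using h.max
        · simp [hsize, img_push]; omega
        · simpa using h.nd
        · simp [hsize, img_push]; omega
  · rintro t' s' - ⟨kids, h⟩ hb
    simp only [Test.Holds, IExpr.eval, not_lt, Nat.le_zero] at hb
    refine ⟨⟨kids, h.at_, h.ne_zero, h.tab, h.max, h.size, h.nd, ?_⟩, hb⟩
    have := h.time
    simp only [Test.cost, IExpr.cost]
    omega

/-- The roots are moved from the table to the stack, except for one with the least key, which
remains in the register `iMn`. -/
def pScan : Prog :=
  .while (.ilt (.reg iRk) (.reg iMax)) (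
    .setI iX (.read aTab (.reg iRk)) ;;
    .writeI aTab (.reg iRk) (.const 0) ;;
    .setI iRk (.succ (.reg iRk)) ;;
    .ite (.ieq (.reg iX) (.const 0)) .skip
      (.ite (.ieq (.reg iMn) (.const 0)) (.setI iMn (.reg iX))
        (.ite (.rlt (.read aKey (.reg iX)) (.read aKey (.reg iMn)))
          (pPush (.reg iMn) ;; .setI iMn (.reg iX)) (pPush (.reg iX)))))

/-- Invariant of `pScan`. -/
structure ScanInv (B Z T : ℕ) (kids : ℕ → List ℕ) (t : ℕ) (s : State) : Prop where
  at_ : HeapAt s kids (s.ireg iMn ::ₘ (img (s.iarr aStk) (s.ireg iSp) + img (s.iarr aTab) B))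
  ne_zero : 0 ∉ img (s.iarr aStk) (s.ireg iSp)
  tab : ∀ i, s.iarr aTab i ≠ 0 → s.ireg iRk ≤ i ∧ i < s.ireg iMax ∧
    s.iarr aNd (s.iarr aItem (s.iarr aTab i)) = s.iarr aTab i
  max : s.ireg iMax ≤ B
  full : s.ireg iMn ≠ 0 → s.iarr aNd (s.iarr aItem (s.ireg iMn)) = s.ireg iMn
  le : ∀ x ∈ img (s.iarr aStk) (s.ireg iSp), s.rarr aKey (s.ireg iMn) ≤ s.rarr aKey x
  empty : s.ireg iMn = 0 → s.ireg iSp = 0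
  sp : s.ireg iSp ≤ s.ireg iRk
  rk : s.ireg iRk ≤ s.ireg iMax
  size : hsize s kids (s.ireg iMn ::ₘ (img (s.iarr aStk) (s.ireg iSp) + img (s.iarr aTab) B)) = Z
  time : t ≤ T + 60 * s.ireg iRk

/-- The table is traversed once, at a cost proportional to the number of ranks. There is at most one
root of each rank, so the stack ends with at most `B` entries. -/
theorem wp_scan {s : State} {B Z T t : ℕ} {kids : ℕ → List ℕ} (h : ScanInv B Z T kids t s) :
    wp pScan s t fun t' s' => ScanInv B Z (T + 10) kids t' s' ∧ s'.ireg iRk = s'.ireg iMax := by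
  refine wp_while (ScanInv B Z T kids) (T + 60 * B) h
    (fun t' s' h' => by have := h'.time; have := h'.rk; have := h'.max; omega) ?_ ?_
  · rintro t' s' - h hb
    simp only [Test.Holds, IExpr.eval] at hb
    simp only [wp_seq, wp_setI, wp_writeI, wp_ite, wp_skip, pPush, IExpr.eval, RExpr.eval,
      IExpr.cost, RExpr.cost, Test.cost, Test.Holds]
    simp
    set ρ := s'.ireg iRk with hρ
    set x := s'.iarr aTab ρ with hx
    set mn := s'.ireg iMn with hmn
    set sp := s'.ireg iSp with hsp
    have hρB : ρ < B := by have := h.max; omega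
    have hM : x ::ₘ img (Function.update (s'.iarr aTab) ρ 0) B = 0 ::ₘ img (s'.iarr aTab) B :=
      img_update_lt _ 0 hρB
    have hM' : x ::ₘ mn ::ₘ (img (s'.iarr aStk) sp + img (Function.update (s'.iarr aTab) ρ 0) B) =
        0 ::ₘ (mn ::ₘ (img (s'.iarr aStk) sp + img (s'.iarr aTab) B)) := by
      rw [Multiset.cons_swap, ← Multiset.add_cons, hM, Multiset.add_cons, Multiset.cons_swap]
    have hat : HeapAt s' kids
        (x ::ₘ mn ::ₘ (img (s'.iarr aStk) sp + img (Function.update (s'.iarr aTab) ρ 0) B)) := by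
      rw [hM', HeapAt.cons_zero]; exact h.at_
    have hsz : hsize s' kids
        (x ::ₘ mn ::ₘ (img (s'.iarr aStk) sp + img (Function.update (s'.iarr aTab) ρ 0) B)) = Z := by
      rw [hM', hsize, lsum_cons_zero]; exact h.size
    have htab : ∀ i, Function.update (s'.iarr aTab) ρ 0 i ≠ 0 → ρ + 1 ≤ i ∧ i < s'.ireg iMax ∧
        s'.iarr aNd (s'.iarr aItem (Function.update (s'.iarr aTab) ρ 0 i)) =
          Function.update (s'.iarr aTab) ρ 0 i := by
      intro i hi
      have : i ≠ ρ := by rintro rfl; simp at hi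
      rw [Function.update_of_ne this] at hi ⊢
      obtain ⟨b1, b2⟩ := h.tab i hi
      exact ⟨by omega, b2⟩
    have htime := h.time
    have hspr := h.sp
    refine ⟨fun hx0 => ?_, fun hx0 => ⟨fun hm0 => ?_, fun hm0 => ⟨fun hlt => ?_, fun hlt => ?_⟩⟩⟩
    · rw [hx0, HeapAt.cons_zero] at hat
      rw [hx0, hsize, lsum_cons_zero] at hsz
      constructor <;> simp <;> try omega
      · exact ⟨by simpa using hat.mem, by simpa using hat.inv⟩
      · exact h.ne_zero
      · exact htab
      · exact h.max
      · exact h.full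
      · exact h.le
      · exact h.empty
      · simpa [hsize] using hsz
    · have hsp0 := h.empty hm0
      have hfull := (h.tab ρ hx0).2.2
      rw [hm0, Multiset.cons_swap, HeapAt.cons_zero] at hat
      rw [hm0, Multiset.cons_swap, hsize, lsum_cons_zero] at hsz
      constructor <;> simp <;> try omega
      · exact ⟨by simpa using hat.mem, by simpa using hat.inv⟩
      · exact h.ne_zero
      · exact htab
      · exact h.max
      · exact fun _ => hfull
      · rw [hsp0, img_zero]; simp
      · simpa [hsize] using hsz
    · have hfull := (h.tab ρ hx0).2.2
      constructor <;> simp <;> try omega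
      · refine ⟨by simpa using hat.mem, ?_⟩
        simpa [img_push] using hat.inv
      · rw [img_push]; simpa using ⟨Ne.symm hm0, h.ne_zero⟩
      · exact htab
      · exact h.max
      · exact fun _ => hfull
      · rw [img_push]; simpa using ⟨hlt.le, fun y hy => hlt.le.trans (h.le y hy)⟩
      · simpa [hsize, img_push] using hsz
    · rw [Multiset.cons_swap] at hat hsz
      constructor <;> simp <;> try omega
      · refine ⟨by simpa using hat.mem, ?_⟩
        simpa [img_push] using hat.inv
      · rw [img_push]; simpa using ⟨Ne.symm hx0, h.ne_zero⟩
      · exact htab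
      · exact h.max
      · exact h.full
      · rw [img_push]; simpa using ⟨hlt, h.le⟩
      · simpa [hsize, img_push] using hsz
  · rintro t' s' - h hb
    simp only [Test.Holds, IExpr.eval, not_lt] at hb
    refine ⟨{ h with time := ?_ }, le_antisymm h.rk hb⟩
    have := h.time
    simp only [Test.cost, IExpr.cost]
    omega

/-- The entries of the list `iY` are pushed on the stack. -/
def pKids : Prog :=
  .while (.not (.ieq (.reg iY) (.const 0))) (
    pPush (.read aHd (.reg iY)) ;; .setI iY (.read aTl (.reg iY)))

theorem wp_kids {s : State} {t : ℕ} {kids : ℕ → List ℕ} {l : List ℕ}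
    (hl : LRep (s.iarr aHd) (s.iarr aTl) (s.ireg iCnt) (s.ireg iY) l) (hl0 : 0 ∉ l)
    (h : HeapAt s kids (↑l + img (s.iarr aStk) (s.ireg iSp)))
    (h0 : 0 ∉ img (s.iarr aStk) (s.ireg iSp)) (htab : ∀ i, s.iarr aTab i = 0)
    (hmax : s.ireg iMax = 0) :
    wp pKids s t fun t' s' => Heap s' kids ∧
      size s' kids = hsize s kids (↑l + img (s.iarr aStk) (s.ireg iSp)) ∧
      t' ≤ t + 40 * l.length + 10 ∧ s'.ireg iSp = s.ireg iSp + l.length := by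
  refine wp_while (fun t' s' => ∃ l',
    LRep (s'.iarr aHd) (s'.iarr aTl) (s'.ireg iCnt) (s'.ireg iY) l' ∧ 0 ∉ l' ∧
    HeapAt s' kids (↑l' + img (s'.iarr aStk) (s'.ireg iSp)) ∧
    0 ∉ img (s'.iarr aStk) (s'.ireg iSp) ∧
    hsize s' kids (↑l' + img (s'.iarr aStk) (s'.ireg iSp)) =
      hsize s kids (↑l + img (s.iarr aStk) (s.ireg iSp)) ∧
    t' + 40 * l'.length ≤ t + 40 * l.length ∧
    s'.ireg iSp + l'.length = s.ireg iSp + l.length) (t + 40 * l.length)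
    ⟨l, hl, hl0, h, h0, rfl, le_rfl, rfl⟩ ?_ ?_ ?_
  · rintro t' s' ⟨l', -, -, -, -, -, h, -⟩; omega
  · rintro t' s' - ⟨l', h1, h2, h3, h4, h5, h6, h7⟩ hb
    simp only [Test.Holds, IExpr.eval] at hb
    match l' with
    | [] => exact absurd h1 hb
    | a :: l' =>
      obtain ⟨-, -, e, h1⟩ := h1
      simp only [wp_seq, wp_setI, wp_writeI, pPush, IExpr.eval, IExpr.cost, Test.cost]
      have e' : ((a :: l' : List ℕ) : Multiset ℕ) + img (s'.iarr aStk) (s'.ireg iSp) =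
          ↑l' + (a ::ₘ img (s'.iarr aStk) (s'.ireg iSp)) := by
        rw [← Multiset.cons_coe, Multiset.cons_add, Multiset.add_cons]
      rw [e'] at h3 h5
      simp only [List.mem_cons, not_or, List.length_cons] at h2 h6 h7
      refine ⟨l', by simpa using h1, h2.2, ⟨by simpa using h3.mem, ?_⟩, ?_, ?_, ?_, ?_⟩
      · simpa [img_push, e] using h3.inv
      · simpa [img_push, e] using ⟨h2.1, h4⟩
      · simpa [img_push, e, hsize] using h5
      · simp; omega
      · simp; omega
  · rintro t' s' hf ⟨l', h1, h2, h3, h4, h5, h6, h7⟩ hb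
    simp only [Test.Holds, IExpr.eval, not_not] at hb
    have hl' : l' = [] := by
      cases l' with
      | nil => rfl
      | cons a l' => exact absurd hb h1.1
    subst hl'
    simp only [Multiset.coe_nil, zero_add] at h3 h5
    refine ⟨⟨h3, h4, fun i => ?_, ?_⟩, h5, ?_, by simpa using h7⟩
    · rw [hf.iarr aTab (by decide)]; exact htab i
    · rw [hf.ireg iMax (by decide)]; exact hmax
    · simp only [Test.cost, IExpr.cost]
      simp at h6
      omega

/-- An element with the least key, if there is one, is removed from the heap and stored in the
register `iU`; the register `iMn` tells whether there is one. -/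
def pExtract : Prog :=
  pConsolidate ;;
  .setI iMn (.const 0) ;; .setI iRk (.const 0) ;; pScan ;; .setI iMax (.const 0) ;;
  .ite (.ieq (.reg iMn) (.const 0)) .skip
    (.setI iU (.read aItem (.reg iMn)) ;; .writeI aNd (.reg iU) (.const 0) ;;
      .setI iY (.read aKp (.reg iMn)) ;; pKids)

/-- Consolidation is paid by the potential. The charge `1000 * (B + 1)` covers the scan of the
table, the roots it returns to the stack and the children of the removed root, of which there are
fewer than `B`, with 200 units of potential for each stack entry. The least root is full, so by heap
order its element has the least key. -/
theorem wp_extract {s : State} {B N t : ℕ} {kids : ℕ → List ℕ}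
    (hB : ∀ k, 2 ^ (k / 2) ≤ N → k < B) (h : Heap s kids) (hN : size s kids ≤ N) :
    wp pExtract s t fun t' s' => ∃ kids', Heap s' kids' ∧
      t' + 200 * s'.ireg iSp + 400 * size s' kids' ≤
        t + 200 * s.ireg iSp + 400 * size s kids + 1000 * (B + 1) ∧
      size s' kids' ≤ size s kids ∧
      ((s'.ireg iMn = 0 ∧ (∀ v, s.iarr aNd v = 0) ∧ ∀ v, s'.iarr aNd v = 0) ∨
        (s'.ireg iMn ≠ 0 ∧ s.iarr aNd (s'.ireg iU) ≠ 0 ∧ s'.iarr aNd (s'.ireg iU) = 0 ∧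
          (∀ v, v ≠ s'.ireg iU → (s'.iarr aNd v = 0 ↔ s.iarr aNd v = 0)) ∧
          ∀ v, s.iarr aNd v ≠ 0 → s.rarr aD (s'.ireg iU) ≤ s.rarr aD v)) := by
  -- An empty table contributes neither roots, nor nodes, nor potential.
  have himg0 : ∀ f : ℕ → ℕ, (∀ i, f i = 0) → ∀ L : Multiset ℕ,
      (∀ kids' item' nd' key' d' cnt', HInv kids' item' nd' key' d' cnt' (L + img f B) ↔
        HInv kids' item' nd' key' d' cnt' L) ∧ (∀ c, lsum c (L + img f B) = lsum c L) ∧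
      nz (img f B) = 0 := by
    intro f hf L
    clear hB
    induction B with
    | zero => simp [img_zero, nz]
    | succ B ih =>
      simp only [img_succ, hf B, Multiset.add_cons, HInv.cons_zero, lsum_cons_zero, nz_cons]
      exact ⟨ih.1, ih.2.1, by simpa using ih.2.2⟩
  -- The bound on the size is taken to be the present size and not the given `N`, so that
  -- consolidation is seen not to enlarge the heap.
  refine wp_seq_of (wp_consolidate (s := s) (kids := kids) (B := B) (N := size s kids)
    (T := t + 200 * s.ireg iSp + 400 * size s kids)
    (fun k hk => hB k (hk.trans hN)) ⟨?_, ?_, ?_, ?_, ?_, ?_, ?_⟩) ?_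
  · exact ⟨h.at_.mem, ((himg0 _ h.tab _).1 _ _ _ _ _ _).2 h.at_.inv⟩
  · exact h.ne_zero
  · exact fun i hi => absurd (h.tab i) hi
  · rw [h.max]; omega
  · rw [hsize, (himg0 _ h.tab _).2.1]; exact le_rfl
  · simp
  · rw [hsize, (himg0 _ h.tab _).2.1, (himg0 _ h.tab 0).2.2, size, hsize]; omega
  rintro t₁ s₁ hf₁ ⟨⟨kids₁, h₁⟩, hsp₁⟩
  have h1sz := h₁.size
  have h1t := h₁.time
  rw [wp_seq, wp_setI, wp_seq, wp_setI]
  simp only [IExpr.eval, IExpr.cost]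
  refine wp_seq_of (wp_scan (B := B) (kids := kids₁) (T := t₁ + 10) (Z := hsize s₁ kids₁
    (img (s₁.iarr aStk) (s₁.ireg iSp) + img (s₁.iarr aTab) B)) ?_) ?_
  · constructor <;> simp [hsp₁, img_zero]
    · exact ⟨by simpa using h₁.at_.mem, by
        simpa [hsp₁, img_zero, HInv.cons_zero] using h₁.at_.inv⟩
    · exact fun i hi => ⟨(h₁.tab i hi).1, (h₁.tab i hi).2.1⟩
    · exact h₁.max
    · simp [hsize, lsum_cons_zero]
  rintro t₂ s₂ hf₂ ⟨h₂, hrk⟩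
  have h2t := h₂.time
  have h2z := h₂.size
  have htab₂ : ∀ i, s₂.iarr aTab i = 0 := by
    intro i
    by_contra hi
    have := h₂.tab i hi
    omega
  have hmax₂ := h₂.max
  have hsp₂ := h₂.sp
  have end₂ : s₂.iarr aNd = s₁.iarr aNd := (hf₂.iarr _ (by decide)).trans (by simp)
  have ed₁ : s₁.rarr aD = s.rarr aD := hf₁.rarr _ (by decide)
  have ed₂ : s₂.rarr aD = s₁.rarr aD := (hf₂.rarr _ (by decide)).trans (by simp)
  have hinv₂ := h₂.at_.inv
  rw [← Multiset.cons_add, (himg0 _ htab₂ _).1] at hinv₂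
  rw [hsize, ← Multiset.cons_add, (himg0 _ htab₂ _).2.1] at h2z
  simp only [wp_seq, wp_setI, wp_writeI, wp_ite, wp_skip, IExpr.eval,
      IExpr.cost, Test.cost, Test.Holds]
  simp
  constructor
  · intro hm0
    have hsp0 := h₂.empty hm0
    rw [hm0, HInv.cons_zero, hsp0, img_zero] at hinv₂
    rw [hm0, lsum_cons_zero, hsp0, img_zero] at h2z
    have hall := hinv₂.eq_zero_of_roots (by simp)
    refine ⟨kids₁, ⟨⟨?_, ?_⟩, ?_, ?_, ?_⟩, ?_, ?_, .inl ⟨hm0, fun v => ?_, hall⟩⟩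
    · simpa using h₂.at_.mem
    · simpa [hsp0, img_zero] using hinv₂
    · simp [hsp0, img_zero]
    · simpa using htab₂
    · simp
    · simp [size, hsize, hsp0, img_zero] at h1t h2z ⊢
      omega
    · simp [size, hsize, hsp0, img_zero] at h1sz h2z ⊢
      omega
    · rw [← h₁.nd v, ← end₂]; exact hall v
  · intro hm0
    have hfull := h₂.full hm0
    set mn := s₂.ireg iMn with hmn
    set u := s₂.iarr aItem mn with hu
    obtain ⟨he1, he2⟩ := hinv₂.extract hm0 hfull
    rw [← hu] at he1 he2
    have hmc := hinv₂.roots mn (by simp)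
    have hklen : (kids₁ mn).length < B := by
      refine hB _ ((hinv₂.two_pow_le hm0 (by simp)).trans ?_)
      rw [h2z]; exact h1sz.trans hN
    have hndu : s₂.iarr aNd u ≠ 0 := by rw [hfull]; exact hm0
    have hkey : s₂.rarr aKey mn = s₂.rarr aD u := by
      have := (hinv₂.live u hndu).2.2.1
      rwa [hfull] at this
    refine (wp_kids (kids := kids₁) (l := kids₁ mn) ?_ ?_ ⟨?_, ?_⟩ ?_ ?_ ?_).frame.mono ?_
    · simpa using h₂.at_.mem.rep mn hmc
    · exact fun h0 => absurd (hinv₂.lt mn 0 h0).1 (lt_irrefl _)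
    · simpa using h₂.at_.mem
    · simpa using he1
    · simpa using h₂.ne_zero
    · simpa using htab₂
    · simp
    · rintro t₃ s₃ ⟨⟨h₃, h3z, h3t, h3sp⟩, hf₃⟩
      have eu : s₃.ireg iU = u := (hf₃.ireg _ (by decide)).trans (by simp)
      have emn : s₃.ireg iMn = mn := (hf₃.ireg _ (by decide)).trans (by simp [hmn])
      have end₃ : s₃.iarr aNd = Function.update (s₂.iarr aNd) u 0 :=
        (hf₃.iarr _ (by decide)).trans (by simp)
      simp [hsize] at h3z h3t h3sp h1t h1sz
      refine ⟨kids₁, h₃, ?_, ?_, .inr ⟨by rwa [emn], ?_, ?_, fun v hv => ?_, fun v hv => ?_⟩⟩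
      · simp [hsize] at h2z; omega
      · simp [hsize] at h2z; omega
      · rw [eu]; exact fun e => hndu (by rw [end₂]; exact (h₁.nd u).2 e)
      · rw [eu, end₃]; simp
      · rw [eu] at hv
        rw [end₃, Function.update_of_ne hv, end₂]; exact h₁.nd v
      · rw [eu, ← ed₁, ← ed₂, ← hkey]
        refine hinv₂.key_min (fun x hx hx0 => ?_) (v := v) ?_
        · rcases Multiset.mem_cons.1 hx with rfl | hx
          · exact le_rfl
          · exact h₂.le x hx
        · rw [end₂]; exact fun e => hv ((h₁.nd v).1 e)

/-! ## Searching from a root: the invariant -/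

/-- What the search has computed: the set `S` of scanned vertices, the set `Q` of vertices in the
heap, tentative distances, parents, numbers of arcs from the root, branches (children of the root)
and the best candidate for a cycle. -/
structure View where
  S : Finset ℕ
  Q : Set ℕ
  d : ℕ → ℝ
  par : ℕ → ℕ
  hop : ℕ → ℕ
  br : ℕ → ℕ
  has : ℕ
  imp : ℕ
  cu : ℕ
  cv : ℕ
  best : ℝ

/-- The arc from `u` to `v` closes a cycle through the root `r`. -/
def Closes (und : Bool) (r : ℕ) (par br : ℕ → ℕ) (u v : ℕ) : Prop :=
  if und then br u ≠ br v ∧ par u ≠ v ∧ par v ≠ u else v = r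

/-- The hypotheses on the adjacency lists. -/
structure AdjOK (n : ℕ) (und : Bool) (adj : ℕ → List (ℕ × ℝ)) : Prop where
  lt : ∀ u, ∀ e ∈ adj u, e.1 < n
  nonneg : ∀ u, ∀ e ∈ adj u, 0 ≤ e.2
  loopless : ∀ u, ∀ e ∈ adj u, e.1 ≠ u
  symm : und = true → ∀ u v x, (v, x) ∈ adj u → (u, x) ∈ adj v

/-- The invariant of the search from `r` avoiding the vertices `v` with `del v ≠ 0`: of the arcs
from scanned vertices, those in `ex` have been examined; the vertex `o` is being scanned. -/
structure RunInv (n : ℕ) (und : Bool) (adj : ℕ → List (ℕ × ℝ)) (del : ℕ → ℕ) (r has₀ : ℕ)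
    (best₀ : ℝ) (ex : ℕ → List (ℕ × ℝ)) (o : ℕ) (V : View) : Prop where
  queue : ∀ v ∈ V.Q, v < n ∧ v ∉ V.S ∧ del v = 0
  scanned : ∀ v ∈ V.S, v < n ∧ del v = 0
  root : r ∈ V.S ∨ r ∈ V.Q ∧ V.S = ∅ ∧ ∀ v ∈ V.Q, v = r
  root_val : V.d r = 0 ∧ V.hop r = 0 ∧ V.br r = r ∧ V.par r = r
  tree : ∀ v, v ∈ V.S ∨ v ∈ V.Q → v ≠ r → V.par v ∈ V.S ∧
    (∃ x, (v, x) ∈ adj (V.par v) ∧ V.d v = V.d (V.par v) + x) ∧ V.hop v = V.hop (V.par v) + 1 ∧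
    V.br v = if V.par v = r then v else V.br (V.par v)
  relaxed : ∀ u ∈ V.S, ∀ e ∈ ex u, del e.1 = 0 → (e.1 ∈ V.S ∨ e.1 ∈ V.Q) ∧ V.d e.1 ≤ V.d u + e.2
  mono : ∀ u ∈ V.S, ∀ v ∈ V.Q, V.d u ≤ V.d v
  last : o ∈ V.S → ∀ u ∈ V.S, V.d u ≤ V.d o
  first : o = r → ∀ u ∈ V.S, u = r
  cand : ∀ u ∈ V.S, ∀ e ∈ ex u, e.1 ∈ V.S → e.1 ≠ o → Closes und r V.par V.br u e.1 →
    V.has ≠ 0 ∧ V.best ≤ V.d u + e.2 + V.d e.1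
  best : (V.imp = 0 ∧ V.has = has₀ ∧ V.best = best₀) ∨
    (V.imp ≠ 0 ∧ V.has ≠ 0 ∧ (has₀ ≠ 0 → V.best ≤ best₀) ∧ V.cu ∈ V.S ∧ V.cv ∈ V.S ∧
      Closes und r V.par V.br V.cu V.cv ∧
      ∃ x, (V.cv, x) ∈ adj V.cu ∧ V.best = V.d V.cu + x + V.d V.cv)

section RunInv

variable {n : ℕ} {und : Bool} {adj : ℕ → List (ℕ × ℝ)} {del : ℕ → ℕ} {r has₀ : ℕ} {best₀ : ℝ}
  {ex : ℕ → List (ℕ × ℝ)} {o : ℕ} {V : View}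

theorem Closes.congr {par par' br br' : ℕ → ℕ} {u v : ℕ} (h : Closes und r par br u v)
    (hu : par' u = par u ∧ br' u = br u) (hv : par' v = par v ∧ br' v = br v) :
    Closes und r par' br' u v := by
  unfold Closes at h ⊢
  rwa [hu.1, hu.2, hv.1, hv.2]

/-- A vertex of the queue with the least distance becomes scanned. -/
theorem RunInv.select (h : RunInv n und adj del r has₀ best₀ adj o V) (ho : n ≤ o) {u : ℕ}
    (hu : u ∈ V.Q) (hmin : ∀ v ∈ V.Q, V.d u ≤ V.d v) :
    RunInv n und adj del r has₀ best₀ (Function.update adj u []) u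
      { V with S := insert u V.S, Q := V.Q \ {u} } := by
  obtain ⟨hun, huS, hud⟩ := h.queue u hu
  have hex : ∀ a, ∀ e ∈ Function.update adj u [] a, a ≠ u ∧ e ∈ adj a := by
    intro a e he
    by_cases hau : a = u
    · subst hau; simp at he
    · rw [Function.update_of_ne hau] at he; exact ⟨hau, he⟩
  constructor
  · rintro v ⟨hv, hvu⟩
    obtain ⟨h1, h2, h3⟩ := h.queue v hv
    exact ⟨h1, by simpa [h2] using hvu, h3⟩
  · intro v hv
    rcases Finset.mem_insert.1 hv with rfl | hv
    · exact ⟨hun, hud⟩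
    · exact h.scanned v hv
  · rcases h.root with h1 | ⟨h1, h2, h3⟩
    · exact .inl (Finset.mem_insert_of_mem h1)
    · left; rw [h3 u hu]; simp
  · exact h.root_val
  · intro v hv hvr
    have hv' : v ∈ V.S ∨ v ∈ V.Q := by
      rcases hv with hv | hv
      · rcases Finset.mem_insert.1 hv with rfl | hv
        · exact .inr hu
        · exact .inl hv
      · exact .inr hv.1
    obtain ⟨h1, h2⟩ := h.tree v hv' hvr
    exact ⟨Finset.mem_insert_of_mem h1, h2⟩
  · intro a ha e he hd
    obtain ⟨hau, he⟩ := hex a e he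
    obtain ⟨h1, h2⟩ := h.relaxed a (by simpa [hau] using ha) e he hd
    refine ⟨?_, h2⟩
    by_cases heu : e.1 = u
    · left; simp [heu]
    · rcases h1 with h1 | h1
      · exact .inl (Finset.mem_insert_of_mem h1)
      · exact .inr ⟨h1, heu⟩
  · intro a ha v hv
    rcases Finset.mem_insert.1 ha with rfl | ha
    · exact hmin v hv.1
    · exact h.mono a ha v hv.1
  · intro _ a ha
    rcases Finset.mem_insert.1 ha with rfl | ha
    · exact le_rfl
    · exact h.mono a ha u hu
  · intro hur a ha
    rcases Finset.mem_insert.1 ha with rfl | ha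
    · exact hur
    · rcases h.root with h1 | ⟨h1, h2, h3⟩
      · rw [hur] at huS; exact absurd h1 huS
      · rw [h2] at ha; simp at ha
  · intro a ha e he heS heo hc
    obtain ⟨hau, he⟩ := hex a e he
    have heS' : e.1 ∈ V.S := by simpa [heo] using heS
    have := (h.scanned _ heS').1
    exact h.cand a (by simpa [hau] using ha) e he heS' (by omega) hc
  · rcases h.best with h1 | ⟨h1, h2, h3, h4, h5, h6⟩
    · exact .inl h1
    · exact .inr ⟨h1, h2, h3, Finset.mem_insert_of_mem h4, Finset.mem_insert_of_mem h5, h6⟩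

/-- All arcs of the vertex being scanned have been examined. -/
theorem RunInv.finish (hadj : AdjOK n und adj) (h : RunInv n und adj del r has₀ best₀ adj o V)
    (ho : o ∈ V.S) (hr : r < n) : RunInv n und adj del r has₀ best₀ adj n V := by
  refine { h with last := fun hn => ?_, first := fun e => ?_, cand := ?_ }
  · exact absurd (h.scanned n hn).1 (lt_irrefl _)
  · omega
  · rintro u hu ⟨v, x⟩ he hv - hc
    -- Arcs into `o` were examined while `o` was still in the queue, so they gave no candidate. In
    -- the undirected case the reverse arc has now been examined from `o`. In the directed case the
    -- arc closes a cycle only if `o = r`, and then `r` is the only scanned vertex and the arc would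
    -- be a loop.
    by_cases hvo : v = o
    · subst hvo
      have hne := hadj.loopless u _ he
      cases und with
      | false =>
        have hvr : v = r := by simpa [Closes] using hc
        exact absurd (hvr.trans (h.first hvr u hu).symm) hne
      | true =>
        obtain ⟨h1, h2⟩ := h.cand v ho (u, x) (hadj.symm rfl u v x he) hu (Ne.symm hne) (by
          simp only [Closes, if_true] at hc ⊢
          exact ⟨hc.1.symm, hc.2.2, hc.2.1⟩)
        exact ⟨h1, by linarith⟩
    · exact h.cand u hu (v, x) he hv hvo hc

theorem mem_update_append {u a : ℕ} {e f : ℕ × ℝ}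
    (h : f ∈ Function.update ex u (ex u ++ [e]) a) : f ∈ ex a ∨ a = u ∧ f = e := by
  by_cases ha : a = u
  · subst ha
    rw [Function.update_self, List.mem_append, List.mem_singleton] at h
    exact h.imp_right fun h => ⟨rfl, h⟩
  · rw [Function.update_of_ne ha] at h; exact .inl h

/-- An arc that changes nothing has been examined. -/
theorem RunInv.pass (h : RunInv n und adj del r has₀ best₀ ex o V) {e : ℕ × ℝ}
    (hrel : del e.1 = 0 → (e.1 ∈ V.S ∨ e.1 ∈ V.Q) ∧ V.d e.1 ≤ V.d o + e.2)
    (hcand : e.1 ∈ V.S → Closes und r V.par V.br o e.1 →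
      V.has ≠ 0 ∧ V.best ≤ V.d o + e.2 + V.d e.1) :
    RunInv n und adj del r has₀ best₀ (Function.update ex o (ex o ++ [e])) o V := by
  refine { h with relaxed := ?_, cand := ?_ }
  · intro a ha f hf hd
    rcases mem_update_append hf with hf | ⟨rfl, rfl⟩
    · exact h.relaxed a ha f hf hd
    · exact hrel hd
  · intro a ha f hf hfS hfo hc
    rcases mem_update_append hf with hf | ⟨rfl, rfl⟩
    · exact h.cand a ha f hf hfS hfo hc
    · exact hcand hfS hc

/-- An arc to a scanned vertex gives a better candidate. -/
theorem RunInv.improve (h : RunInv n und adj del r has₀ best₀ ex o V) {e : ℕ × ℝ}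
    (he : e ∈ adj o) (ho : o ∈ V.S) (heS : e.1 ∈ V.S) (hx : 0 ≤ e.2)
    (hc : Closes und r V.par V.br o e.1)
    (hb : V.has = 0 ∨ V.d o + e.2 + V.d e.1 < V.best) :
    RunInv n und adj del r has₀ best₀ (Function.update ex o (ex o ++ [e])) o
      { V with has := 1, imp := 1, cu := o, cv := e.1, best := V.d o + e.2 + V.d e.1 } := by
  refine { h with relaxed := ?_, cand := ?_, best := ?_ }
  · intro a ha f hf hd
    rcases mem_update_append hf with hf | ⟨rfl, rfl⟩
    · exact h.relaxed a ha f hf hd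
    -- No scanned vertex is farther from the root than the one being scanned, and the weight is
    -- nonnegative.
    · exact ⟨.inl heS, by have := h.last ho _ heS; show V.d f.1 ≤ V.d a + f.2; linarith⟩
  · intro a ha f hf hfS hfo hc
    refine ⟨one_ne_zero, ?_⟩
    rcases mem_update_append hf with hf | ⟨rfl, rfl⟩
    · obtain ⟨h1, h2⟩ := h.cand a ha f hf hfS hfo hc
      exact (hb.resolve_left h1).le.trans h2
    · exact le_rfl
  · refine .inr ⟨one_ne_zero, one_ne_zero, fun h0 => ?_, ho, heS, hc, e.2, he, rfl⟩
    rcases h.best with ⟨h1, h2, h3⟩ | ⟨h1, h2, h3, -⟩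
    · rw [← h3]; exact (hb.resolve_left (by rw [h2]; exact h0)).le
    · exact (hb.resolve_left h2).le.trans (h3 h0)

/-- An arc gives a new or better path to a vertex that is not scanned. -/
theorem RunInv.relax (h : RunInv n und adj del r has₀ best₀ ex o V) {e : ℕ × ℝ}
    (he : e ∈ adj o) (ho : o ∈ V.S) (heS : e.1 ∉ V.S) (hx : 0 ≤ e.2) (hn : e.1 < n)
    (hd : del e.1 = 0) (hb : e.1 ∈ V.Q → V.d o + e.2 < V.d e.1) :
    RunInv n und adj del r has₀ best₀ (Function.update ex o (ex o ++ [e])) o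
      { V with
        Q := insert e.1 V.Q
        d := Function.update V.d e.1 (V.d o + e.2)
        par := Function.update V.par e.1 o
        hop := Function.update V.hop e.1 (V.hop o + 1)
        br := Function.update V.br e.1 (if o = r then e.1 else V.br o) } := by
  obtain ⟨v, x⟩ := e
  simp only at heS hx hn hd hb ⊢
  have hrS : r ∈ V.S := h.root.resolve_right fun h' => by rw [h'.2.1] at ho; simp at ho
  have hne : ∀ a ∈ V.S, a ≠ v := fun a ha e => heS (e ▸ ha)
  constructor
  · intro a ha
    rcases ha with rfl | ha
    · exact ⟨hn, heS, hd⟩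
    · exact h.queue a ha
  · exact h.scanned
  · exact .inl hrS
  · simp only [Function.update_of_ne (hne r hrS)]; exact h.root_val
  · intro a ha har
    by_cases hav : a = v
    · subst hav
      simp only [Function.update_self, Function.update_of_ne (hne o ho)]
      exact ⟨ho, ⟨x, he, rfl⟩, trivial, trivial⟩
    · have ha' : a ∈ V.S ∨ a ∈ V.Q := ha.imp_right fun h' => h'.resolve_left hav
      have h1 := h.tree a ha' har
      simp only [Function.update_of_ne hav, Function.update_of_ne (hne _ h1.1)]
      exact h1
  · intro a ha f hf hfd
    simp only [Function.update_of_ne (hne a ha)]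
    rcases mem_update_append hf with hf | ⟨rfl, rfl⟩
    · obtain ⟨h1, h2⟩ := h.relaxed a ha f hf hfd
      refine ⟨h1.imp_right fun h' => .inr h', ?_⟩
      by_cases hfv : f.1 = v
      · rw [hfv, Function.update_self]
        rw [hfv] at h1 h2
        exact (hb (h1.resolve_left heS)).le.trans h2
      · rw [Function.update_of_ne hfv]; exact h2
    · simp
  · intro a ha w hw
    simp only [Function.update_of_ne (hne a ha)]
    -- The weight is nonnegative, so the new tentative distance is at least that of `o`, the largest
    -- of the scanned vertices.
    by_cases hwv : w = v
    · rw [hwv, Function.update_self]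
      have := h.last ho a ha
      linarith
    · rw [Function.update_of_ne hwv]
      exact h.mono a ha w (hw.resolve_left hwv)
  · intro _ a ha
    simp only [Function.update_of_ne (hne a ha), Function.update_of_ne (hne o ho)]
    exact h.last ho a ha
  · exact h.first
  · intro a ha f hf hfS hfo hc
    simp only [Function.update_of_ne (hne a ha), Function.update_of_ne (hne _ hfS)]
    rcases mem_update_append hf with hf | ⟨rfl, rfl⟩
    · refine h.cand a ha f hf hfS hfo (hc.congr ?_ ?_)
      · simp only [Function.update_of_ne (hne a ha)]; exact ⟨trivial, trivial⟩
      · simp only [Function.update_of_ne (hne _ hfS)]; exact ⟨trivial, trivial⟩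
    · exact absurd hfS heS
  · rcases h.best with h1 | ⟨h1, h2, h3, h4, h5, h6, h7⟩
    · exact .inl h1
    · refine .inr ⟨h1, h2, h3, h4, h5, h6.congr ?_ ?_, ?_⟩
      · simp only [Function.update_of_ne (hne _ h4)]; exact ⟨trivial, trivial⟩
      · simp only [Function.update_of_ne (hne _ h5)]; exact ⟨trivial, trivial⟩
      · simp only [Function.update_of_ne (hne _ h4), Function.update_of_ne (hne _ h5)]; exact h7

/-- The state of the search before its first step. -/
theorem RunInv.start (hr : r < n) (hd : del r = 0) (hS : V.S = ∅) (hQ : V.Q = {r})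
    (hv : V.d r = 0 ∧ V.hop r = 0 ∧ V.br r = r ∧ V.par r = r) (himp : V.imp = 0) :
    RunInv n und adj del r V.has V.best adj n V := by
  constructor <;> simp [hS, hQ, hv, himp, hr, hd]

end RunInv

/-! ## Searching from a root: the program -/

/-- `p` points to a linked list of arcs with the ends and weights `l`. -/
def ALRep (tgt next : ℕ → ℕ) (wt : ℕ → ℝ) : ℕ → List (ℕ × ℝ) → Prop
  | p, [] => p = 0
  | p, e :: l => p ≠ 0 ∧ tgt p = e.1 ∧ wt p = e.2 ∧ ALRep tgt next wt (next p) l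

/-- The arrays hold the adjacency lists `adj`. -/
def AdjAt (n : ℕ) (adj : ℕ → List (ℕ × ℝ)) (s : State) : Prop :=
  ∀ u < n, ALRep (s.iarr aTo) (s.iarr aNext) (s.rarr aWt) (s.iarr aHead u) (adj u)

/-- A vertex counts as scanned if it bears the stamp `r + 1` of the present root. Each root is used
only once, so the marks need not be cleared between searches. -/
def view (n : ℕ) (s : State) : View where
  S := (Finset.range n).filter fun v => s.iarr aScn v = s.ireg iR + 1
  Q := {v | s.iarr aNd v ≠ 0}
  d := s.rarr aD
  par := s.iarr aPar
  hop := s.iarr aHop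
  br := s.iarr aBr
  has := s.ireg iHas
  imp := s.ireg iImp
  cu := s.ireg iCu
  cv := s.ireg iCv
  best := s.rreg rBest

/-- Tests whether the arc from `iU` to `iW` closes a cycle. -/
def tCloses : Bool → Test
  | true => .and (.not (.ieq (.read aBr (.reg iU)) (.read aBr (.reg iW))))
      (.and (.not (.ieq (.read aPar (.reg iU)) (.reg iW)))
        (.not (.ieq (.read aPar (.reg iW)) (.reg iU))))
  | false => .ieq (.reg iW) (.reg iR)

theorem tCloses_holds {und : Bool} {s : State} : (tCloses und).Holds s ↔
    Closes und (s.ireg iR) (s.iarr aPar) (s.iarr aBr) (s.ireg iU) (s.ireg iW) := by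
  cases und <;> simp [tCloses, Closes, Test.Holds, IExpr.eval]

theorem tCloses_cost (und : Bool) : (tCloses und).cost ≤ 30 := by
  cases und <;> simp [tCloses, Test.cost, IExpr.cost]

/-- Considers the arc from `iU` to the scanned vertex `iW` as a candidate. -/
def pCandidate (und : Bool) : Prog :=
  .ite (tCloses und)
    (.setR rK (.add (.add (.read aD (.reg iU)) (.read aWt (.reg iA))) (.read aD (.reg iW))) ;;
      .ite (.or (.ieq (.reg iHas) (.const 0)) (.rlt (.reg rK) (.reg rBest)))
        (.setR rBest (.reg rK) ;; .setI iHas (.const 1) ;; .setI iImp (.const 1) ;;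
          .setI iCu (.reg iU) ;; .setI iCv (.reg iW)) .skip) .skip

/-- Relaxes the arc from `iU` to the vertex `iW`, which is not scanned. -/
def pRelax : Prog :=
  .setR rK (.add (.read aD (.reg iU)) (.read aWt (.reg iA))) ;;
  .ite (.or (.ieq (.read aNd (.reg iW)) (.const 0)) (.rlt (.reg rK) (.read aD (.reg iW))))
    (pInsert ;; .writeI aPar (.reg iW) (.reg iU) ;;
      .writeI aHop (.reg iW) (.succ (.read aHop (.reg iU))) ;;
      .ite (.ieq (.reg iU) (.reg iR)) (.writeI aBr (.reg iW) (.reg iW))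
        (.writeI aBr (.reg iW) (.read aBr (.reg iU)))) .skip

/-- Examines the arc `iA` from the vertex `iU`. -/
def pArc (und : Bool) : Prog :=
  .setI iW (.read aTo (.reg iA)) ;;
  .ite (.ieq (.read aDel (.reg iW)) (.const 0))
    (.ite (.ieq (.read aScn (.reg iW)) (.succ (.reg iR))) (pCandidate und) pRelax) .skip ;;
  .setI iA (.read aNext (.reg iA))

/-- The invariant of the search in memory. -/
structure SearchInv (n : ℕ) (und : Bool) (adj : ℕ → List (ℕ × ℝ)) (has₀ : ℕ)
    (best₀ : ℝ) (B T : ℕ) (ex : ℕ → List (ℕ × ℝ)) (o : ℕ) (kids : ℕ → List ℕ) (t : ℕ) (s : State) :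
    Prop where
  run : RunInv n und adj (s.iarr aDel) (s.ireg iR) has₀ best₀ ex o (view n s)
  heap : Heap s kids
  size : size s kids ≤ 1 + ∑ v ∈ (view n s).S, (ex v).length
  time : t + 200 * s.ireg iSp + 400 * TreeDepthCycle.size s kids ≤
    T + 2000 * ∑ v ∈ (view n s).S, ((ex v).length + (B + 1))

/-- Used with `c = 0` to count nodes of the heap, and with `c = B + 1` to count time, where each
scanned vertex also pays for its extraction. -/
theorem sum_update_append {S : Finset ℕ} {adj : ℕ → List (ℕ × ℝ)} {u : ℕ} (hu : u ∈ S)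
    (l : List (ℕ × ℝ)) (e : ℕ × ℝ) (c : ℕ) :
    ∑ v ∈ S, ((Function.update adj u (l ++ [e]) v).length + c) =
      ∑ v ∈ S, ((Function.update adj u l v).length + c) + 1 := by
  rw [← Finset.add_sum_erase _ _ hu, ← Finset.add_sum_erase _ _ hu]
  simp only [Function.update_self, List.length_append, List.length_singleton]
  have : ∀ l : List (ℕ × ℝ), ∑ v ∈ S.erase u, ((Function.update adj u l v).length + c) =
      ∑ v ∈ S.erase u, ((adj v).length + c) := fun l => Finset.sum_congr rfl fun v hv => by
    rw [Function.update_of_ne (Finset.ne_of_mem_erase hv)]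
  rw [this, this]
  omega

theorem Heap.congr {s s' : State} {kids : ℕ → List ℕ} (h : Heap s kids)
    (hi : ∀ x, x = iCnt ∨ x = iSp ∨ x = iMax → s'.ireg x = s.ireg x)
    (ha : ∀ a, a = aNd ∨ 12 ≤ a → s'.iarr a = s.iarr a)
    (hr : s'.rarr aKey = s.rarr aKey) (hd : s'.rarr aD = s.rarr aD) : Heap s' kids := by
  have e1 := hi iCnt (by simp)
  have e2 := hi iSp (by simp)
  have e3 := hi iMax (by simp)
  have f1 := ha aNd (by simp)
  have f2 := ha aItem (by simp)
  have f3 := ha aKp (by simp)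
  have f4 := ha aRk (by simp)
  have f5 := ha aHd (by simp)
  have f6 := ha aTl (by simp)
  have f7 := ha aStk (by simp)
  have f8 := ha aTab (by simp)
  exact ⟨⟨by rw [f3, f4, f5, f6, e1]; exact h.at_.mem,
    by rw [f2, f1, hr, hd, e1, f7, e2]; exact h.at_.inv⟩, by rw [f7, e2]; exact h.ne_zero,
    by rw [f8]; exact h.tab, by rw [e3]; exact h.max⟩

theorem size_congr {s s' : State} {kids : ℕ → List ℕ}
    (hi : s'.ireg iSp = s.ireg iSp) (ha : ∀ a, a = aNd ∨ 12 ≤ a → s'.iarr a = s.iarr a) :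
    size s' kids = size s kids := by
  rw [size, size, hsize, hsize, ha aNd (by simp), ha aItem (by simp), ha aStk (by simp), hi]

/-- An arc causes at most one insertion, which raises the potential by at most 600 and the clock by
a constant. The 2000 units granted to each examined arc cover both. -/
theorem wp_arc {n : ℕ} {und : Bool} {adj : ℕ → List (ℕ × ℝ)} {has₀ : ℕ} {best₀ : ℝ} {B T u : ℕ}
    {kids : ℕ → List ℕ} {t t₀ : ℕ} {s : State} {l l' : List (ℕ × ℝ)} {e : ℕ × ℝ}
    (hadj : AdjOK n und adj)
    (h : SearchInv n und adj has₀ best₀ B T (Function.update adj u l) u kids t₀ s)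
    (ht₀ : t ≤ t₀ + 10) (hu : s.ireg iU = u) (huS : u ∈ (view n s).S) (hl : adj u = l ++ e :: l')
    (hto : s.iarr aTo (s.ireg iA) = e.1) (hwt : s.rarr aWt (s.ireg iA) = e.2) :
    wp (pArc und) s t fun t' s' => (∃ kids, SearchInv n und adj has₀ best₀ B T
      (Function.update adj u (l ++ [e])) u kids t' s') ∧
      s'.ireg iA = s.iarr aNext (s.ireg iA) := by
  have he : e ∈ adj u := by rw [hl]; simp
  have hn := hadj.lt u e he
  have hx := hadj.nonneg u e he
  have hrun := h.run
  have hup : Function.update (Function.update adj u l) u (Function.update adj u l u ++ [e]) =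
      Function.update adj u (l ++ [e]) := by simp
  have hsum1 := sum_update_append (adj := adj) huS l e (B + 1)
  have hsum0 := sum_update_append (adj := adj) huS l e 0
  simp only [add_zero] at hsum0
  have htime := h.time
  have hsize := h.size
  -- nothing but scratch registers and the candidate changes
  have same : ∀ t' s', t' ≤ t + 300 →
      (∀ x, x = iCnt ∨ x = iSp ∨ x = iMax ∨ x = iR → s'.ireg x = s.ireg x) →
      s'.iarr = s.iarr → s'.rarr = s.rarr →
      RunInv n und adj (s.iarr aDel) (s.ireg iR) has₀ best₀
        (Function.update adj u (l ++ [e])) u (view n s') →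
      ∃ kids, SearchInv n und adj has₀ best₀ B T (Function.update adj u (l ++ [e])) u kids t' s' := by
    intro t' s' ht hi ha hr hrun'
    have er : s'.ireg iR = s.ireg iR := hi _ (by simp)
    have eS : (view n s').S = (view n s).S := by simp [view, ha, er]
    have esz : size s' kids = size s kids :=
      size_congr (hi _ (by simp)) fun a _ => by rw [ha]
    refine ⟨kids, by rw [ha, er]; exact hrun', h.heap.congr (fun x hx => hi x (by tauto))
      (fun a _ => by rw [ha]) (by rw [hr]) (by rw [hr]), ?_, ?_⟩
    · rw [eS, esz]; omega
    · rw [eS, esz, hi iSp (by simp)]; omega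
  have memS : ∀ v, v ∈ (view n s).S ↔ v < n ∧ s.iarr aScn v = s.ireg iR + 1 := by simp [view]
  simp only [pArc, wp_seq, wp_setI, wp_ite, IExpr.eval, IExpr.cost, Test.cost, Test.Holds]
  simp [hto]
  refine ⟨fun hdel => ⟨fun hscn => ?_, fun hscn => ?_⟩, fun hdel => ?_⟩
  · have heS : e.1 ∈ (view n s).S := (memS _).2 ⟨hn, hscn⟩
    have hcost := tCloses_cost und
    simp only [pCandidate, wp_seq, wp_setI, wp_setR, wp_ite, wp_skip, IExpr.eval, RExpr.eval,
      IExpr.cost, RExpr.cost, Test.cost, Test.Holds, tCloses_holds]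
    simp [hu, hwt]
    have hrel : (e.1 ∈ (view n s).S ∨ e.1 ∈ (view n s).Q) ∧
        (view n s).d e.1 ≤ (view n s).d u + e.2 :=
      ⟨.inl heS, by have := hrun.last huS _ heS; linarith⟩
    refine ⟨fun hc => ⟨fun hb => ?_, fun hb0 hb => ?_⟩, fun hc => ?_⟩
    · refine same _ _ (by omega) (by simp) (by simp) (by simp) ?_
      have := hrun.improve he huS heS hx hc hb
      rw [hup] at this
      convert this using 1
      simp [view]
    · refine same _ _ (by omega) (by simp) (by simp) (by simp) ?_
      have := hrun.pass (e := e) (fun _ => hrel) fun _ _ => ⟨hb0, hb⟩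
      rw [hup] at this
      convert this using 1
      simp [view]
    · refine same _ _ (by omega) (by simp) (by simp) (by simp) ?_
      have := hrun.pass (e := e) (fun _ => hrel) fun _ hc' => absurd hc' hc
      rw [hup] at this
      convert this using 1
      simp [view]
  · have heS : e.1 ∉ (view n s).S := fun h' => hscn ((memS _).1 h').2
    simp only [pRelax, wp_seq, wp_setR, wp_ite, wp_skip, wp_writeI, IExpr.eval, RExpr.eval,
      IExpr.cost, RExpr.cost, Test.cost, Test.Holds]
    simp [hu, hwt]
    constructor
    · intro hb
      refine (wp_insert (kids := kids) (h.heap.congr ?_ ?_ ?_ ?_) ?_).frame.mono ?_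
      · simp
      · simp
      · simp
      · simp
      · simpa using fun h0 => (hb.resolve_left h0).le
      rintro t₁ s₁ ⟨⟨kids₁, h₁, ht₁, hsp₁, hsz₁, hnd₁, hd₁, hcnt⟩, hf₁⟩
      have eU : s₁.ireg iU = u := (hf₁.ireg _ (by decide)).trans (by simp [hu])
      have eR : s₁.ireg iR = s.ireg iR := (hf₁.ireg _ (by decide)).trans (by simp)
      have eW : s₁.ireg iW = e.1 := (hf₁.ireg _ (by decide)).trans (by simp)
      have eA : s₁.ireg iA = s.ireg iA := (hf₁.ireg _ (by decide)).trans (by simp)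
      have eHas : s₁.ireg iHas = s.ireg iHas := (hf₁.ireg _ (by decide)).trans (by simp)
      have eImp : s₁.ireg iImp = s.ireg iImp := (hf₁.ireg _ (by decide)).trans (by simp)
      have eCu : s₁.ireg iCu = s.ireg iCu := (hf₁.ireg _ (by decide)).trans (by simp)
      have eCv : s₁.ireg iCv = s.ireg iCv := (hf₁.ireg _ (by decide)).trans (by simp)
      have eB : s₁.rreg rBest = s.rreg rBest := (hf₁.rreg _ (by decide)).trans (by simp)
      have ePar : s₁.iarr aPar = s.iarr aPar := (hf₁.iarr _ (by decide)).trans (by simp)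
      have eHop : s₁.iarr aHop = s.iarr aHop := (hf₁.iarr _ (by decide)).trans (by simp)
      have eBr : s₁.iarr aBr = s.iarr aBr := (hf₁.iarr _ (by decide)).trans (by simp)
      have eScn : s₁.iarr aScn = s.iarr aScn := (hf₁.iarr _ (by decide)).trans (by simp)
      have eDel : s₁.iarr aDel = s.iarr aDel := (hf₁.iarr _ (by decide)).trans (by simp)
      have eNext : s₁.iarr aNext = s.iarr aNext := (hf₁.iarr _ (by decide)).trans (by simp)
      simp at hnd₁ hd₁ hcnt hsp₁
      have hrun₁ := hrun.relax he huS heS hx hn hdel (fun hq => hb.resolve_left hq)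
      rw [hup] at hrun₁
      have esz : size (((s.setI iW e.1).setR rK (s.rarr aD u + e.2))) kids = size s kids :=
        size_congr (by simp) (by simp)
      rw [esz] at hsz₁
      have hQ : {v | Function.update (s.iarr aNd) e.1 (s.ireg iCnt) v ≠ 0} =
          insert e.1 {v | s.iarr aNd v ≠ 0} := by
        ext w
        by_cases hw : w = e.1
        · simp [hw, hcnt.ne']
        · simp [hw]
      -- the tail is the same for both values of the branch
      have fin : ∀ t' s', t' ≤ t₁ + 50 → s'.iarr aPar = Function.update (s.iarr aPar) e.1 u →
          s'.iarr aHop = Function.update (s.iarr aHop) e.1 (s.iarr aHop u + 1) →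
          s'.iarr aBr = Function.update (s.iarr aBr) e.1
            (if u = s.ireg iR then e.1 else s.iarr aBr u) →
          (∀ x, x ≠ iA → s'.ireg x = s₁.ireg x) → s'.rreg = s₁.rreg → s'.rarr = s₁.rarr →
          (∀ a, a ≠ aPar → a ≠ aHop → a ≠ aBr → s'.iarr a = s₁.iarr a) →
          ∃ kids, SearchInv n und adj has₀ best₀ B T (Function.update adj u (l ++ [e])) u kids
            t' s' := by
        intro t' s' ht' hpar hhop hbr hi hr hra ha
        have esz' : size s' kids₁ = size s₁ kids₁ := by
          refine size_congr (hi _ (by decide)) fun a h' => ha a ?_ ?_ ?_ <;> omega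
        have ev : view n s' = { view n s with
            Q := insert e.1 (view n s).Q
            d := Function.update (view n s).d e.1 ((view n s).d u + e.2)
            par := Function.update (view n s).par e.1 u
            hop := Function.update (view n s).hop e.1 ((view n s).hop u + 1)
            br := Function.update (view n s).br e.1
              (if u = s.ireg iR then e.1 else (view n s).br u) } := by
          simp only [view]
          rw [hpar, hhop, hbr, hi iR (by decide), hi iHas (by decide), hi iImp (by decide),
            hi iCu (by decide), hi iCv (by decide), hr, hra, ha aScn (by decide) (by decide)
            (by decide), ha aNd (by decide) (by decide) (by decide), hnd₁, hd₁, hQ, eR, eHas,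
            eImp, eCu, eCv, eB, eScn]
        have eS : (view n s').S = (view n s).S := by rw [ev]
        refine ⟨kids₁, ?_, h₁.congr (fun x hx => hi x (by omega)) (fun a h' => ha a ?_ ?_ ?_)
          (by rw [hra]) (by rw [hra]), ?_, ?_⟩
        · rw [hi iR (by decide), eR, ha aDel (by decide) (by decide) (by decide), eDel, ev]
          exact hrun₁
        · omega
        · omega
        · omega
        · rw [eS, esz']; omega
        · rw [eS, esz', hi iSp (by decide)]; omega
      constructor
      · intro hur
        rw [eU, eR] at hur
        refine ⟨fin _ _ (by omega) ?_ ?_ ?_ ?_ ?_ ?_ ?_, by simp [eA, eNext]⟩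
        · simp [ePar, eW, eU]
        · simp [eHop, eW, eU]
        · simp [eBr, eW, hur]
        · intro x hx; simp [hx]
        · simp
        · simp
        · intro a h1 h2 h3; simp [h1, h2, h3]
      · intro hur
        rw [eU, eR] at hur
        refine ⟨fin _ _ (by omega) ?_ ?_ ?_ ?_ ?_ ?_ ?_, by simp [eA, eNext]⟩
        · simp [ePar, eW, eU]
        · simp [eHop, eW, eU]
        · simp [eBr, eW, eU, hur]
        · intro x hx; simp [hx]
        · simp
        · simp
        · intro a h1 h2 h3; simp [h1, h2, h3]
    · intro hb0 hb
      refine same _ _ (by omega) (by simp) (by simp) (by simp) ?_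
      have := hrun.pass (e := e) (fun _ => ⟨.inr hb0, hb⟩) fun h' _ => absurd h' heS
      rw [hup] at this
      convert this using 1
      simp [view]
  · rw [wp_skip]
    refine ⟨same _ _ (by omega) (by simp) (by simp) (by simp) ?_, by simp⟩
    have hdS : e.1 ∉ (view n s).S := fun h' => hdel (hrun.scanned _ h').2
    have := hrun.pass (e := e) (fun h' => absurd h' hdel) fun h' _ => absurd h' hdS
    rw [hup] at this
    convert this using 1
    simp [view]

/-- Scans the vertex `iU`. -/
def pScanVertex (und : Bool) : Prog :=
  .writeI aScn (.reg iU) (.succ (.reg iR)) ;;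
  .setI iA (.read aHead (.reg iU)) ;;
  .while (.not (.ieq (.reg iA) (.const 0))) (pArc und)

/-- Dijkstra's algorithm from the vertex `iR`. -/
def pSearch (und : Bool) : Prog :=
  .setI iSp (.const 0) ;; .setI iImp (.const 0) ;; .setI iW (.reg iR) ;;
  .setR rK (.reg rZero) ;; pInsert ;;
  .writeI aPar (.reg iR) (.reg iR) ;; .writeI aHop (.reg iR) (.const 0) ;;
  .writeI aBr (.reg iR) (.reg iR) ;; .setI iMn (.const 1) ;;
  .while (.not (.ieq (.reg iMn) (.const 0)))
    (pExtract ;; .ite (.ieq (.reg iMn) (.const 0)) .skip (pScanVertex und))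

/-! ### One search: correctness and amortised cost. -/

section Search

variable {n : ℕ} {und : Bool} {adj : ℕ → List (ℕ × ℝ)} {has₀ : ℕ} {best₀ : ℝ} {B T u : ℕ}
  {kids : ℕ → List ℕ} {t : ℕ} {s : State}

theorem SearchInv.time_le {ex : ℕ → List (ℕ × ℝ)} {o : ℕ}
    (h : SearchInv n und adj has₀ best₀ B T ex o kids t s)
    (hex : ∀ v, (ex v).length ≤ (adj v).length) :
    t ≤ T + 2000 * ∑ v ∈ Finset.range n, ((adj v).length + (B + 1)) := by
  have h1 := h.time
  have h2 : ∑ v ∈ (view n s).S, ((ex v).length + (B + 1)) ≤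
      ∑ v ∈ Finset.range n, ((adj v).length + (B + 1)) :=
    (Finset.sum_le_sum fun v _ => Nat.add_le_add_right (hex v) _).trans
      (Finset.sum_le_sum_of_subset (Finset.filter_subset _ _))
  omega

/-- The invariant is required of the state in which `u` is already stamped and none of its arcs
examined, with the clock advanced by 20 for the instructions before the loop. The loop then moves
arcs from the unexamined suffix `l'` to the examined prefix `l`. -/
theorem wp_scanVertex (hadj : AdjOK n und adj) (hat : AdjAt n adj s)
    (hr : s.ireg iR < n) (hu : s.ireg iU = u)
    (h : SearchInv n und adj has₀ best₀ B T (Function.update adj u []) u kids (t + 20)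
      (s.putI aScn u (s.ireg iR + 1)))
    (huS : u ∈ (view n (s.putI aScn u (s.ireg iR + 1))).S) :
    wp (pScanVertex und) s t fun t' s' =>
      (∃ kids, SearchInv n und adj has₀ best₀ B (T + 10) adj n kids t' s') ∧
        s'.iarr aScn = Function.update (s.iarr aScn) u (s.ireg iR + 1) := by
  simp only [pScanVertex, wp_seq, wp_setI, wp_writeI, IExpr.eval, IExpr.cost, hu]
  have hun : u < n := by
    exact (h.run.scanned u huS).1
  refine wp_while (fun t' s' => ∃ l l' kids, adj u = l ++ l' ∧
    ALRep (s'.iarr aTo) (s'.iarr aNext) (s'.rarr aWt) (s'.ireg iA) l' ∧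
    u ∈ (view n s').S ∧
    SearchInv n und adj has₀ best₀ B T (Function.update adj u l) u kids t' s')
    (T + 2000 * ∑ v ∈ Finset.range n, ((adj v).length + (B + 1))) ?_ ?_ ?_ ?_
  · refine ⟨[], adj u, kids, rfl, ?_, ?_, ?_⟩
    · simpa [hu] using hat u hun
    · simpa [view] using huS
    · refine ⟨?_, h.heap.congr ?_ ?_ ?_ ?_, ?_, ?_⟩
      · simpa [view] using h.run
      · simp +contextual
      · intro a ha; simp
      · simp
      · simp
      · exact h.size
      · refine le_trans ?_ h.time
        simp
        show _ ≤ t + 20 + 200 * s.ireg iSp + _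
        have : size ((s.putI aScn u (s.ireg iR + 1)).setI iA (s.iarr aHead (s.ireg iU))) kids =
          size (s.putI aScn u (s.ireg iR + 1)) kids := rfl
        omega
  · rintro t' s' ⟨l, l', kids, hl, -, -, h'⟩
    refine h'.time_le fun v => ?_
    by_cases hv : v = u
    · subst hv; rw [Function.update_self, hl]; simp
    · rw [Function.update_of_ne hv]
  · rintro t' s' hf ⟨l, l', kids, hl, hrep, huS', h'⟩ hb
    simp only [Test.Holds, IExpr.eval] at hb
    have eU : s'.ireg iU = u := by
      rw [hf.ireg _ (by cases und <;> decide)]; simpa using hu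
    match l' with
    | [] => exact absurd hrep hb
    | e :: l' =>
      obtain ⟨-, h1, h2, h3⟩ := hrep
      refine (wp_arc hadj h' (by simp [Test.cost, IExpr.cost]) eU huS' hl h1 h2).frame.mono ?_
      rintro t₁ s₁ ⟨⟨⟨kids₁, h₁⟩, hA⟩, hf₁⟩
      refine ⟨l ++ [e], l', kids₁, by simp [hl], ?_, ?_, h₁⟩
      · rw [hA, hf₁.iarr aTo (by cases und <;> decide), hf₁.iarr aNext (by cases und <;> decide),
          hf₁.rarr aWt (by cases und <;> decide)]
        exact h3
      · have e1 := hf₁.iarr aScn (by cases und <;> decide)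
        have e2 := hf₁.ireg iR (by cases und <;> decide)
        simpa [view, e1, e2] using huS'
  · rintro t' s' hf ⟨l, l', kids, hl, hrep, huS', h'⟩ hb
    simp only [Test.Holds, IExpr.eval, not_not] at hb
    have hl' : l' = [] := by
      cases l' with
      | nil => rfl
      | cons a l' => exact absurd hb hrep.1
    subst hl'
    have eR : s'.ireg iR = s.ireg iR := (hf.ireg _ (by cases und <;> decide)).trans (by simp)
    have hex : Function.update adj u l = adj := by
      rw [show l = adj u by simp [hl], Function.update_eq_self]
    rw [hex] at h'
    refine ⟨⟨kids, h'.run.finish hadj huS' (by rw [eR]; exact hr), h'.heap, h'.size, ?_⟩,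
      (hf.iarr aScn (by cases und <;> decide)).trans (by simp)⟩
    have := h'.time
    simp only [Test.cost, IExpr.cost]
    omega

/-- The result of a search. -/
structure SearchDone (n : ℕ) (und : Bool) (adj : ℕ → List (ℕ × ℝ)) (has₀ : ℕ) (best₀ : ℝ)
    (B T : ℕ) (kids : ℕ → List ℕ) (t : ℕ) (s : State) : Prop where
  run : RunInv n und adj (s.iarr aDel) (s.ireg iR) has₀ best₀ adj n (view n s)
  heap : Heap s kids
  empty : ∀ v, s.iarr aNd v = 0
  time : t ≤ T + 3000 * ∑ v ∈ (view n s).S, ((adj v).length + (B + 1))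

/-- Each extraction is charged to the vertex it yields and each insertion, after the first, to an
arc. So the heap never has more than one node plus one for each arc, which makes `B` a bound for the
ranks. -/
theorem wp_search (hadj : AdjOK n und adj) (hat : AdjAt n adj s)
    (hB : ∀ k, 2 ^ (k / 2) ≤ 1 + ∑ v ∈ Finset.range n, (adj v).length → k < B)
    (hr : s.ireg iR < n) (hdel : s.iarr aDel (s.ireg iR) = 0)
    (hscn : ∀ v < n, s.iarr aScn v ≠ s.ireg iR + 1) (hheap : Heap s kids)
    (hnd : ∀ v, s.iarr aNd v = 0) (hz : s.rreg rZero = 0) :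
    wp (pSearch und) s t fun t' s' =>
      (∃ kids, SearchDone n und adj (s.ireg iHas) (s.rreg rBest) B (t + 2000) kids t' s') ∧
        ∀ v, s'.iarr aScn v = s.iarr aScn v ∨ s'.iarr aScn v = s.ireg iR + 1 := by
  simp only [pSearch, wp_seq, wp_setI, wp_setR, IExpr.eval, RExpr.eval, IExpr.cost, RExpr.cost]
  have hheap₀ : Heap ((((s.setI iSp 0).setI iImp 0).setI iW (s.ireg iR)).setR rK 0) kids := by
    refine ⟨⟨by simpa using hheap.at_.mem, ?_⟩, ?_, by simpa using hheap.tab,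
      by simpa using hheap.max⟩
    · simp [img_zero]
      exact ⟨hheap.at_.inv.toShape, hheap.at_.inv.cnt_pos, by simp, fun v hv => absurd (hnd v) hv⟩
    · simp [img_zero]
  simp [hz]
  refine (wp_insert hheap₀ ?_).frame.mono ?_
  · simp [hnd]
  rintro t₁ s₁ ⟨⟨kids₁, h₁, ht₁, hsp₁, hsz₁, hnd₁, hd₁, hcnt⟩, hf₁⟩
  have eR : s₁.ireg iR = s.ireg iR := (hf₁.ireg _ (by decide)).trans (by simp)
  have eHas : s₁.ireg iHas = s.ireg iHas := (hf₁.ireg _ (by decide)).trans (by simp)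
  have eImp : s₁.ireg iImp = 0 := (hf₁.ireg _ (by decide)).trans (by simp)
  have eB : s₁.rreg rBest = s.rreg rBest := (hf₁.rreg _ (by decide)).trans (by simp)
  have eScn : s₁.iarr aScn = s.iarr aScn := (hf₁.iarr _ (by decide)).trans (by simp)
  have eDel : s₁.iarr aDel = s.iarr aDel := (hf₁.iarr _ (by decide)).trans (by simp)
  have eHead : s₁.iarr aHead = s.iarr aHead := (hf₁.iarr _ (by decide)).trans (by simp)
  have eNext : s₁.iarr aNext = s.iarr aNext := (hf₁.iarr _ (by decide)).trans (by simp)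
  have eTo : s₁.iarr aTo = s.iarr aTo := (hf₁.iarr _ (by decide)).trans (by simp)
  have eWt : s₁.rarr aWt = s.rarr aWt := (hf₁.rarr _ (by decide)).trans (by simp)
  simp at hnd₁ hd₁ hcnt hsp₁
  have hsz0 : size ((((s.setI iSp 0).setI iImp 0).setI iW (s.ireg iR)).setR rK 0) kids = 0 := by
    simp [size, hsize, img_zero, lsum]
  rw [hsz0] at hsz₁
  simp only [wp_writeI, IExpr.eval, IExpr.cost]
  simp
  set r := s.ireg iR with hrdef
  set s₂ := (((s₁.putI aPar (s₁.ireg iR) (s₁.ireg iR)).putI aHop (s₁.ireg iR) 0).putI aBr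
    (s₁.ireg iR) (s₁.ireg iR)).setI iMn 1 with hs₂
  have hS₂ : (view n s₂).S = ∅ := by
    ext v
    simp only [view, Finset.mem_filter, Finset.mem_range, Finset.notMem_empty, iff_false, not_and]
    simpa [hs₂, eScn, eR] using hscn v
  have hQ₂ : (view n s₂).Q = {r} := by
    ext v
    by_cases hv : v = r
    · simp [view, hs₂, hnd₁, hv, hcnt.ne']
    · simp [view, hs₂, hnd₁, hv, hnd]
  have hrun₂ : RunInv n und adj (s₂.iarr aDel) r (s.ireg iHas) (s.rreg rBest) adj n
      (view n s₂) := by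
    have := RunInv.start (und := und) (adj := adj) (V := view n s₂) hr
      (show s₂.iarr aDel r = 0 by simp [hs₂, eDel, hdel]) hS₂ hQ₂ (by
        simp [view, hs₂, hd₁, eR]) (by simp [view, hs₂, eImp])
    have e1 : (view n s₂).has = s.ireg iHas := by simp [view, hs₂, eHas]
    have e2 : (view n s₂).best = s.rreg rBest := by simp [view, hs₂, eB]
    rwa [e1, e2] at this
  have hR₂ : s₂.ireg iR = r := by simp [hs₂, eR]
  have hat₂ : AdjAt n adj s₂ := by
    intro v hv
    have := hat v hv
    simpa [hs₂, eTo, eNext, eWt, eHead] using this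
  have hinv₂ : SearchInv n und adj (s.ireg iHas) (s.rreg rBest) B (t + 1800) adj n kids₁
      (t₁ + 20) s₂ := by
    have hsz : size s₂ kids₁ = size s₁ kids₁ :=
      size_congr (by simp [hs₂]) fun a ha => by
        have ha' : a ≠ 9 ∧ a ≠ 10 ∧ a ≠ 11 := by omega
        simp [hs₂, ha']
    have esp : s₂.ireg iSp = 1 := by simp [hs₂, hsp₁]
    refine ⟨by rw [hR₂]; exact hrun₂, h₁.congr ?_ ?_ ?_ ?_, ?_, ?_⟩
    · rintro x (rfl | rfl | rfl) <;> simp [hs₂]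
    · intro a ha
      have ha' : a ≠ 9 ∧ a ≠ 10 ∧ a ≠ 11 := by omega
      simp [hs₂, ha']
    · simp [hs₂]
    · simp [hs₂]
    · omega
    · rw [hsz, esp]; omega
  have eScn₂ : s₂.iarr aScn = s.iarr aScn := by simp [hs₂, eScn]
  have eMn₂ : s₂.ireg iMn = 1 := by simp [hs₂]
  clear_value s₂
  -- The second alternative is the state after the last extraction, which finds the heap empty. Its
  -- cost belongs to no scanned vertex and is therefore added to the budget.
  refine wp_while (fun t' s' =>
    (∀ v, s'.iarr aScn v = s.iarr aScn v ∨ s'.iarr aScn v = r + 1) ∧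
    ((s'.ireg iMn ≠ 0 ∧ ∃ kids, SearchInv n und adj (s.ireg iHas) (s.rreg rBest) B (t + 1800) adj n
      kids t' s') ∨ (s'.ireg iMn = 0 ∧ (∀ v, s'.iarr aNd v = 0) ∧
      ∃ kids, SearchInv n und adj (s.ireg iHas) (s.rreg rBest) B (t + 1800 + 1000 * (B + 1) + 30)
        adj n kids t' s')))
    (t + 1800 + 1000 * (B + 1) + 30 + 2000 * ∑ v ∈ Finset.range n, ((adj v).length + (B + 1)))
    ?_ ?_ ?_ ?_
  · refine ⟨fun v => .inl (by rw [eScn₂]), .inl ⟨by rw [eMn₂]; exact one_ne_zero, kids₁, hinv₂.run, hinv₂.heap, hinv₂.size,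
      le_trans (by omega) hinv₂.time⟩⟩
  · rintro t' s' ⟨-, ⟨-, kids, h⟩ | ⟨-, -, kids, h⟩⟩
    · refine (h.time_le fun v => le_refl (adj v).length).trans (Nat.add_le_add_right ?_ _)
      rw [add_assoc]
      exact Nat.le_add_right _ _
    · exact h.time_le fun v => le_refl (adj v).length
  · rintro t' s' hf ⟨hst, h⟩ hb
    simp only [Test.Holds, IExpr.eval] at hb
    obtain ⟨-, kids, h⟩ := h.resolve_right fun h' => hb h'.1
    have hsize : size s' kids ≤ 1 + ∑ v ∈ Finset.range n, (adj v).length :=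
      h.size.trans (Nat.add_le_add_left
        (Finset.sum_le_sum_of_subset (Finset.filter_subset _ _)) 1)
    refine wp_seq_of (wp_extract hB h.heap hsize) ?_
    rintro t₃ s₃ hf₃ ⟨kids₃, h₃, ht₃, hsz₃, hcase⟩
    have eR₃ : s₃.ireg iR = s'.ireg iR := hf₃.ireg _ (by decide)
    have eDel₃ : s₃.iarr aDel = s'.iarr aDel := hf₃.iarr _ (by decide)
    have eScn₃ : s₃.iarr aScn = s'.iarr aScn := hf₃.iarr _ (by decide)
    have ev : view n s₃ = { view n s' with Q := {v | s₃.iarr aNd v ≠ 0} } := by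
      simp only [view]
      rw [eR₃, eScn₃, hf₃.rarr aD (by decide), hf₃.iarr aPar (by decide),
        hf₃.iarr aHop (by decide), hf₃.iarr aBr (by decide), hf₃.ireg iHas (by decide),
        hf₃.ireg iImp (by decide), hf₃.ireg iCu (by decide), hf₃.ireg iCv (by decide),
        hf₃.rreg rBest (by decide)]
    have htime := h.time
    simp only [wp_ite, wp_skip, Test.Holds, Test.cost, IExpr.eval, IExpr.cost] at ht₃ ⊢
    rcases hcase with ⟨hm, hn0, hn3⟩ | ⟨hm, hu0, hu3, hiff, hmin⟩
    · refine ⟨fun _ => ⟨by rw [eScn₃]; exact hst, .inr ⟨hm, hn3, kids₃, ?_, h₃, ?_, ?_⟩⟩, fun h' => absurd hm h'⟩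
      · rw [ev, eR₃, eDel₃]
        have : {v | s₃.iarr aNd v ≠ 0} = (view n s').Q := by simp [view, hn0, hn3]
        rw [this]
        exact h.run
      · rw [ev]; exact hsz₃.trans h.size
      · rw [ev]; simp only; omega
    · refine ⟨fun h' => absurd h' hm, fun _ => ?_⟩
      set u := s₃.ireg iU with hu
      have hsel := h.run.select le_rfl (u := u) hu0 fun v hv => hmin v hv
      have hun := (h.run.queue u hu0).1
      have huS := (h.run.queue u hu0).2.1
      have ev' : view n (s₃.putI aScn u (s₃.ireg iR + 1)) =
          { view n s' with S := insert u (view n s').S, Q := (view n s').Q \ {u} } := by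
        have e1 : (Finset.range n).filter (fun v => Function.update (s'.iarr aScn) u
            (s'.ireg iR + 1) v = s'.ireg iR + 1) = insert u (view n s').S := by
          ext v
          by_cases hv : v = u
          · simp [hv, hun]
          · simp [view, hv]
        have e2 : {v | s₃.iarr aNd v ≠ 0} = (view n s').Q \ {u} := by
          ext v
          by_cases hv : v = u
          · simp [hv, hu3]
          · simp [view, hv, hiff v hv]
        rw [← e1, ← e2]
        simp only [view]
        simp
        rw [eR₃, eScn₃, hf₃.rarr aD (by decide), hf₃.iarr aPar (by decide),
          hf₃.iarr aHop (by decide), hf₃.iarr aBr (by decide), hf₃.ireg iHas (by decide),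
          hf₃.ireg iImp (by decide), hf₃.ireg iCu (by decide), hf₃.ireg iCv (by decide),
          hf₃.rreg rBest (by decide)]
        simp
      have hsum : ∀ c, ∑ v ∈ insert u (view n s').S, ((Function.update adj u [] v).length + c) =
          ∑ v ∈ (view n s').S, ((adj v).length + c) + c := by
        intro c
        rw [Finset.sum_insert huS, Function.update_self, List.length_nil, zero_add, add_comm]
        congr 1
        refine Finset.sum_congr rfl fun v hv => ?_
        rw [Function.update_of_ne]
        rintro rfl
        exact huS hv
      have hsz₄ : size (s₃.putI aScn u (s₃.ireg iR + 1)) kids₃ = size s₃ kids₃ :=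
        size_congr (by simp) fun a ha => by
          have ha' : a ≠ 7 := by omega
          simp [ha']
      -- The vertex `u` brings `2000 * (B + 1)` units, of which the extraction uses half. Part of
      -- the rest lowers the constant from 1800 to 1700, which leaves room for the 10 units added by
      -- the scan.
      refine (wp_scanVertex (has₀ := s.ireg iHas) (best₀ := s.rreg rBest) (B := B) (T := t + 1700) (kids := kids₃) hadj ?_ ?_ hu.symm ⟨?_, ?_, ?_, ?_⟩
        ?_).frame.mono ?_
      · intro v hv
        rw [hf₃.iarr aTo (by decide), hf₃.iarr aNext (by decide), hf₃.rarr aWt (by decide),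
          hf₃.iarr aHead (by decide), hf.iarr aTo (by cases und <;> decide),
          hf.iarr aNext (by cases und <;> decide), hf.rarr aWt (by cases und <;> decide),
          hf.iarr aHead (by cases und <;> decide)]
        exact hat₂ v hv
      · rw [eR₃, hf.ireg iR (by cases und <;> decide), hR₂]
        exact hr
      · rw [ev']
        simpa [eDel₃, eR₃] using hsel
      · refine h₃.congr (by simp) ?_ (by simp) (by simp)
        intro a ha
        have ha' : a ≠ 7 := by omega
        simp [ha']
      · rw [ev', hsz₄]
        have := hsum 0
        have := h.size
        simp only [add_zero] at *
        omega
      · rw [ev', hsz₄]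
        simp only
        rw [hsum]
        simp
        omega
      · rw [ev']; simp
      · rintro t₅ s₅ ⟨⟨⟨kids₅, h₅⟩, hst₅⟩, hf₅⟩
        refine ⟨fun v => ?_, .inl ⟨?_, kids₅, h₅.run, h₅.heap, h₅.size, h₅.time.trans (by omega)⟩⟩
        · rw [hst₅, eScn₃, eR₃, hf.ireg iR (by cases und <;> decide), hR₂]
          by_cases hv : v = u
          · rw [hv, Function.update_self]; exact .inr rfl
          · rw [Function.update_of_ne hv]; exact hst v
        rw [hf₅.ireg iMn (by cases und <;> decide)]
        exact hm
  · rintro t' s' hf ⟨hst, h⟩ hb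
    simp only [Test.Holds, IExpr.eval, not_not] at hb
    obtain ⟨-, hnd', kids, h⟩ := h.resolve_left fun h' => h'.1 hb
    refine ⟨⟨kids, h.run, h.heap, hnd', ?_⟩, hst⟩
    have hrS : s'.ireg iR ∈ (view n s').S :=
      h.run.root.resolve_right fun h' => h'.1 (hnd' _)
    -- The summand of the root, which was scanned, absorbs the last extraction; hence the factor
    -- rises from 2000 to 3000.
    have := Finset.single_le_sum (f := fun v => (adj v).length + (B + 1))
      (fun v _ => Nat.zero_le _) hrS
    have := h.time
    simp only [Test.cost, IExpr.cost] at *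
    omega

end Search

/-! ## Cycles found by a search -/

/-- `f 0 → f 1 → ⋯ → f (L - 1) → f 0` is a cycle, in the undirected case one of length at least
three. -/
structure Cyc (und : Bool) (A : ℕ → ℕ → Prop) (L : ℕ) (f : ℕ → ℕ) : Prop where
  pos : 0 < L
  three : und = true → 3 ≤ L
  inj : ∀ i < L, ∀ j < L, f i = f j → i = j
  arc : ∀ i < L, A (f i) (f ((i + 1) % L))

/-- The weight of a cycle. -/
noncomputable def cycWeight (W : ℕ → ℕ → ℝ) (L : ℕ) (f : ℕ → ℕ) : ℝ :=
  ∑ i ∈ Finset.range L, W (f i) (f ((i + 1) % L))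

/-- The adjacency lists `adj` describe the graph with arcs `A` and weights `W`. -/
def Describes (A : ℕ → ℕ → Prop) (W : ℕ → ℕ → ℝ) (adj : ℕ → List (ℕ × ℝ)) : Prop :=
  ∀ u v x, (v, x) ∈ adj u ↔ A u v ∧ x = W u v

/-- Going up `hop cu` arcs to `r` and down from `cv`. -/
structure IsTour (par hop : ℕ → ℕ) (cu cv L : ℕ) (f : ℕ → ℕ) : Prop where
  len : L = hop cu + 1 + hop cv
  up : ∀ i ≤ hop cu, f (hop cu - i) = par^[i] cu
  down : ∀ i < hop cv, f (hop cu + 1 + i) = par^[i] cv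

/-! ### The shortest path tree and lightest cycles through the root. -/

section Tree

variable {n : ℕ} {und : Bool} {adj : ℕ → List (ℕ × ℝ)} {del : ℕ → ℕ} {r has₀ : ℕ} {best₀ : ℝ}
  {ex : ℕ → List (ℕ × ℝ)} {o : ℕ} {V : View} {A : ℕ → ℕ → Prop} {W : ℕ → ℕ → ℝ}

theorem RunInv.eq_root (h : RunInv n und adj del r has₀ best₀ ex o V) {v : ℕ} (hv : v ∈ V.S)
    (h0 : V.hop v = 0) : v = r := by
  by_contra hne
  have := (h.tree v (.inl hv) hne).2.2.1
  omega

theorem RunInv.iterate (h : RunInv n und adj del r has₀ best₀ ex o V) {v : ℕ} (hv : v ∈ V.S) :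
    ∀ i ≤ V.hop v, V.par^[i] v ∈ V.S ∧ V.hop (V.par^[i] v) + i = V.hop v := by
  intro i
  induction i with
  | zero => intro _; exact ⟨hv, rfl⟩
  | succ i ih =>
    intro hi
    obtain ⟨h1, h2⟩ := ih (by omega)
    have hne : V.par^[i] v ≠ r := by
      intro e
      rw [e, h.root_val.2.1] at h2
      omega
    obtain ⟨h3, -, h4, -⟩ := h.tree _ (.inl h1) hne
    rw [Function.iterate_succ_apply']
    exact ⟨h3, by omega⟩

theorem RunInv.iterate_hop (h : RunInv n und adj del r has₀ best₀ ex o V) {v : ℕ} (hv : v ∈ V.S) :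
    V.par^[V.hop v] v = r := by
  obtain ⟨h1, h2⟩ := h.iterate hv _ le_rfl
  exact h.eq_root h1 (by omega)

theorem RunInv.iterate_ne (h : RunInv n und adj del r has₀ best₀ ex o V) {v : ℕ} (hv : v ∈ V.S)
    {i : ℕ} (hi : i < V.hop v) : V.par^[i] v ≠ r := by
  obtain ⟨h1, h2⟩ := h.iterate hv i hi.le
  intro e
  rw [e, h.root_val.2.1] at h2
  omega

/-- The vertices on the tree path have different hop counts, so they are different scanned vertices.
This bounds the time for writing down a cycle by that of the search. -/
theorem RunInv.hop_lt (h : RunInv n und adj del r has₀ best₀ ex o V) {v : ℕ} (hv : v ∈ V.S) :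
    V.hop v < V.S.card := by
  have : (Finset.range (V.hop v + 1)).card ≤ V.S.card := by
    refine Finset.card_le_card_of_injOn (fun i => V.par^[i] v) ?_ ?_
    · intro i hi
      exact (h.iterate hv i (by simpa [Nat.lt_succ_iff] using hi)).1
    · intro i hi j hj e
      have h1 := (h.iterate hv i (by simpa [Nat.lt_succ_iff] using hi)).2
      have h2 := (h.iterate hv j (by simpa [Nat.lt_succ_iff] using hj)).2
      simp only at e
      rw [e] at h1
      omega
  simpa using this

/-- The label is inherited from the parent as long as the parent is not the root. So tree paths with
different labels can meet only in the root. -/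
theorem RunInv.br_iterate (h : RunInv n und adj del r has₀ best₀ ex o V) {v : ℕ} (hv : v ∈ V.S) :
    ∀ i < V.hop v, V.br (V.par^[i] v) = V.br v := by
  intro i
  induction i with
  | zero => intro _; rfl
  | succ i ih =>
    intro hi
    have h1 := (h.iterate hv i (by omega)).1
    have h2 := (h.tree _ (.inl h1) (h.iterate_ne hv (by omega))).2.2.2
    have h3 := h.iterate_ne hv hi
    rw [Function.iterate_succ_apply'] at h3 ⊢
    rw [if_neg h3] at h2
    rw [← h2, ih (by omega)]

theorem RunInv.br_ne (h : RunInv n und adj del r has₀ best₀ ex o V) {v : ℕ} (hv : v ∈ V.S)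
    (hne : v ≠ r) : V.br v ≠ r := by
  have hpos : V.hop v ≠ 0 := fun e => hne (h.eq_root hv e)
  have h1 := h.br_iterate hv (V.hop v - 1) (by omega)
  have h2 := h.iterate_ne hv (i := V.hop v - 1) (by omega)
  have h3 := (h.iterate hv (V.hop v - 1) (by omega)).1
  have h4 := (h.tree _ (.inl h3) h2).2.2.2
  have h5 := h.iterate_hop hv
  rw [show V.hop v = V.hop v - 1 + 1 by omega, Function.iterate_succ_apply'] at h5
  rw [if_pos h5] at h4
  rw [← h1, h4]
  exact h2

theorem RunInv.parent_arc (hA : Describes A W adj) (h : RunInv n und adj del r has₀ best₀ ex o V)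
    {v : ℕ} (hv : v ∈ V.S) {i : ℕ} (hi : i < V.hop v) :
    A (V.par^[i + 1] v) (V.par^[i] v) ∧
      W (V.par^[i + 1] v) (V.par^[i] v) = V.d (V.par^[i] v) - V.d (V.par^[i + 1] v) := by
  have h1 := (h.iterate hv i hi.le).1
  obtain ⟨-, ⟨x, h2, h3⟩, -⟩ := h.tree _ (.inl h1) (h.iterate_ne hv hi)
  obtain ⟨h4, rfl⟩ := (hA _ _ _).1 h2
  rw [Function.iterate_succ_apply']
  exact ⟨h4, by linarith⟩

/-- The tour given by a candidate is a cycle. -/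
theorem RunInv.cyc_of_tour (hadj : AdjOK n und adj) (hA : Describes A W adj)
    (h : RunInv n und adj del r has₀ best₀ ex o V) {cu cv L : ℕ} {x : ℝ} {f : ℕ → ℕ}
    (hu : cu ∈ V.S) (hv : cv ∈ V.S) (hc : Closes und r V.par V.br cu cv)
    (hx : (cv, x) ∈ adj cu) (hf : IsTour V.par V.hop cu cv L f) :
    Cyc und A L f ∧ cycWeight W L f = V.d cu + x + V.d cv := by
  have hlen := hf.len
  set a := V.hop cu with ha
  set b := V.hop cv with hb
  have hup : ∀ i ≤ a, f i = V.par^[a - i] cu := by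
    intro i hi
    rw [← hf.up (a - i) (by omega), show a - (a - i) = i by omega]
  have hf0 : f 0 = r := by
    rw [hup 0 (Nat.zero_le _), Nat.sub_zero, ha, h.iterate_hop hu]
  have hdown : ∀ i ≤ b, f ((a + 1 + i) % L) = V.par^[i] cv := by
    intro i hi
    rcases hi.lt_or_eq with hi | rfl
    · rw [Nat.mod_eq_of_lt (by omega), hf.down i hi]
    · rw [← hlen, Nat.mod_self, hf0, hb, h.iterate_hop hv]
  -- In the directed case `cv` is the root and the downward half of the tour is empty, so reversed
  -- tree arcs are needed only in undirected graphs.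
  have hund : 0 < b → und = true ∧ V.br cu ≠ V.br cv ∧ V.par cu ≠ cv ∧ V.par cv ≠ cu := by
    intro hb0
    cases und with
    | true => simpa [Closes] using hc
    | false =>
      have : cv = r := by simpa [Closes] using hc
      rw [this, h.root_val.2.1] at hb
      omega
  have arc1 : ∀ i < a, A (f i) (f ((i + 1) % L)) ∧
      W (f i) (f ((i + 1) % L)) = V.d (f (i + 1)) - V.d (f i) := by
    intro i hi
    have := h.parent_arc hA hu (i := a - (i + 1)) (by omega)
    rw [Nat.mod_eq_of_lt (by omega), hup i hi.le, hup (i + 1) hi]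
    rwa [show a - (i + 1) + 1 = a - i by omega] at this
  have arc2 : A (f a) (f ((a + 1) % L)) ∧ W (f a) (f ((a + 1) % L)) = x := by
    have h1 := hdown 0 (Nat.zero_le _)
    rw [add_zero] at h1
    rw [h1, hup a le_rfl, Nat.sub_self]
    obtain ⟨h2, h3⟩ := (hA _ _ _).1 hx
    exact ⟨h2, h3.symm⟩
  have arc3 : ∀ i < b, A (f (a + 1 + i)) (f ((a + 1 + i + 1) % L)) ∧
      W (f (a + 1 + i)) (f ((a + 1 + i + 1) % L)) = V.d (V.par^[i] cv) - V.d (V.par^[i + 1] cv) := by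
    intro i hi
    have h1 := h.parent_arc hA hv hi
    have h2 := hdown (i + 1) hi
    rw [← add_assoc] at h2
    rw [hf.down i hi, h2]
    have h3 := hadj.symm (hund (by omega)).1 _ _ _ ((hA _ _ _).2 ⟨h1.1, rfl⟩)
    obtain ⟨h4, h5⟩ := (hA _ _ _).1 h3
    exact ⟨h4, by rw [← h5, h1.2]⟩
  refine ⟨⟨by omega, fun hu' => ?_, ?_, ?_⟩, ?_⟩
  -- A tour of length below 3 has at most one tree edge. Then either both ends are the root, in the
  -- same branch, or the candidate edge is that tree edge.
  · by_contra hlt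
    subst hu'
    simp only [Closes, if_true] at hc
    rcases Nat.eq_zero_or_pos a with ha0 | ha0
    · have e1 := h.eq_root hu ha0
      rcases Nat.eq_zero_or_pos b with hb0 | hb0
      · have e2 := h.eq_root hv hb0
        exact hc.1 (by rw [e1, e2])
      · have h1 := h.iterate_hop hv
        rw [← hb, show b = 1 by omega] at h1
        exact hc.2.2 (h1.trans e1.symm)
    · have e2 := h.eq_root hv (by omega)
      have h1 := h.iterate_hop hu
      rw [← ha, show a = 1 by omega] at h1
      exact hc.2.1 (h1.trans e2.symm)
  -- Apart from the root, which only the first half contains, the two halves lie in different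
  -- branches.
  · have cross : ∀ i ≤ a, ∀ j < b, f i ≠ f (a + 1 + j) := by
      intro i hi j hj e
      rw [hup i hi, hf.down j hj] at e
      have h1 := h.iterate_ne hv hj
      have h2 := h.br_iterate hv j hj
      rw [← e] at h1 h2
      rcases (Nat.sub_le a i).lt_or_eq with h3 | h3
      · rw [h.br_iterate hu _ h3] at h2
        exact (hund (by omega)).2.1 h2
      · rw [h3, ha, h.iterate_hop hu] at h1
        exact h1 rfl
    intro i hi j hj e
    rcases Nat.lt_or_ge a i with hai | hai <;> rcases Nat.lt_or_ge a j with haj | haj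
    · obtain ⟨i, rfl⟩ := Nat.exists_eq_add_of_lt hai
      obtain ⟨j, rfl⟩ := Nat.exists_eq_add_of_lt haj
      rw [add_right_comm a i, add_right_comm a j, hf.down i (by omega), hf.down j (by omega)] at e
      have h1 := (h.iterate hv i (by omega)).2
      have h2 := (h.iterate hv j (by omega)).2
      rw [e] at h1
      omega
    · obtain ⟨i, rfl⟩ := Nat.exists_eq_add_of_lt hai
      rw [add_right_comm a i] at e
      exact absurd e.symm (cross j haj i (by omega))
    · obtain ⟨j, rfl⟩ := Nat.exists_eq_add_of_lt haj
      rw [add_right_comm a j] at e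
      exact absurd e (cross i hai j (by omega))
    · rw [hup i hai, hup j haj] at e
      have h1 := (h.iterate hu (a - i) (by omega)).2
      have h2 := (h.iterate hu (a - j) (by omega)).2
      rw [e] at h1
      omega
  · intro i hi
    rcases lt_trichotomy i a with hia | rfl | hia
    · exact (arc1 i hia).1
    · exact arc2.1
    · obtain ⟨j, rfl⟩ := Nat.exists_eq_add_of_lt hia
      rw [add_right_comm a j]
      exact (arc3 j (by omega)).1
  · rw [cycWeight, hlen, Finset.sum_range_add, Finset.sum_range_succ, ← hlen, arc2.2,
      Finset.sum_congr rfl fun i hi => (arc1 i (Finset.mem_range.1 hi)).2,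
      Finset.sum_congr rfl fun i hi => (arc3 i (Finset.mem_range.1 hi)).2,
      Finset.sum_range_sub fun i => V.d (f i), Finset.sum_range_sub' fun i => V.d (V.par^[i] cv),
      hf0, hup a le_rfl, Nat.sub_self, hb, h.iterate_hop hv, h.root_val.1]
    simp

/-- A candidate is at most as heavy as any cycle through the root. -/
theorem RunInv.le_cycle (hadj : AdjOK n und adj) (hA : Describes A W adj)
    (h : RunInv n und adj del r has₀ best₀ adj n V) (hQ : V.Q = ∅) {L : ℕ} {f : ℕ → ℕ}
    (hf : Cyc und A L f) (h0 : f 0 = r) (hdel : ∀ i < L, del (f i) = 0) :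
    V.has ≠ 0 ∧ V.best ≤ cycWeight W L f := by
  have hrS : r ∈ V.S := h.root.resolve_right fun h' => by rw [hQ] at h'; exact h'.1
  have step : ∀ u ∈ V.S, ∀ v, A u v → del v = 0 → v ∈ V.S ∧ V.d v ≤ V.d u + W u v := by
    intro u hu v hv hd
    have := h.relaxed u hu (v, W u v) ((hA _ _ _).2 ⟨hv, rfl⟩) hd
    rw [hQ] at this
    exact ⟨this.1.resolve_right id, this.2⟩
  have hL := hf.pos
  have pre : ∀ j < L, f j ∈ V.S ∧
      V.d (f j) ≤ ∑ i ∈ Finset.range j, W (f i) (f ((i + 1) % L)) := by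
    intro j
    induction j with
    | zero => intro _; rw [h0]; exact ⟨hrS, by simp [h.root_val.1]⟩
    | succ j ih =>
      intro hj
      obtain ⟨h1, h2⟩ := ih (by omega)
      have h3 := hf.arc j (by omega)
      rw [Finset.sum_range_succ]
      rw [Nat.mod_eq_of_lt hj] at h3 ⊢
      obtain ⟨h4, h5⟩ := step _ h1 _ h3 (hdel _ hj)
      exact ⟨h4, by linarith⟩
  have hcand : ∀ u ∈ V.S, ∀ v ∈ V.S, A u v → Closes und r V.par V.br u v →
      V.has ≠ 0 ∧ V.best ≤ V.d u + W u v + V.d v := by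
    intro u hu v hv ha hc
    exact h.cand u hu (v, W u v) ((hA _ _ _).2 ⟨ha, rfl⟩) hv ((h.scanned v hv).1.ne) hc
  cases und with
  | false =>
    obtain ⟨h1, h2⟩ := pre (L - 1) (by omega)
    have h3 := hf.arc (L - 1) (by omega)
    rw [show L - 1 + 1 = L by omega, Nat.mod_self, h0] at h3
    obtain ⟨h4, h5⟩ := hcand _ h1 _ hrS h3 (by simp [Closes])
    refine ⟨h4, ?_⟩
    have h6 := Finset.sum_range_succ (fun i => W (f i) (f ((i + 1) % L))) (L - 1)
    rw [show L - 1 + 1 = L by omega, Nat.mod_self, h0] at h6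
    rw [cycWeight, h6]
    rw [h.root_val.1] at h5
    linarith
  | true =>
    have hL3 := hf.three rfl
    have hsym : ∀ u v, A u v → A v u ∧ W v u = W u v := by
      intro u v huv
      obtain ⟨h1, h2⟩ := (hA _ _ _).1 (hadj.symm rfl u v _ ((hA _ _ _).2 ⟨huv, rfl⟩))
      exact ⟨h1, h2.symm⟩
    -- By symmetry the rest of the cycle, run backwards from `r`, is also a path, so its weight
    -- bounds the distance of its far end. The induction descends from `j = L`.
    have suf : ∀ j, j ≤ L → 0 < j →
        V.d (f (j % L)) + ∑ i ∈ Finset.range j, W (f i) (f ((i + 1) % L)) ≤ cycWeight W L f := by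
      intro j hj
      induction hj using Nat.decreasingInduction with
      | self => intro _; rw [Nat.mod_self, h0, h.root_val.1, zero_add]; exact le_rfl
      | of_succ j hj ih =>
        intro hj0
        have h1 := ih (by omega)
        rw [Finset.sum_range_succ] at h1
        have hS : f ((j + 1) % L) ∈ V.S := (pre _ (Nat.mod_lt _ hL)).1
        obtain ⟨h2, h3⟩ := hsym _ _ (hf.arc j hj)
        have h4 := (step _ hS _ h2 (hdel _ hj)).2
        rw [Nat.mod_eq_of_lt hj]
        linarith
    have fin : ∀ j < L, Closes true r V.par V.br (f j) (f ((j + 1) % L)) →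
        V.has ≠ 0 ∧ V.best ≤ cycWeight W L f := by
      intro j hj hc
      obtain ⟨h1, h2⟩ := pre j hj
      obtain ⟨h3, h4⟩ := hcand _ h1 _ (pre _ (Nat.mod_lt _ hL)).1 (hf.arc j hj) hc
      have h5 := suf (j + 1) (by omega) (by omega)
      rw [Finset.sum_range_succ] at h5
      exact ⟨h3, by linarith⟩
    have hne : ∀ j < L, 0 < j → f j ≠ r := by
      intro j hj hj0 e
      have := hf.inj j hj 0 hL (e.trans h0.symm)
      omega
    -- If no edge of the cycle is a candidate, then edges away from `r` stay within a branch, and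
    -- both edges at `r` are tree edges. So `f 1` and `f (L - 1)` are children of `r` in the same
    -- branch and hence equal, against `3 ≤ L`.
    by_contra hcon
    have nofin : ∀ j < L, ¬ Closes true r V.par V.br (f j) (f ((j + 1) % L)) :=
      fun j hj hc => hcon (fin j hj hc)
    have par_br : ∀ u ∈ V.S, u ≠ r → V.par u ≠ r → V.br u = V.br (V.par u) := by
      intro u hu hur hpr
      have := (h.tree u (.inl hu) hur).2.2.2
      rwa [if_neg hpr] at this
    have same : ∀ j, 0 < j → j < L → V.br (f j) = V.br (f 1) := by
      intro j hj0
      induction j, hj0 using Nat.le_induction with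
      | base => intro _; rfl
      | succ j hj0 ih =>
        intro hj
        by_contra hbr
        rw [← ih (by omega)] at hbr
        have hS1 := (pre j (by omega)).1
        have hS2 := (pre (j + 1) hj).1
        have hn1 := hne j (by omega) hj0
        have hn2 := hne (j + 1) hj (by omega)
        refine nofin j (by omega) ?_
        rw [Nat.mod_eq_of_lt hj]
        simp only [Closes, if_true]
        refine ⟨fun e => hbr e.symm, fun e => hbr ?_, fun e => hbr ?_⟩
        · rw [← e]; exact (par_br _ hS1 hn1 (by rw [e]; exact hn2)).symm
        · rw [← e]; exact par_br _ hS2 hn2 (by rw [e]; exact hn1)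
    have hS1 := (pre 1 (by omega)).1
    have hS2 := (pre (L - 1) (by omega)).1
    have hn1 := hne 1 (by omega) (by omega)
    have hn2 := hne (L - 1) (by omega) (by omega)
    have p1 : V.par (f 1) = r := by
      by_contra hp
      refine nofin 0 hL ?_
      rw [zero_add, Nat.mod_eq_of_lt (by omega), h0]
      simp only [Closes, if_true, h.root_val]
      exact ⟨(h.br_ne hS1 hn1).symm, hn1.symm, hp⟩
    have p2 : V.par (f (L - 1)) = r := by
      by_contra hp
      refine nofin (L - 1) (by omega) ?_
      rw [show L - 1 + 1 = L by omega, Nat.mod_self, h0]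
      simp only [Closes, if_true, h.root_val]
      exact ⟨h.br_ne hS2 hn2, hp, hn2.symm⟩
    have b1 := (h.tree _ (.inl hS1) hn1).2.2.2
    have b2 := (h.tree _ (.inl hS2) hn2).2.2.2
    rw [if_pos p1] at b1
    rw [if_pos p2] at b2
    have := hf.inj (L - 1) (by omega) 1 (by omega)
      (b2.symm.trans ((same (L - 1) (by omega) (by omega)).trans b1))
    omega

end Tree

/-- Rotating a cycle. -/
theorem Cyc.rotate {und : Bool} {A : ℕ → ℕ → Prop} {W : ℕ → ℕ → ℝ} {L : ℕ} {f : ℕ → ℕ}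
    (hf : Cyc und A L f) (k : ℕ) : Cyc und A L (fun i => f ((i + k) % L)) ∧
      cycWeight W L (fun i => f ((i + k) % L)) = cycWeight W L f := by
  have hL := hf.pos
  have inj : ∀ i < L, ∀ j < L, (i + k) % L = (j + k) % L → i = j := by
    intro i hi j hj e
    have := Nat.ModEq.add_right_cancel' k e
    rwa [Nat.ModEq, Nat.mod_eq_of_lt hi, Nat.mod_eq_of_lt hj] at this
  have e : ∀ i, ((i + 1) % L + k) % L = ((i + k) % L + 1) % L := by
    intro i
    rw [Nat.mod_add_mod, Nat.mod_add_mod, add_right_comm]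
  refine ⟨⟨hL, hf.three, ?_, ?_⟩, ?_⟩
  · intro i hi j hj h
    exact inj i hi j hj (hf.inj _ (Nat.mod_lt _ hL) _ (Nat.mod_lt _ hL) h)
  · intro i hi
    simp only [e]
    exact hf.arc _ (Nat.mod_lt _ hL)
  · simp only [cycWeight, e]
    have hinj : Set.InjOn (fun i => (i + k) % L) (Finset.range L) := by
      intro i hi j hj h
      exact inj i (by simpa using hi) j (by simpa using hj) h
    have himg : (Finset.range L).image (fun i => (i + k) % L) = Finset.range L := by
      refine Finset.eq_of_subset_of_card_le ?_ ?_
      · intro i hi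
        obtain ⟨j, -, rfl⟩ := Finset.mem_image.1 hi
        exact Finset.mem_range.2 (Nat.mod_lt _ hL)
      · rw [Finset.card_image_of_injOn hinj]
    conv_rhs => rw [← himg]
    rw [Finset.sum_image hinj]

/-! ## One round: searching, writing down the cycle, deleting the root -/

/-- Writes down the tour given by the best candidate. -/
def pOutput : Prog :=
  .setI iP (.read aHop (.reg iCu)) ;; .setI iX (.reg iCu) ;;
  .while (.not (.ieq (.reg iX) (.reg iR)))
    (.writeI aSrc (.reg iP) (.reg iX) ;; .setI iX (.read aPar (.reg iX)) ;;
      .setI iP (.pred (.reg iP))) ;;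
  .writeI aSrc (.reg iP) (.reg iX) ;;
  .setI iP (.succ (.read aHop (.reg iCu))) ;; .setI iY (.reg iCv) ;;
  .while (.not (.ieq (.reg iY) (.reg iR)))
    (.writeI aSrc (.reg iP) (.reg iY) ;; .setI iY (.read aPar (.reg iY)) ;;
      .setI iP (.succ (.reg iP))) ;;
  .setI iLen (.reg iP)

/-- A search from `iR`, which is then deleted. -/
def pRound (und : Bool) : Prog :=
  pSearch und ;; .ite (.ieq (.reg iImp) (.const 0)) .skip pOutput ;;
  .writeI aDel (.reg iR) (.const 1)

section Round

variable {n : ℕ} {und : Bool} {adj : ℕ → List (ℕ × ℝ)} {del : ℕ → ℕ} {has₀ : ℕ} {best₀ : ℝ}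
  {ex : ℕ → List (ℕ × ℝ)} {o r B : ℕ} {A : ℕ → ℕ → Prop} {W : ℕ → ℕ → ℝ} {s : State} {t : ℕ}
  {V : View} {kids : ℕ → List ℕ}

/-- The upward half is met from `cu` to the root but has to be stored from the root to `cu`, so it
is written from position `hop cu` down to 0; the other half follows from `hop cu + 1` on. -/
theorem wp_output (h : RunInv n und adj del (s.ireg iR) has₀ best₀ ex o (view n s))
    (hu : s.ireg iCu ∈ (view n s).S) (hv : s.ireg iCv ∈ (view n s).S) :
    wp pOutput s t fun t' s' => t' ≤ t + 100 * (view n s).S.card ∧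
      IsTour (s.iarr aPar) (s.iarr aHop) (s.ireg iCu) (s.ireg iCv) (s'.ireg iLen)
        (s'.iarr aSrc) := by
  have ha' := h.hop_lt hu
  have hb' := h.hop_lt hv
  have hita := fun i hi => h.iterate_ne hu (i := i) hi
  have hitb := fun i hi => h.iterate_ne hv (i := i) hi
  have hra : (s.iarr aPar)^[s.iarr aHop (s.ireg iCu)] (s.ireg iCu) = s.ireg iR := h.iterate_hop hu
  have hrb : (s.iarr aPar)^[s.iarr aHop (s.ireg iCv)] (s.ireg iCv) = s.ireg iR := h.iterate_hop hv
  simp only [show (view n s).hop = s.iarr aHop from rfl,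
    show (view n s).par = s.iarr aPar from rfl] at ha' hb' hita hitb
  simp only [pOutput, wp_seq, wp_setI, IExpr.eval, IExpr.cost]
  generalize (view n s).S.card = c at *
  generalize hcu : s.ireg iCu = cu at *
  generalize hcv : s.ireg iCv = cv at *
  generalize hrr : s.ireg iR = r at *
  generalize hpar : s.iarr aPar = par at *
  generalize ha : s.iarr aHop cu = a at *
  generalize hb : s.iarr aHop cv = b at *
  refine wp_while (fun t' s' => ∃ i ≤ a, s'.ireg iX = par^[i] cu ∧ s'.ireg iP = a - i ∧
    (∀ j < i, s'.iarr aSrc (a - j) = par^[j] cu) ∧ t' ≤ t + 10 + 13 * i)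
    (t + 10 + 13 * a) ?_ ?_ ?_ ?_
  · refine ⟨0, Nat.zero_le _, ?_, ?_, by simp, by omega⟩ <;> simp [hcu]
  · rintro t' s' ⟨i, hi, -, -, -, h⟩; omega
  · rintro t' s' hf ⟨i, hi, hX, hP, hout, ht⟩ hb
    simp only [Test.Holds, IExpr.eval] at hb
    have eR : s'.ireg iR = r := by rw [hf.ireg iR (by decide)]; simp [hrr]
    have eP : s'.iarr aPar = par := by rw [hf.iarr aPar (by decide)]; simp [hpar]
    have hia : i < a := by
      rcases hi.lt_or_eq with hi | rfl
      · exact hi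
      · exact absurd (by rw [hX, eR, hra]) hb
    simp only [wp_seq, wp_setI, wp_writeI, IExpr.eval, IExpr.cost, Test.cost]
    refine ⟨i + 1, hia, ?_, ?_, ?_, by omega⟩
    · simp [eP, hX, Function.iterate_succ_apply']
    · simp [hP]; omega
    · intro j hj
      rcases Nat.lt_succ_iff_lt_or_eq.1 hj with hj | rfl
      · simp only [setI_iarr, putI_iarr, if_true]
        rw [Function.update_of_ne (by omega)]
        exact hout j hj
      · simp [hP, hX]
  · rintro t₁ s₁ hf₁ ⟨i, hi, hX, hP, hout, ht⟩ hbb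
    simp only [Test.Holds, IExpr.eval, not_not] at hbb
    have eR : s₁.ireg iR = r := by rw [hf₁.ireg iR (by decide)]; simp [hrr]
    have eP : s₁.iarr aPar = par := by rw [hf₁.iarr aPar (by decide)]; simp [hpar]
    have eH : s₁.iarr aHop = s.iarr aHop := by rw [hf₁.iarr aHop (by decide)]; simp
    have eu : s₁.ireg iCu = cu := by rw [hf₁.ireg iCu (by decide)]; simp [hcu]
    have ev : s₁.ireg iCv = cv := by rw [hf₁.ireg iCv (by decide)]; simp [hcv]
    have hia : i = a := by
      by_contra hne
      exact hita i (by omega) (by rw [← hX, hbb, eR])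
    subst hia
    have hout' : ∀ j ≤ i, Function.update (s₁.iarr aSrc) (s₁.ireg iP) (s₁.ireg iX) (i - j) =
        par^[j] cu := by
      intro j hj
      rcases hj.lt_or_eq with hj | rfl
      · rw [Function.update_of_ne (by omega)]
        exact hout j hj
      · rw [hP, Function.update_self, hX]
    simp only [wp_writeI, IExpr.eval, IExpr.cost, Test.cost]
    refine wp_while (fun t' s' => ∃ k ≤ b, s'.ireg iY = par^[k] cv ∧ s'.ireg iP = i + 1 + k ∧
      (∀ j ≤ i, s'.iarr aSrc (i - j) = par^[j] cu) ∧
      (∀ j < k, s'.iarr aSrc (i + 1 + j) = par^[j] cv) ∧ t' ≤ t + 30 + 13 * i + 13 * k)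
      (t + 30 + 13 * i + 13 * b) ?_ ?_ ?_ ?_
    · refine ⟨0, Nat.zero_le _, ?_, ?_, ?_, by simp, by omega⟩
      · simp [ev]
      · simp [eu, eH, ha]
      · simpa using hout'
    · rintro t' s' ⟨i, hi, -, -, -, -, h⟩; omega
    · rintro t' s' hf ⟨k, hk, hY, hP', ho1, ho2, ht'⟩ hbt
      simp only [Test.Holds, IExpr.eval] at hbt
      have eR' : s'.ireg iR = r := by rw [hf.ireg iR (by decide)]; simp [eR]
      have eP' : s'.iarr aPar = par := by rw [hf.iarr aPar (by decide)]; simp [eP]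
      have hkb : k < b := by
        rcases hk.lt_or_eq with hk | rfl
        · exact hk
        · exact absurd (by rw [hY, eR', hrb]) hbt
      simp only [wp_seq, wp_setI, wp_writeI, IExpr.eval, IExpr.cost, Test.cost]
      refine ⟨k + 1, hkb, ?_, ?_, ?_, ?_, by omega⟩
      · simp [eP', hY, Function.iterate_succ_apply']
      · simp [hP']; omega
      · intro j hj
        simp only [setI_iarr, putI_iarr, if_true]
        rw [Function.update_of_ne (by omega)]
        exact ho1 j hj
      · intro j hj
        rcases Nat.lt_succ_iff_lt_or_eq.1 hj with hj | rfl
        · simp only [setI_iarr, putI_iarr, if_true]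
          rw [Function.update_of_ne (by omega)]
          exact ho2 j hj
        · simp [hP', hY]
    · rintro t₂ s₂ hf₂ ⟨k, hk, hY, hP', ho1, ho2, ht'⟩ hbb'
      simp only [Test.Holds, IExpr.eval, not_not] at hbb'
      have eR' : s₂.ireg iR = r := by rw [hf₂.ireg iR (by decide)]; simp [eR]
      have hkb : k = b := by
        by_contra hne
        exact hitb k (by omega) (by rw [← hY, hbb', eR'])
      subst hkb
      simp only [Test.cost, IExpr.cost]
      refine ⟨by omega, ?_, ?_, ?_⟩
      · simp [hP', ha, hb]
      · simpa [ha] using ho1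
      · simpa [ha, hb] using ho2

/-- Tree paths avoid the deleted vertices; with the elimination forest this confines the search to
descendants of the root. -/
theorem RunInv.reach (hA : Describes A W adj) (h : RunInv n und adj del r has₀ best₀ ex o V)
    {v : ℕ} (hv : v ∈ V.S) : Relation.ReflTransGen (fun u v => A u v ∧ del v = 0) r v := by
  have key : ∀ i ≤ V.hop v, Relation.ReflTransGen (fun u v => A u v ∧ del v = 0)
      (V.par^[i] v) v := by
    intro i
    induction i with
    | zero => intro _; exact .refl
    | succ i ih =>
      intro hi
      exact .head ⟨(h.parent_arc hA hv hi).1, (h.scanned _ (h.iterate hv i (by omega)).1).2⟩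
        (ih (by omega))
  have := key _ le_rfl
  rwa [h.iterate_hop hv] at this

/-- The memory holds a cycle of least weight among those through a deleted vertex. -/
structure Sol (und : Bool) (A : ℕ → ℕ → Prop) (W : ℕ → ℕ → ℝ) (s : State) : Prop where
  cyc : (s.ireg iHas = 0 ∧ s.ireg iLen = 0) ∨ (s.ireg iHas ≠ 0 ∧
    Cyc und A (s.ireg iLen) (s.iarr aSrc) ∧ cycWeight W (s.ireg iLen) (s.iarr aSrc) = s.rreg rBest)
  lower : ∀ L f, Cyc und A L f → (∃ i < L, s.iarr aDel (f i) ≠ 0) →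
    s.ireg iHas ≠ 0 ∧ s.rreg rBest ≤ cycWeight W L f

/-- The memory between two rounds. -/
structure Ready (n : ℕ) (und : Bool) (A : ℕ → ℕ → Prop) (W : ℕ → ℕ → ℝ) (adj : ℕ → List (ℕ × ℝ))
    (s : State) : Prop where
  sol : Sol und A W s
  adjAt : AdjAt n adj s
  heap : ∃ kids, Heap s kids
  empty : ∀ v, s.iarr aNd v = 0
  zero : s.rreg rZero = 0
  scn : ∀ v < n, ∀ u < n, s.iarr aDel u = 0 → s.iarr aScn v ≠ u + 1

/-- Cycles through an earlier root are handled by the old best value, which can only decrease; the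
others that meet `r` are handled by the present search. The cost is expressed through the set of
scanned vertices, to be compared with the descendants of `r`. -/
theorem wp_round (hadj : AdjOK n und adj) (hA : Describes A W adj)
    (hB : ∀ k, 2 ^ (k / 2) ≤ 1 + ∑ v ∈ Finset.range n, (adj v).length → k < B)
    (h : Ready n und A W adj s) (hr : s.ireg iR < n) (hdel : s.iarr aDel (s.ireg iR) = 0) :
    wp (pRound und) s t fun t' s' => Ready n und A W adj s' ∧
      s'.iarr aDel = Function.update (s.iarr aDel) (s.ireg iR) 1 ∧
      ∃ S : Finset ℕ, (∀ v ∈ S, v < n ∧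
        Relation.ReflTransGen (fun u v => A u v ∧ s.iarr aDel v = 0) (s.ireg iR) v) ∧
        s.ireg iR ∈ S ∧ t' ≤ t + 6000 * ∑ v ∈ S, ((adj v).length + (B + 1)) := by
  obtain ⟨kids, hheap⟩ := h.heap
  refine wp_seq_of (wp_search hadj h.adjAt hB hr hdel (fun v hv => h.scn v hv _ hr hdel) hheap
    h.empty h.zero) ?_
  rintro t₁ s₁ hf ⟨⟨kids₁, hd⟩, hst⟩
  have eR : s₁.ireg iR = s.ireg iR := hf.ireg iR (by cases und <;> decide)
  have eDel : s₁.iarr aDel = s.iarr aDel := hf.iarr aDel (by cases und <;> decide)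
  have eLen : s₁.ireg iLen = s.ireg iLen := hf.ireg iLen (by cases und <;> decide)
  have eSrc : s₁.iarr aSrc = s.iarr aSrc := hf.iarr aSrc (by cases und <;> decide)
  have hrun := hd.run
  rw [eR, eDel] at hrun
  have hQ : (view n s₁).Q = ∅ := by
    ext v; simp [view, hd.empty]
  have hrS : s.ireg iR ∈ (view n s₁).S :=
    hrun.root.resolve_right fun h' => by rw [hQ] at h'; exact h'.1
  have hsum := Finset.single_le_sum (f := fun v => (adj v).length + (B + 1))
    (fun v _ => Nat.zero_le _) hrS
  have hcard : (view n s₁).S.card ≤ ∑ v ∈ (view n s₁).S, ((adj v).length + (B + 1)) := by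
    rw [Finset.card_eq_sum_ones]
    exact Finset.sum_le_sum fun v _ => by omega
  have htime := hd.time
  have hlow : ∀ L f, Cyc und A L f →
      (∃ i < L, Function.update (s.iarr aDel) (s.ireg iR) 1 (f i) ≠ 0) →
      s₁.ireg iHas ≠ 0 ∧ s₁.rreg rBest ≤ cycWeight W L f := by
    rintro L f hf ⟨i, hi, hne⟩
    by_cases hex : ∃ i < L, s.iarr aDel (f i) ≠ 0
    · obtain ⟨h1, h2⟩ := h.sol.lower L f hf hex
      rcases hrun.best with ⟨-, h3, h4⟩ | ⟨-, h3, h4, -⟩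
      · change s₁.ireg iHas = _ at h3
        change s₁.rreg rBest = _ at h4
        rw [h3, h4]; exact ⟨h1, h2⟩
      · exact ⟨h3, (h4 h1).trans h2⟩
    · push Not at hex
      have hfi : f i = s.ireg iR := by
        by_contra hfi
        rw [Function.update_of_ne hfi] at hne
        exact hne (hex i hi)
      -- The cycle has no vertex deleted earlier and contains `r` at position `i`. Rotation moves
      -- `r` to position 0, where the search from `r` applies.
      obtain ⟨h1, h2⟩ := hf.rotate (W := W) i
      rw [← h2]
      refine hrun.le_cycle hadj hA hQ h1 (by simp [Nat.mod_eq_of_lt hi, hfi]) ?_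
      intro j hj
      exact hex _ (Nat.mod_lt _ hf.pos)
  have fin : ∀ s₂ : State, Frame pOutput s₁ s₂ → ((s₂.ireg iHas = 0 ∧ s₂.ireg iLen = 0) ∨
      (s₂.ireg iHas ≠ 0 ∧ Cyc und A (s₂.ireg iLen) (s₂.iarr aSrc) ∧
        cycWeight W (s₂.ireg iLen) (s₂.iarr aSrc) = s₂.rreg rBest)) →
      Ready n und A W adj (s₂.putI aDel (s₂.ireg iR) 1) ∧
      (s₂.putI aDel (s₂.ireg iR) 1).iarr aDel = Function.update (s.iarr aDel) (s.ireg iR) 1 := by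
    intro s₂ hf₂ hcyc
    have eR₂ : s₂.ireg iR = s.ireg iR := (hf₂.ireg iR (by decide)).trans eR
    have eDel₂ : s₂.iarr aDel = s.iarr aDel := (hf₂.iarr aDel (by decide)).trans eDel
    refine ⟨⟨⟨hcyc, ?_⟩, ?_, ⟨kids₁, hd.heap.congr ?_ ?_ ?_ ?_⟩, ?_, ?_, ?_⟩, ?_⟩
    · intro L f hf hex
      simp only [putI_ireg, putI_rreg]
      rw [hf₂.ireg iHas (by decide), hf₂.rreg rBest (by decide)]
      refine hlow L f hf ?_
      simpa [eR₂, eDel₂] using hex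
    · intro v hv
      have := h.adjAt v hv
      simp only [putI_iarr, putI_rarr]
      simp
      rw [hf₂.iarr aTo (by decide), hf₂.iarr aNext (by decide), hf₂.iarr aHead (by decide),
        hf₂.rarr aWt (by decide), hf.iarr aTo (by cases und <;> decide),
        hf.iarr aNext (by cases und <;> decide), hf.iarr aHead (by cases und <;> decide),
        hf.rarr aWt (by cases und <;> decide)]
      exact this
    · rintro x (rfl | rfl | rfl) <;> simp only [putI_ireg] <;> exact hf₂.ireg _ (by decide)
    · intro a ha
      rw [putI_iarr, if_neg (by omega)]
      refine hf₂.iarr a ?_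
      simp [pOutput, Prog.mods]
      omega
    · exact hf₂.rarr _ (by decide)
    · exact hf₂.rarr _ (by decide)
    · intro v
      simp
      rw [hf₂.iarr aNd (by decide)]
      exact hd.empty v
    · simp only [putI_rreg]
      rw [hf₂.rreg rZero (by decide), hf.rreg rZero (by cases und <;> decide)]
      exact h.zero
    · intro v hv u hu hdu
      simp [eR₂, eDel₂] at hdu ⊢
      have hur : u ≠ s.ireg iR := by
        rintro rfl
        rw [Function.update_self] at hdu
        omega
      rw [Function.update_of_ne hur] at hdu
      rw [hf₂.iarr aScn (by decide)]
      -- A stamp is either an old one or that of `r`, which is now deleted and never searched from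
      -- again.
      rcases hst v with h1 | h1
      · rw [h1]; exact h.scn v hv u hu hdu
      · rw [h1]; omega
    · simp [eR₂, eDel₂]
  simp only [wp_seq, wp_ite, wp_skip, wp_writeI, Test.Holds, Test.cost, IExpr.eval, IExpr.cost]
  refine ⟨fun himp => ?_, fun himp => ?_⟩
  · obtain ⟨h1, h2⟩ := fin s₁ (Frame.refl _ _) (by
      rcases hrun.best with ⟨-, h3, h4⟩ | ⟨h3, -⟩
      · change s₁.ireg iHas = _ at h3
        change s₁.rreg rBest = _ at h4
        rw [h3, h4, eLen, eSrc]; exact h.sol.cyc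
      · exact absurd himp h3)
    exact ⟨h1, h2, (view n s₁).S, fun v hv => ⟨(hrun.scanned v hv).1, hrun.reach hA hv⟩, hrS,
      by omega⟩
  · rcases hrun.best with ⟨h3, -⟩ | ⟨-, h3, -, hu, hv, hc, x, hx, hbest⟩
    · exact absurd h3 himp
    refine (wp_output hd.run hu hv).frame.mono ?_
    rintro t₂ s₂ ⟨⟨ht₂, htour⟩, hf₂⟩
    obtain ⟨h4, h5⟩ := hrun.cyc_of_tour hadj hA hu hv hc hx htour
    obtain ⟨h1, h2⟩ := fin s₂ hf₂ (by
      right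
      rw [hf₂.ireg iHas (by decide), hf₂.rreg rBest (by decide)]
      exact ⟨h3, h4, h5.trans hbest.symm⟩)
    exact ⟨h1, h2, (view n s₁).S, fun v hv => ⟨(hrun.scanned v hv).1, hrun.reach hA hv⟩, hrS,
      by omega⟩

end Round

/-! ## All rounds -/

/-- Finds the highest ancestor of `iR` all of whose ancestors are deleted. -/
def pClimb : Prog :=
  .while (.and (.not (.ieq (.read aForest (.reg iR)) (.reg iR)))
      (.ieq (.read aDel (.read aForest (.reg iR))) (.const 0)))
    (.setI iR (.read aForest (.reg iR)))

/-- No ordering of the vertices is computed. As long as `iV` is present, the topmost present vertex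
above it is processed; every pass of the inner loop deletes a vertex. -/
def pRounds (und : Bool) : Prog :=
  .setI iV (.const 0) ;;
  .while (.ilt (.reg iV) (.reg iN))
    (.while (.ieq (.read aDel (.reg iV)) (.const 0))
      (.setI iR (.reg iV) ;; pClimb ;; pRound und) ;;
      .setI iV (.succ (.reg iV)))

open Classical in
/-- The parent pointers `fp` form an elimination forest of depth at most `k`. -/
structure ForestOK (n k : ℕ) (A : ℕ → ℕ → Prop) (fp : ℕ → ℕ) : Prop where
  lt : ∀ v < n, fp v < n
  level : ∃ lev : ℕ → ℕ, ∀ v < n, lev v < k ∧ (fp v ≠ v → lev (fp v) < lev v)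
  elim : ∀ u v, A u v → (∃ i, fp^[i] v = u) ∨ ∃ i, fp^[i] u = v
  count : ∀ v < n, ((Finset.range n).filter fun u => ∃ i, fp^[i] v = u).card ≤ k

open Classical in
/-- The work charged to a round. -/
noncomputable def charge (n B : ℕ) (adj : ℕ → List (ℕ × ℝ)) (fp : ℕ → ℕ) (r : ℕ) : ℕ :=
  ∑ u ∈ (Finset.range n).filter (fun u => ∃ i, fp^[i] u = r), ((adj u).length + (B + 1))

/-! ### Charging the searches to the ancestors. -/

section Rounds

variable {n k : ℕ} {und : Bool} {adj : ℕ → List (ℕ × ℝ)} {r B : ℕ} {A : ℕ → ℕ → Prop}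
  {W : ℕ → ℕ → ℝ} {s : State} {t T : ℕ} {fp : ℕ → ℕ}

/-- Exchange the sums: `u` is charged once for each of its ancestors, `u` included, and there are at
most `k` of these. -/
theorem ForestOK.sum_charge_le (hF : ForestOK n k A fp) : ∑ r ∈ Finset.range n,
    charge n B adj fp r ≤ k * ∑ u ∈ Finset.range n, ((adj u).length + (B + 1)) := by
  classical
  simp only [charge, Finset.sum_filter]
  rw [Finset.sum_comm, Finset.mul_sum]
  refine Finset.sum_le_sum fun u hu => ?_
  rw [← Finset.sum_filter, Finset.sum_const, smul_eq_mul]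
  refine Nat.mul_le_mul_right _ ?_
  convert hF.count u (Finset.mem_range.1 hu)

theorem ForestOK.iterate_lt (hF : ForestOK n k A fp) {v : ℕ} (hv : v < n) (i : ℕ) :
    fp^[i] v < n := by
  induction i with
  | zero => exact hv
  | succ i ih => rw [Function.iterate_succ_apply']; exact hF.lt _ ih

/-- If the deleted vertices are closed under taking parents, then a search from a vertex whose
proper ancestors are deleted only meets descendants. -/
theorem ForestOK.descendant (hF : ForestOK n k A fp) {del : ℕ → ℕ}
    (hup : ∀ v < n, del v ≠ 0 → del (fp v) ≠ 0) (hr : r < n) (htop : fp r = r ∨ del (fp r) ≠ 0)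
    {v : ℕ} (h : Relation.ReflTransGen (fun u v => A u v ∧ del v = 0) r v) :
    ∃ i, fp^[i] v = r := by
  induction h with
  | refl => exact ⟨0, rfl⟩
  | @tail u v _ hv ih =>
    obtain ⟨j, hj⟩ := ih
    rcases hF.elim u v hv.1 with ⟨i, hi⟩ | ⟨i, hi⟩
    · exact ⟨j + i, by rw [Function.iterate_add_apply, hi, hj]⟩
    · rcases le_or_gt i j with hij | hij
      · refine ⟨j - i, ?_⟩
        rw [← hi, ← Function.iterate_add_apply, Nat.sub_add_cancel hij, hj]
      -- Here `v` would be above `r`. If `r` is a forest root, then `v = r`; otherwise all proper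
      -- ancestors of `r` are deleted, while `v` is not.
      · obtain ⟨c, rfl⟩ := Nat.exists_eq_add_of_lt hij
        rw [show j + c + 1 = (c + 1) + j by omega, Function.iterate_add_apply, hj] at hi
        rcases htop with htop | htop
        · rw [Function.iterate_fixed htop] at hi
          exact ⟨0, hi.symm⟩
        · have key : ∀ c, del (fp^[c + 1] r) ≠ 0 := by
            intro c
            induction c with
            | zero => exact htop
            | succ c ih =>
              rw [Function.iterate_succ_apply']
              exact hup _ (hF.iterate_lt hr _) ih
          rw [Function.iterate_succ_apply] at hi
          have := key c
          rw [Function.iterate_succ_apply, hi] at this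
          exact absurd hv.2 this

/-- The level drops at each step and is below `k`. There is one climb per deleted vertex, so all
climbs together cost `O(k n)`. -/
theorem wp_climb (hF : ForestOK n k A (s.iarr aForest)) (hv : s.ireg iR < n)
    (hdel : s.iarr aDel (s.ireg iR) = 0) :
    wp pClimb s t fun t' s' => t' ≤ t + 20 * k + 20 ∧ s'.ireg iR < n ∧
      s.iarr aDel (s'.ireg iR) = 0 ∧ (s.iarr aForest (s'.ireg iR) = s'.ireg iR ∨
        s.iarr aDel (s.iarr aForest (s'.ireg iR)) ≠ 0) := by
  obtain ⟨lev, hlev⟩ := hF.level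
  refine wp_while (fun t' s' => s'.ireg iR < n ∧ s.iarr aDel (s'.ireg iR) = 0 ∧
    t' + 20 * lev (s'.ireg iR) ≤ t + 20 * k) (t + 20 * k) ?_ ?_ ?_ ?_
  · exact ⟨hv, hdel, by have := (hlev _ hv).1; omega⟩
  · rintro t' s' ⟨-, -, h⟩; omega
  · rintro t' s' hf ⟨h1, h2, h3⟩ hb
    simp only [Test.Holds, IExpr.eval] at hb
    have e1 : s'.iarr aForest = s.iarr aForest := hf.iarr _ (by decide)
    have e2 : s'.iarr aDel = s.iarr aDel := hf.iarr _ (by decide)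
    rw [e1, e2] at hb
    have := (hlev _ h1).2 hb.1
    rw [wp_setI]
    simp only [IExpr.eval, IExpr.cost, Test.cost, setI_ireg, e1, if_true]
    exact ⟨hF.lt _ h1, hb.2, by omega⟩
  · rintro t' s' hf ⟨h1, h2, h3⟩ hb
    simp only [Test.Holds, IExpr.eval] at hb
    have e1 : s'.iarr aForest = s.iarr aForest := hf.iarr _ (by decide)
    have e2 : s'.iarr aDel = s.iarr aDel := hf.iarr _ (by decide)
    rw [e1, e2] at hb
    refine ⟨by simp only [Test.cost, IExpr.cost]; omega, h1, h2, ?_⟩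
    tauto

/-- The invariant of the outer loop. -/
structure RoundsInv (n k : ℕ) (und : Bool) (A : ℕ → ℕ → Prop) (W : ℕ → ℕ → ℝ)
    (adj : ℕ → List (ℕ × ℝ)) (fp : ℕ → ℕ) (B T t : ℕ) (s : State) : Prop where
  ready : Ready n und A W adj s
  size : s.ireg iN = n
  forest : s.iarr aForest = fp
  up : ∀ v < n, s.iarr aDel v ≠ 0 → s.iarr aDel (fp v) ≠ 0
  le : s.ireg iV ≤ n
  time : t ≤ T + 20 * s.ireg iV + ∑ r ∈ (Finset.range n).filter (fun r => s.iarr aDel r ≠ 0),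
    (20 * k + 50 + 6000 * charge n B adj fp r)

theorem Ready.setI {x v : ℕ} (h : Ready n und A W adj s) (hx : x = iV ∨ x = iR) :
    Ready n und A W adj (s.setI x v) := by
  have h1 : x ≠ 17 ∧ x ≠ 18 ∧ x ≠ 2 ∧ x ≠ 3 ∧ x ≠ 4 := by omega
  obtain ⟨h1, h2, h3, h4, h5⟩ := h1
  obtain ⟨kids, hk⟩ := h.heap
  refine ⟨⟨?_, ?_⟩, h.adjAt, ⟨kids, hk.congr ?_ ?_ ?_ ?_⟩, h.empty, h.zero, h.scn⟩
  · simpa [h1.symm, h2.symm] using h.sol.cyc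
  · simpa [h1.symm, h2.symm] using h.sol.lower
  · rintro y (rfl | rfl | rfl) <;> simp [h3.symm, h4.symm, h5.symm]
  · simp
  · simp
  · simp

theorem RoundsInv.time_le (hF : ForestOK n k A fp) (h : RoundsInv n k und A W adj fp B T t s) :
    t ≤ T + 20 * n + (n * (20 * k + 50) +
      6000 * (k * ∑ u ∈ Finset.range n, ((adj u).length + (B + 1)))) := by
  have h1 := h.time
  have h2 := h.le
  have h3 : ∑ r ∈ (Finset.range n).filter (fun r => s.iarr aDel r ≠ 0),
      (20 * k + 50 + 6000 * charge n B adj fp r) ≤ ∑ r ∈ Finset.range n,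
      (20 * k + 50 + 6000 * charge n B adj fp r) :=
    Finset.sum_le_sum_of_subset (Finset.filter_subset _ _)
  have h5 : ∑ r ∈ Finset.range n, (20 * k + 50 + 6000 * charge n B adj fp r) =
      n * (20 * k + 50) + 6000 * ∑ r ∈ Finset.range n, charge n B adj fp r := by
    rw [Finset.sum_add_distrib, Finset.sum_const, Finset.card_range, smul_eq_mul, Finset.mul_sum]
  rw [h5] at h3
  have h4 := hF.sum_charge_le (B := B) (adj := adj)
  omega

/-- The clock is bounded by a sum over the deleted vertices, to which each pass of the inner loop
adds the term of the vertex it deletes. This bound also gives termination of both loops. -/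
theorem wp_rounds (hadj : AdjOK n und adj) (hA : Describes A W adj)
    (hB : ∀ k, 2 ^ (k / 2) ≤ 1 + ∑ v ∈ Finset.range n, (adj v).length → k < B)
    (hF : ForestOK n k A (s.iarr aForest)) (h : Ready n und A W adj s) (hn : s.ireg iN = n)
    (hdel : ∀ v, s.iarr aDel v = 0) :
    wp (pRounds und) s t fun t' s' => Sol und A W s' ∧ (∀ v < n, s'.iarr aDel v ≠ 0) ∧
      t' ≤ t + 10 + 20 * n + (n * (20 * k + 50) +
      6000 * (k * ∑ u ∈ Finset.range n, ((adj u).length + (B + 1)))) := by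
  simp only [pRounds, wp_seq, wp_setI, IExpr.eval, IExpr.cost]
  generalize hfp : s.iarr aForest = fp at *
  refine wp_while (fun t' s' => RoundsInv n k und A W adj fp B (t + 2) t' s' ∧
    ∀ v < s'.ireg iV, s'.iarr aDel v ≠ 0) _ ?_ (fun t' s' h => h.1.time_le hF) ?_ ?_
  · refine ⟨⟨h.setI (by simp), by simpa using hn, by simpa using hfp, ?_, by simp, by omega⟩,
      by simp⟩
    intro v _ hv
    exact absurd (by simpa using hdel v) hv
  · rintro t₁ s₁ - ⟨h₁, hd₁⟩ hb
    simp only [Test.Holds, IExpr.eval] at hb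
    rw [wp_seq]
    -- The 6 units beyond the outer budget pay for the outer test; they are recovered when `iV`
    -- increases and 20 units become available.
    refine wp_while (fun t' s' => RoundsInv n k und A W adj fp B (t + 8) t' s' ∧
      (∀ v < s'.ireg iV, s'.iarr aDel v ≠ 0) ∧ s'.ireg iV < n) _ ?_
      (fun t' s' h => h.1.time_le hF) ?_ ?_
    · refine ⟨⟨h₁.ready, h₁.size, h₁.forest, h₁.up, h₁.le, ?_⟩, hd₁, by rw [← h₁.size]; exact hb⟩
      have := h₁.time
      simp only [Test.cost, IExpr.cost]
      omega
    · rintro t₂ s₂ - ⟨h₂, hd₂, hV₂⟩ hb₂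
      simp only [Test.Holds, IExpr.eval] at hb₂
      simp only [wp_seq, wp_setI, IExpr.eval, IExpr.cost]
      refine (wp_climb (s := s₂.setI iR (s₂.ireg iV)) (n := n) (k := k) (A := A) ?_ ?_ ?_).frame.mono
        ?_
      · simpa [h₂.forest] using hF
      · simpa using hV₂
      · simpa using hb₂
      rintro t₃ s₃ ⟨⟨ht₃, hr₃, hdel₃, htop₃⟩, hf₃⟩
      simp only [setI_iarr, h₂.forest] at hdel₃ htop₃
      have hDel₃ : s₃.iarr aDel = s₂.iarr aDel := (hf₃.iarr _ (by decide)).trans (by simp)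
      have hs₃ : s₃ = s₂.setI iR (s₃.ireg iR) := by
        refine State.ext ?_ ?_ ?_ ?_ <;> funext x
        · by_cases hx : x = iR
          · simp [hx]
          · rw [hf₃.ireg x (by simpa [pClimb, Prog.mods] using hx)]
            simp [hx]
        · exact hf₃.rreg x (by simp [pClimb, Prog.mods])
        · exact hf₃.iarr x (by simp [pClimb, Prog.mods])
        · exact hf₃.rarr x (by simp [pClimb, Prog.mods])
      have hready : Ready n und A W adj s₃ := by
        rw [hs₃]; exact h₂.ready.setI (by simp)
      have hup₃ := h₂.up
      have htime := h₂.time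
      rw [← hDel₃] at hdel₃ htop₃ hup₃ htime
      refine (wp_round hadj hA hB hready hr₃ hdel₃).frame.mono ?_
      rintro t₄ s₄ ⟨⟨hready₄, hDel₄, S, hS, hrS, ht₄⟩, hf₄⟩
      have eV : s₄.ireg iV = s₂.ireg iV := by
        rw [hf₄.ireg iV (by cases und <;> decide), hf₃.ireg iV (by decide)]; simp
      set r := s₃.ireg iR
      refine ⟨⟨hready₄, ?_, ?_, ?_, ?_, ?_⟩, ?_, ?_⟩
      · rw [hf₄.ireg iN (by cases und <;> decide), hf₃.ireg iN (by decide)]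
        simpa using h₂.size
      · rw [hf₄.iarr aForest (by cases und <;> decide), hf₃.iarr aForest (by decide)]
        simpa using h₂.forest
      · intro v hv hdv
        rw [hDel₄] at hdv ⊢
        by_cases hfr : fp v = r
        · rw [hfr, Function.update_self]; exact one_ne_zero
        rw [Function.update_of_ne hfr]
        by_cases hvr : v = r
        · subst hvr
          exact htop₃.resolve_left hfr
        · rw [Function.update_of_ne hvr] at hdv
          exact hup₃ v hv hdv
      · rw [eV]; exact hV₂.le
      · have hfil : (Finset.range n).filter (fun v => s₄.iarr aDel v ≠ 0) =
            insert r ((Finset.range n).filter (fun v => s₃.iarr aDel v ≠ 0)) := by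
          ext v
          by_cases hvr : v = r
          · subst hvr; simp [hDel₄, hr₃]
          · simp [hDel₄, hvr]
        have hcharge : ∑ v ∈ S, ((adj v).length + (B + 1)) ≤ charge n B adj fp r := by
          classical
          refine Finset.sum_le_sum_of_subset fun v hv => ?_
          rw [Finset.mem_filter, Finset.mem_range]
          exact ⟨(hS v hv).1, hF.descendant hup₃ hr₃ htop₃ (hS v hv).2⟩
        rw [hfil, Finset.sum_insert (by simp [hdel₃]), eV]
        simp only [Test.cost, IExpr.cost] at ht₃
        omega
      · intro v hv
        rw [eV] at hv
        rw [hDel₄]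
        by_cases hvr : v = r
        · rw [hvr, Function.update_self]; exact one_ne_zero
        · rw [Function.update_of_ne hvr, hDel₃]; exact hd₂ v hv
      · rw [eV]; exact hV₂
    · rintro t₂ s₂ - ⟨h₂, hd₂, hV₂⟩ hb₂
      simp only [Test.Holds, IExpr.eval] at hb₂
      simp only [wp_setI, IExpr.eval, IExpr.cost, Test.cost]
      refine ⟨⟨h₂.ready.setI (by simp), by simpa using h₂.size, by simpa using h₂.forest,
        by simpa using h₂.up, by simpa using hV₂, ?_⟩, ?_⟩
      · have := h₂.time
        change _ ≤ t + 2 + 20 * (s₂.setI iV (s₂.ireg iV + 1)).ireg iV +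
          ∑ r ∈ (Finset.range n).filter (fun r => s₂.iarr aDel r ≠ 0),
            (20 * k + 50 + 6000 * charge n B adj fp r)
        rw [setI_ireg, if_pos rfl]
        omega
      · intro v hv
        simp at hv ⊢
        rcases hv.lt_or_eq with hv | rfl
        · exact hd₂ v hv
        · exact hb₂
  · rintro t₁ s₁ - ⟨h₁, hd₁⟩ hb
    simp only [Test.Holds, IExpr.eval, h₁.size] at hb
    refine ⟨h₁.ready.sol, fun v hv => hd₁ v (by omega), ?_⟩
    have := h₁.time_le hF
    simp only [Test.cost, IExpr.cost]
    omega

end Rounds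

/-! ## Building the adjacency lists -/

/-- Adds the arc from `iX` to `iY` of weight `rK`. -/
def pAddArc : Prog :=
  .writeI aTo (.reg iArc) (.reg iY) ;; .writeR aWt (.reg iArc) (.reg rK) ;;
  .writeI aNext (.reg iArc) (.read aHead (.reg iX)) ;; .writeI aHead (.reg iX) (.reg iArc) ;;
  .setI iArc (.succ (.reg iArc))

/-- Node and arc numbers start at 1, because 0 is the null pointer. -/
def pBuild (und : Bool) : Prog :=
  .setI iCnt (.const 1) ;; .setI iJ (.const 0) ;; .setI iArc (.const 1) ;;
  .while (.ilt (.reg iJ) (.reg iM))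
    (.setI iX (.read aSrc (.reg iJ)) ;; .setI iY (.read aDst (.reg iJ)) ;;
      .setR rK (.read aIn (.reg iJ)) ;; pAddArc ;;
      (if und then .setI iZ (.reg iX) ;; .setI iX (.reg iY) ;; .setI iY (.reg iZ) ;; pAddArc
        else .skip) ;;
      .setI iJ (.succ (.reg iJ)))

/-- The whole program. -/
def pMain (und : Bool) : Prog :=
  pBuild und ;; pRounds und ;; .setI iN (.reg iLen)

/-- As `ALRep`, with a bound on the cells used. -/
def ALIn (tgt next : ℕ → ℕ) (wt : ℕ → ℝ) (b : ℕ) : ℕ → List (ℕ × ℝ) → Prop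
  | p, [] => p = 0
  | p, e :: l => p ≠ 0 ∧ p < b ∧ tgt p = e.1 ∧ wt p = e.2 ∧ ALIn tgt next wt b (next p) l

theorem ALIn.rep {tgt next : ℕ → ℕ} {wt : ℕ → ℝ} {b p : ℕ} {l : List (ℕ × ℝ)}
    (h : ALIn tgt next wt b p l) : ALRep tgt next wt p l := by
  induction l generalizing p with
  | nil => exact h
  | cons e l ih => exact ⟨h.1, h.2.2.1, h.2.2.2.1, ih h.2.2.2.2⟩

theorem ALIn.alloc {tgt next : ℕ → ℕ} {wt : ℕ → ℝ} {b p y q : ℕ} {x : ℝ} {l : List (ℕ × ℝ)}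
    (h : ALIn tgt next wt b p l) : ALIn (Function.update tgt b y) (Function.update next b q)
      (Function.update wt b x) (b + 1) p l := by
  induction l generalizing p with
  | nil => exact h
  | cons e l ih =>
    obtain ⟨h1, h2, h3, h4, h5⟩ := h
    refine ⟨h1, by omega, ?_, ?_, ?_⟩
    · rw [Function.update_of_ne h2.ne]; exact h3
    · rw [Function.update_of_ne h2.ne]; exact h4
    · rw [Function.update_of_ne h2.ne]; exact ih h5

/-- The arrays hold the adjacency lists `adj`, in cells below `iArc`. -/
def BuiltAt (adj : ℕ → List (ℕ × ℝ)) (s : State) : Prop :=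
  s.ireg iArc ≠ 0 ∧ ∀ u, ALIn (s.iarr aTo) (s.iarr aNext) (s.rarr aWt) (s.ireg iArc)
    (s.iarr aHead u) (adj u)

section Build

variable {n m k : ℕ} {und : Bool} {adj : ℕ → List (ℕ × ℝ)} {A : ℕ → ℕ → Prop}
  {W : ℕ → ℕ → ℝ} {s : State} {t : ℕ}

theorem wp_addArc (h : BuiltAt adj s) : wp pAddArc s t fun t' s' => t' = t + 16 ∧
    BuiltAt (Function.update adj (s.ireg iX) ((s.ireg iY, s.rreg rK) :: adj (s.ireg iX))) s' := by
  simp only [pAddArc, wp_seq, wp_setI, wp_writeI, wp_writeR, IExpr.eval, RExpr.eval, IExpr.cost,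
    RExpr.cost]
  refine ⟨trivial, by simp, fun u => ?_⟩
  simp
  by_cases hu : u = s.ireg iX
  · subst hu
    simp only [Function.update_self]
    refine ⟨h.1, by omega, by simp, by simp, ?_⟩
    rw [Function.update_self]
    exact (h.2 _).alloc
  · simp only [Function.update_of_ne hu]
    exact (h.2 _).alloc

/-- The adjacency lists of the first `j` edges of the input. -/
noncomputable def lists (und : Bool) (src dst : ℕ → ℕ) (wt : ℕ → ℝ) : ℕ → ℕ → List (ℕ × ℝ)
  | 0 => fun _ => []
  | j + 1 =>
    let l := lists und src dst wt j
    let l := Function.update l (src j) ((dst j, wt j) :: l (src j))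
    if und then Function.update l (dst j) ((src j, wt j) :: l (dst j)) else l

theorem mem_update_cons {u w v y : ℕ} {x z : ℝ} : (v, x) ∈
    Function.update adj w ((y, z) :: adj w) u ↔ (u = w ∧ v = y ∧ x = z) ∨ (v, x) ∈ adj u := by
  by_cases hu : u = w
  · subst hu; simp
  · simp [hu]

theorem mem_lists {src dst : ℕ → ℕ} {wt : ℕ → ℝ} {j u v : ℕ} {x : ℝ} :
    (v, x) ∈ lists und src dst wt j u ↔ ∃ i < j, x = wt i ∧
      (src i = u ∧ dst i = v ∨ und = true ∧ src i = v ∧ dst i = u) := by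
  induction j with
  | zero => simp [lists]
  | succ j ih =>
    rw [Nat.exists_lt_succ_right, ← ih]
    cases und
    · simp only [lists, Bool.false_eq_true, if_false, mem_update_cons]
      grind
    · simp only [lists, if_true, mem_update_cons]
      grind

theorem sum_update_cons {w : ℕ} (e : ℕ × ℝ) :
    ∑ v ∈ Finset.range n, (Function.update adj w (e :: adj w) v).length ≤
      ∑ v ∈ Finset.range n, (adj v).length + 1 := by
  have h : ∀ v, (Function.update adj w (e :: adj w) v).length =
      (adj v).length + if v = w then 1 else 0 := by
    intro v
    by_cases hv : v = w
    · subst hv; simp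
    · simp [hv]
  simp only [h, Finset.sum_add_distrib, Finset.sum_ite_eq']
  split_ifs <;> omega

/-- Each input edge yields one arc or two; the factor 2 serves both cases. -/
theorem sum_lists {src dst : ℕ → ℕ} {wt : ℕ → ℝ} {j : ℕ} :
    ∑ v ∈ Finset.range n, (lists und src dst wt j v).length ≤ 2 * j := by
  induction j with
  | zero => simp [lists]
  | succ j ih =>
    have h1 := sum_update_cons (n := n) (adj := lists und src dst wt j) (w := src j) (dst j, wt j)
    cases und
    · simp only [lists, Bool.false_eq_true, if_false]
      omega
    · simp only [lists, if_true]
      have h2 := sum_update_cons (n := n) (adj := Function.update (lists true src dst wt j) (src j)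
        ((dst j, wt j) :: lists true src dst wt j (src j))) (w := dst j) (src j, wt j)
      omega

/-- The memory at the start. -/
structure Initial (n m : ℕ) (s : State) : Prop where
  n_eq : s.ireg 0 = n
  m_eq : s.ireg 1 = m
  ireg : ∀ x, 2 ≤ x → s.ireg x = 0
  rreg : ∀ x, s.rreg x = 0
  iarr : ∀ a i, 3 ≤ a → s.iarr a i = 0

theorem wp_build (h : Initial n m s) : wp (pBuild und) s t fun t' s' =>
    t' ≤ t + 20 + 100 * m ∧
      BuiltAt (lists und (s.iarr aSrc) (s.iarr aDst) (s.rarr aIn) m) s' ∧ s'.ireg iCnt = 1 := by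
  simp only [pBuild, wp_seq, wp_setI, IExpr.eval, IExpr.cost]
  refine wp_while (fun t' s' => s'.ireg iJ ≤ m ∧ t' ≤ t + 6 + 100 * s'.ireg iJ ∧
    BuiltAt (lists und (s.iarr aSrc) (s.iarr aDst) (s.rarr aIn) (s'.ireg iJ)) s')
    (t + 6 + 100 * m) ?_ ?_ ?_ ?_
  · refine ⟨by simp, by simp, by simp, fun u => ?_⟩
    simp [h.iarr, lists, ALIn]
  · rintro t' s' ⟨h1, h2, -⟩
    omega
  · rintro t₁ s₁ hf ⟨h1, h2, h3⟩ hb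
    have eM : s₁.ireg iM = m := by
      rw [hf.ireg iM (by cases und <;> decide)]; simpa using h.m_eq
    have eS : s₁.iarr aSrc = s.iarr aSrc := by
      rw [hf.iarr aSrc (by cases und <;> decide)]; simp
    have eD : s₁.iarr aDst = s.iarr aDst := by
      rw [hf.iarr aDst (by cases und <;> decide)]; simp
    have eI : s₁.rarr aIn = s.rarr aIn := by
      rw [hf.rarr aIn (by cases und <;> decide)]; simp
    simp only [Test.Holds, IExpr.eval, eM] at hb
    simp only [wp_seq, wp_setI, wp_setR, IExpr.eval, IExpr.cost, RExpr.eval, RExpr.cost, Test.cost]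
    refine (wp_addArc (adj := lists und (s.iarr aSrc) (s.iarr aDst) (s.rarr aIn) (s₁.ireg iJ))
      ⟨by simpa using h3.1, by simpa using h3.2⟩).frame.mono ?_
    rintro t₂ s₂ ⟨⟨ht₂, h₂⟩, hf₂⟩
    have eJ : s₂.ireg iJ = s₁.ireg iJ := (hf₂.ireg iJ (by decide)).trans (by simp)
    have eX : s₂.ireg iX = s.iarr aSrc (s₁.ireg iJ) :=
      (hf₂.ireg iX (by decide)).trans (by simp [eS])
    have eY : s₂.ireg iY = s.iarr aDst (s₁.ireg iJ) :=
      (hf₂.ireg iY (by decide)).trans (by simp [eD])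
    have eK : s₂.rreg rK = s.rarr aIn (s₁.ireg iJ) :=
      (hf₂.rreg rK (by decide)).trans (by simp [eI])
    simp [eS, eD, eI] at h₂
    cases und with
    | false =>
      simp only [Bool.false_eq_true, if_false, wp_skip]
      refine ⟨by simp [eJ]; omega, by simp [eJ]; omega, ?_⟩
      simp [eJ, lists, BuiltAt]
      simpa [BuiltAt] using h₂
    | true =>
      simp only [if_true, wp_seq, wp_setI, IExpr.eval, IExpr.cost]
      refine (wp_addArc ⟨by simpa using h₂.1, by simpa using h₂.2⟩).frame.mono ?_
      rintro t₃ s₃ ⟨⟨ht₃, h₃⟩, hf₃⟩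
      have eJ₃ : s₃.ireg iJ = s₁.ireg iJ := (hf₃.ireg iJ (by decide)).trans (by simp [eJ])
      simp [eX, eY, eK] at h₃
      refine ⟨by simp [eJ₃]; omega, by simp [eJ₃]; omega, ?_⟩
      simp [eJ₃, lists, BuiltAt]
      simpa [BuiltAt] using h₃
  · rintro t₁ s₁ hf ⟨h1, h2, h3⟩ hb
    have eM : s₁.ireg iM = m := by
      rw [hf.ireg iM (by cases und <;> decide)]; simpa using h.m_eq
    simp only [Test.Holds, IExpr.eval, eM] at hb
    have : s₁.ireg iJ = m := by omega
    rw [this] at h3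
    refine ⟨by simp only [Test.cost, IExpr.cost]; omega, h3, ?_⟩
    rw [hf.ireg iCnt (by cases und <;> decide)]; simp

/-- The specification of the program. -/
theorem wp_main (h : Initial n m s)
    (hadj : AdjOK n und (lists und (s.iarr aSrc) (s.iarr aDst) (s.rarr aIn) m))
    (hA : Describes A W (lists und (s.iarr aSrc) (s.iarr aDst) (s.rarr aIn) m))
    (hF : ForestOK n k A (s.iarr aForest)) (hlt : ∀ u v, A u v → u < n) :
    wp (pMain und) s 0 fun t' s' =>
      (((∀ L f, ¬ Cyc und A L f) ∧ s'.ireg 0 = 0) ∨ (Cyc und A (s'.ireg 0) (s'.iarr 0) ∧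
        ∀ L f, Cyc und A L f → cycWeight W (s'.ireg 0) (s'.iarr 0) ≤ cycWeight W L f)) ∧
      t' ≤ 100 * m + 100 + 20 * n + (n * (20 * k + 50) +
        6000 * (k * (2 * m + n * (2 * Nat.log 2 (1 + 2 * m) + 3)))) := by
  refine wp_seq_of (wp_build h) ?_
  rintro t₁ s₁ hf₁ ⟨ht₁, hb₁, hc₁⟩
  set adj := lists und (s.iarr aSrc) (s.iarr aDst) (s.rarr aIn) m with hadj_def
  have hsum : ∑ v ∈ Finset.range n, (adj v).length ≤ 2 * m := sum_lists
  have ireg0 : ∀ x ∉ (pBuild und).mods.1, 2 ≤ x → s₁.ireg x = 0 := fun x hx h2 =>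
    (hf₁.ireg x hx).trans (h.ireg x h2)
  have iarr0 : ∀ a ∉ (pBuild und).mods.2.2.1, 3 ≤ a → ∀ i, s₁.iarr a i = 0 := fun a ha h3 i => by
    rw [hf₁.iarr a ha, h.iarr a i h3]
  have eNd := iarr0 aNd (by cases und <;> decide) (by norm_num)
  have eDel := iarr0 aDel (by cases und <;> decide) (by norm_num)
  have eKp := iarr0 aKp (by cases und <;> decide) (by norm_num)
  have eRk := iarr0 aRk (by cases und <;> decide) (by norm_num)
  have eTl := iarr0 aTl (by cases und <;> decide) (by norm_num)
  have eTab := iarr0 aTab (by cases und <;> decide) (by norm_num)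
  have eScn := iarr0 aScn (by cases und <;> decide) (by norm_num)
  have eSp := ireg0 iSp (by cases und <;> decide) (by norm_num)
  have hready : Ready n und A W adj s₁ := by
    refine ⟨⟨.inl ⟨ireg0 iHas (by cases und <;> decide) (by norm_num),
      ireg0 iLen (by cases und <;> decide) (by norm_num)⟩, ?_⟩, fun u _ => (hb₁.2 u).rep,
      ⟨fun _ => [], ⟨⟨⟨?_, ?_, ?_⟩, ⟨⟨?_, ?_, ?_, ?_⟩, ?_, ?_, ?_⟩⟩, ?_, eTab,
        ireg0 iMax (by cases und <;> decide) (by norm_num)⟩⟩, eNd, ?_, ?_⟩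
    · rintro L f - ⟨i, -, hi⟩
      exact absurd (eDel _) hi
    · intro x _; exact eKp x
    · intro x _; exact eRk x
    · exact eTl 0
    · simp
    · simp
    · simp
    · intro x; simp [Ranked]
    · omega
    · simp [eSp, img_zero]
    · intro v hv; exact absurd (eNd v) hv
    · simp [eSp, img_zero]
    · rw [hf₁.rreg rZero (by cases und <;> decide)]; exact h.rreg _
    · intro v _ u _ _
      rw [eScn]; omega
  -- There are at most `2 * m` arcs, so a heap has at most `1 + 2 * m` nodes; the summand 2 makes up
  -- for rounding in `k / 2`.
  have hB : ∀ k, 2 ^ (k / 2) ≤ 1 + ∑ v ∈ Finset.range n, (adj v).length →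
      k < 2 * Nat.log 2 (1 + 2 * m) + 2 := by
    intro k hk
    have := Nat.le_log_of_pow_le (b := 2) (by norm_num) (hk.trans (Nat.add_le_add_left hsum 1))
    omega
  rw [wp_seq]
  refine (wp_rounds (k := k) hadj hA hB ?_ hready ?_ eDel).mono ?_
  · rwa [hf₁.iarr aForest (by cases und <;> decide)]
  · rw [hf₁.ireg iN (by cases und <;> decide)]; exact h.n_eq
  rintro t₂ s₂ ⟨hsol, hdel, ht₂⟩
  rw [wp_setI]
  simp only [IExpr.eval, IExpr.cost, setI_ireg, setI_iarr, if_true]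
  -- In the end all vertices are deleted, so the bound for cycles through a deleted vertex holds for
  -- every cycle.
  have low : ∀ L f, Cyc und A L f → s₂.ireg iHas ≠ 0 ∧ s₂.rreg rBest ≤ cycWeight W L f :=
    fun L f hf => hsol.lower L f hf ⟨0, hf.pos, hdel _ (hlt _ _ (hf.arc 0 hf.pos))⟩
  refine ⟨?_, ?_⟩
  · rcases hsol.cyc with ⟨h1, h2⟩ | ⟨h1, h2, h3⟩
    · exact .inl ⟨fun L f hf => (low L f hf).1 h1, h2⟩
    · exact .inr ⟨h2, fun L f hf => by rw [h3]; exact (low L f hf).2⟩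
  · have h1 : ∑ u ∈ Finset.range n, ((adj u).length + (2 * Nat.log 2 (1 + 2 * m) + 2 + 1)) ≤
        2 * m + n * (2 * Nat.log 2 (1 + 2 * m) + 3) := by
      rw [Finset.sum_add_distrib, Finset.sum_const, Finset.card_range, smul_eq_mul]
      exact Nat.add_le_add_right hsum _
    have h2 := Nat.mul_le_mul_left k h1
    omega

end Build

/-! ## From the input to the specification of the program -/

/-! ### Iterated parent pointers and ancestors. -/

section Forest

variable {n : ℕ} (F : RootedForest (Fin n))

/-- The parent of a vertex, a root being its own parent. -/
def RootedForest.up (v : Fin n) : Fin n := (F.parent v).getD v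

theorem RootedForest.isAncestor_iff {u v : Fin n} : F.IsAncestor u v ↔ ∃ i, F.up^[i] v = u := by
  constructor
  · intro h
    induction h using Relation.ReflTransGen.head_induction_on with
    | refl => exact ⟨0, rfl⟩
    | @head a b hab _ ih =>
      obtain ⟨i, hi⟩ := ih
      refine ⟨i + 1, ?_⟩
      rw [Function.iterate_succ_apply', hi, RootedForest.up, hab, Option.getD_some]
  · rintro ⟨i, rfl⟩
    induction i with
    | zero => exact .refl
    | succ i ih =>
      rw [Function.iterate_succ_apply']
      cases h : F.parent (F.up^[i] v) with
      | none => rw [RootedForest.up, h, Option.getD_none]; exact ih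
      | some a => rw [RootedForest.up, h, Option.getD_some]; exact .head h ih

/-- By well-foundedness `v` is not an ancestor of its parent. Hence the number of ancestors can
serve as a level that drops on the way up. -/
theorem RootedForest.up_ancestors_ssubset {v : Fin n} (h : F.up v ≠ v) :
    {u | F.IsAncestor u (F.up v)} ⊂ {u | F.IsAncestor u v} := by
  have hp : F.parent v = some (F.up v) := by
    cases hp : F.parent v with
    | none => exact absurd (by rw [RootedForest.up, hp, Option.getD_none]) h
    | some a => rw [RootedForest.up, hp, Option.getD_some]
  refine ⟨fun u hu => Relation.ReflTransGen.tail hu hp, fun hsub => ?_⟩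
  have h1 : F.IsAncestor v (F.up v) := hsub (show F.IsAncestor v v from .refl)
  exact F.wf.transGen.irrefl.irrefl _ (Relation.TransGen.tail' h1 hp)

theorem RootedForest.ncard_le_depth (v : Fin n) : {u | F.IsAncestor u v}.ncard ≤ F.depth :=
  Finset.le_sup (f := fun v => {u | F.IsAncestor u v}.ncard) (Finset.mem_univ v)

theorem RootedForest.ncard_pos (v : Fin n) : 0 < {u | F.IsAncestor u v}.ncard :=
  (Set.ncard_pos (Set.toFinite _)).2 ⟨v, .refl⟩

theorem RootedForest.depth_le : F.depth ≤ n := by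
  refine Finset.sup_le fun v _ => ?_
  simpa using Set.ncard_le_ncard (Set.subset_univ {u | F.IsAncestor u v})

theorem RootedForest.forestOK {adj : Fin n → Fin n → Prop} (hF : F.IsElimination adj) {fp : ℕ → ℕ}
    (hfp : ∀ v : Fin n, fp v = F.up v) :
    ForestOK n F.depth (fun u v => ∃ hu hv, adj ⟨u, hu⟩ ⟨v, hv⟩) fp := by
  classical
  have hit : ∀ (v : Fin n) i, fp^[i] v = F.up^[i] v := by
    intro v i
    induction i with
    | zero => rfl
    | succ i ih => rw [Function.iterate_succ_apply', Function.iterate_succ_apply', ih, hfp]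
  have hanc : ∀ (v : Fin n) u, (∃ i, fp^[i] v = u) ↔ ∃ hu, F.IsAncestor ⟨u, hu⟩ v := by
    intro v u
    simp only [hit, F.isAncestor_iff]
    constructor
    · rintro ⟨i, rfl⟩; exact ⟨Fin.isLt _, i, rfl⟩
    · rintro ⟨hu, i, hi⟩; exact ⟨i, by rw [hi]⟩
  -- A vertex is among its own ancestors; subtracting 1 makes the level strictly smaller than the
  -- depth.
  refine ⟨fun v hv => ?_, ⟨fun v => if hv : v < n then {u | F.IsAncestor u ⟨v, hv⟩}.ncard - 1
    else 0, fun v hv => ?_⟩, ?_, fun v hv => ?_⟩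
  · rw [hfp ⟨v, hv⟩]; exact Fin.isLt _
  · have h1 := F.ncard_pos ⟨v, hv⟩
    have h2 := F.ncard_le_depth ⟨v, hv⟩
    simp only [dif_pos hv]
    refine ⟨by omega, fun hne => ?_⟩
    rw [hfp ⟨v, hv⟩] at hne ⊢
    simp only [Fin.isLt, dif_pos]
    have h3 := Set.ncard_lt_ncard (F.up_ancestors_ssubset (v := ⟨v, hv⟩) fun e => hne (by rw [e]))
    have h4 := F.ncard_pos (F.up ⟨v, hv⟩)
    simp only [Fin.eta]
    omega
  · rintro u v ⟨hu, hv, h⟩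
    rcases hF _ _ h with h | h
    · exact .inl ((hanc ⟨v, hv⟩ u).2 ⟨hu, h⟩)
    · exact .inr ((hanc ⟨u, hu⟩ v).2 ⟨hv, h⟩)
  · refine le_trans ?_ (F.ncard_le_depth ⟨v, hv⟩)
    rw [← Set.ncard_coe_finset, ← Set.ncard_image_of_injective _ Fin.val_injective]
    refine Set.ncard_le_ncard ?_ (Set.toFinite _)
    intro u hu
    obtain ⟨hu', h⟩ := (hanc ⟨v, hv⟩ u).1 (Finset.mem_filter.1 hu).2
    exact ⟨⟨u, hu'⟩, h, rfl⟩

end Forest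

theorem cycWeight_congr {W : ℕ → ℕ → ℝ} {L : ℕ} {f g : ℕ → ℕ} (h : ∀ i < L, f i = g i) :
    cycWeight W L f = cycWeight W L g :=
  Finset.sum_congr rfl fun i hi => by
    have hi := Finset.mem_range.1 hi
    rw [h i hi, h _ (Nat.mod_lt _ (by omega))]

theorem AdjOK.of_describes {n : ℕ} {und : Bool} {A : ℕ → ℕ → Prop} {W : ℕ → ℕ → ℝ}
    {adj : ℕ → List (ℕ × ℝ)} (h : Describes A W adj) (hlt : ∀ u v, A u v → v < n)
    (hW : ∀ u v, A u v → 0 ≤ W u v) (hne : ∀ u v, A u v → v ≠ u)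
    (hs : und = true → ∀ u v, A u v → A v u ∧ W v u = W u v) : AdjOK n und adj := by
  refine ⟨fun u e he => ?_, fun u e he => ?_, fun u e he => ?_, fun hu u v x he => ?_⟩
  · exact hlt _ _ ((h u e.1 e.2).1 he).1
  · obtain ⟨h1, h2⟩ := (h u e.1 e.2).1 he
    rw [h2]; exact hW _ _ h1
  · exact hne _ _ ((h u e.1 e.2).1 he).1
  · obtain ⟨h1, rfl⟩ := (h u v x).1 he
    obtain ⟨h3, h4⟩ := hs hu u v h1
    exact (h _ _ _).2 ⟨h3, h4.symm⟩

/-! ### Cycles as closed walks and as cyclic sequences. -/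

section Undirected

variable {n : ℕ} (G : SimpleGraph (Fin n)) (w : Sym2 (Fin n) → ℝ)

/-- Weights extended to pairs of natural numbers. -/
noncomputable def extendWeight (w : Fin n → Fin n → ℝ) (u v : ℕ) : ℝ :=
  if h : u < n ∧ v < n then w ⟨u, h.1⟩ ⟨v, h.2⟩ else 0

theorem extendWeight_coe (w : Fin n → Fin n → ℝ) (u v : Fin n) :
    extendWeight w u v = w u v := by
  rw [extendWeight, dif_pos ⟨u.isLt, v.isLt⟩]

theorem walkWeight_eq {V : Type*} {G : SimpleGraph V} (w : Sym2 V → ℝ) {u v : V} (p : G.Walk u v) :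
    walkWeight w p = ∑ i ∈ Finset.range p.length, w s(p.getVert i, p.getVert (i + 1)) := by
  induction p with
  | nil => simp [walkWeight]
  | cons h p ih =>
    rw [SimpleGraph.Walk.length_cons, Finset.sum_range_succ']
    simp only [SimpleGraph.Walk.getVert_cons_succ, SimpleGraph.Walk.getVert_zero]
    rw [← ih, add_comm]
    simp [walkWeight]

theorem cyc_of_walk {u : Fin n} {p : G.Walk u u} (hp : p.IsCycle) :
    Cyc true (fun u v => ∃ hu hv, G.Adj ⟨u, hu⟩ ⟨v, hv⟩) p.length (fun i => p.getVert i) ∧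
      cycWeight (extendWeight fun u v => w s(u, v)) p.length (fun i => p.getVert i) =
        walkWeight w p := by
  have h3 := hp.three_le_length
  have hmod : ∀ i < p.length, p.getVert ((i + 1) % p.length) = p.getVert (i + 1) := by
    intro i hi
    rcases Nat.lt_or_ge (i + 1) p.length with h | h
    · rw [Nat.mod_eq_of_lt h]
    · rw [show i + 1 = p.length by omega, Nat.mod_self, p.getVert_zero, p.getVert_length]
  refine ⟨⟨by omega, fun _ => h3, fun i hi j hj h => ?_, fun i hi => ?_⟩, ?_⟩
  · exact hp.getVert_injOn' (show i ≤ p.length - 1 by omega) (show j ≤ p.length - 1 by omega)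
      (Fin.val_injective h)
  · refine ⟨Fin.isLt _, Fin.isLt _, ?_⟩
    simp only [Fin.eta]
    rw [hmod i hi]
    exact p.adj_getVert_succ hi
  · rw [walkWeight_eq]
    refine Finset.sum_congr rfl fun i hi => ?_
    rw [extendWeight_coe, hmod i (Finset.mem_range.1 hi)]

/-- The walk along a sequence of vertices. -/
def walkAlong {V : Type*} {G : SimpleGraph V} : ∀ (L : ℕ) (f : ℕ → V),
    (∀ i < L, G.Adj (f i) (f (i + 1))) → G.Walk (f 0) (f L)
  | 0, _, _ => .nil
  | L + 1, f, h => .cons (h 0 (Nat.succ_pos L))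
      (walkAlong L (fun i => f (i + 1)) fun i hi => h (i + 1) (Nat.succ_lt_succ hi))

theorem length_walkAlong {V : Type*} {G : SimpleGraph V} (L : ℕ) (f : ℕ → V)
    (h : ∀ i < L, G.Adj (f i) (f (i + 1))) : (walkAlong L f h).length = L := by
  induction L generalizing f with
  | zero => rfl
  | succ L ih => simp [walkAlong, ih (fun i => f (i + 1))]

theorem getVert_walkAlong {V : Type*} {G : SimpleGraph V} (L : ℕ) (f : ℕ → V)
    (h : ∀ i < L, G.Adj (f i) (f (i + 1))) {i : ℕ} (hi : i ≤ L) :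
    (walkAlong L f h).getVert i = f i := by
  induction L generalizing f i with
  | zero => rw [Nat.le_zero.1 hi]; rfl
  | succ L ih =>
    cases i with
    | zero => exact SimpleGraph.Walk.getVert_zero _
    | succ i =>
      rw [walkAlong, SimpleGraph.Walk.getVert_cons_succ]
      exact ih (fun i => f (i + 1)) _ (by omega)

theorem walk_of_cyc {L : ℕ} {f : ℕ → ℕ}
    (hf : Cyc true (fun u v => ∃ hu hv, G.Adj ⟨u, hu⟩ ⟨v, hv⟩) L f) :
    ∃ (u : Fin n) (p : G.Walk u u), p.IsCycle ∧ p.length = L ∧ ∀ i < L, (p.getVert i : ℕ) = f i := by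
  have hL := hf.pos
  have hlt : ∀ i, f (i % L) < n := fun i => (hf.arc _ (Nat.mod_lt i hL)).1
  -- Indices are reduced modulo `L`, so that position `L` is the starting point again and the walk
  -- closes up.
  let g : ℕ → Fin n := fun i => ⟨f (i % L), hlt i⟩
  have hg : ∀ i < L, G.Adj (g i) (g (i + 1)) := by
    intro i hi
    obtain ⟨hu, hv, h⟩ := hf.arc i hi
    simpa [g, Nat.mod_eq_of_lt hi] using h
  have hclose : g L = g 0 := by simp [g]
  let q : G.Walk (g 0) (g 0) := (walkAlong L g hg).copy rfl hclose
  have hq : ∀ i ≤ L, q.getVert i = g i := by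
    intro i hi
    rw [SimpleGraph.Walk.getVert_copy, getVert_walkAlong L g hg hi]
  have hlen : q.length = L := by
    rw [SimpleGraph.Walk.length_copy, length_walkAlong]
  have h3 := hf.three rfl
  refine ⟨g 0, q, ?_, hlen, fun i hi => ?_⟩
  -- The tail visits positions `1` to `L`, which are a full system of residues modulo `L`, so its
  -- vertices are distinct.
  · rw [SimpleGraph.Walk.isCycle_iff_isPath_tail_and_le_length]
    refine ⟨?_, by omega⟩
    have hne : ¬ q.Nil := by
      rw [SimpleGraph.Walk.not_nil_iff_lt_length]; omega
    have ht := SimpleGraph.Walk.length_tail_add_one hne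
    rw [← SimpleGraph.Walk.IsPath.getVert_injOn_iff]
    intro i hi j hj h
    simp only [Set.mem_ofPred_eq] at hi hj
    rw [SimpleGraph.Walk.getVert_tail, SimpleGraph.Walk.getVert_tail, hq _ (by omega),
      hq _ (by omega)] at h
    have h' := hf.inj _ (Nat.mod_lt _ hL) _ (Nat.mod_lt _ hL) (Fin.mk.inj h)
    rcases Nat.lt_or_ge (i + 1) L with hi' | hi' <;> rcases Nat.lt_or_ge (j + 1) L with hj' | hj'
    · rw [Nat.mod_eq_of_lt hi', Nat.mod_eq_of_lt hj'] at h'; omega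
    · rw [Nat.mod_eq_of_lt hi', show j + 1 = L by omega, Nat.mod_self] at h'; omega
    · rw [Nat.mod_eq_of_lt hj', show i + 1 = L by omega, Nat.mod_self] at h'; omega
    · omega
  · rw [hq i hi.le]
    simp [g, Nat.mod_eq_of_lt hi]

end Undirected

/-! ### Directed cycles indexed by `Fin (l + 1)`. -/

section Directed

variable {n : ℕ} (G : Digraph (Fin n)) (w : Fin n → Fin n → ℝ)

theorem ofNat_succ_mod {l : ℕ} (i : ℕ) :
    Fin.ofNat (l + 1) ((i + 1) % (l + 1)) = Fin.ofNat (l + 1) i + 1 := by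
  apply Fin.ext
  simp [Fin.val_add]

theorem cyc_of_diCycle {l : ℕ} {c : Fin (l + 1) → Fin n} (hc : IsDiCycle G c) :
    Cyc false (fun u v => ∃ hu hv, G.Adj ⟨u, hu⟩ ⟨v, hv⟩) (l + 1)
      (fun i => c (Fin.ofNat (l + 1) i)) ∧
      cycWeight (extendWeight w) (l + 1) (fun i => c (Fin.ofNat (l + 1) i)) = diCycleWeight w c := by
  refine ⟨⟨Nat.succ_pos l, by simp, fun i hi j hj h => ?_, fun i hi => ?_⟩, ?_⟩
  · have := congrArg Fin.val (hc.1 (Fin.val_injective h))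
    rwa [Fin.val_ofNat, Fin.val_ofNat, Nat.mod_eq_of_lt hi, Nat.mod_eq_of_lt hj] at this
  · refine ⟨Fin.isLt _, Fin.isLt _, ?_⟩
    simp only [Fin.eta]
    rw [ofNat_succ_mod]
    exact hc.2 _
  · rw [cycWeight, Finset.sum_range, diCycleWeight]
    refine Finset.sum_congr rfl fun i _ => ?_
    rw [extendWeight_coe, ofNat_succ_mod, Fin.ofNat_val_eq_self]

theorem diCycle_of_cyc {L : ℕ} {f : ℕ → ℕ}
    (hf : Cyc false (fun u v => ∃ hu hv, G.Adj ⟨u, hu⟩ ⟨v, hv⟩) L f) :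
    ∃ (l : ℕ) (c : Fin (l + 1) → Fin n), IsDiCycle G c ∧ L = l + 1 ∧
      ∀ i : Fin (l + 1), (c i : ℕ) = f i := by
  have hL := hf.pos
  obtain ⟨l, rfl⟩ := Nat.exists_eq_succ_of_ne_zero hL.ne'
  refine ⟨l, fun i => ⟨f i, (hf.arc i i.isLt).1⟩, ⟨fun i j h => ?_, fun i => ?_⟩, rfl,
    fun i => rfl⟩
  · exact Fin.ext (hf.inj i i.isLt j j.isLt (Fin.mk.inj h))
  · obtain ⟨hu, hv, h⟩ := hf.arc i i.isLt
    have := congrArg Fin.val (ofNat_succ_mod (l := l) i)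
    rw [Fin.ofNat_val_eq_self, Fin.val_ofNat, Nat.mod_mod] at this
    simp only [← this]
    exact h

end Directed

/-- The running time of the program is of the stated order. -/
theorem time_bound {n m k t : ℕ} (hm : m ≤ n * n) (hk : k ≤ n) (hk0 : 0 < n → 0 < k)
    (ht : t ≤ 100 * m + 100 + 20 * n + (n * (20 * k + 50) +
      6000 * (k * (2 * m + n * (2 * Nat.log 2 (1 + 2 * m) + 3))))) :
    (t : ℝ) ≤ 200000 * (k * (m + n * Real.log n) + 1) := by
  -- For `n ≤ 1` the term `n * log n` vanishes, and the summand 1 has to carry the constants.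
  obtain h | h | hn : n = 0 ∨ n = 1 ∨ 2 ≤ n := by omega
  · subst h
    have hm : m = 0 := by omega
    subst hm
    have : k = 0 := by omega
    subst this
    norm_num at ht ⊢
    have : (t : ℝ) ≤ 100 := by exact_mod_cast ht
    linarith
  · subst h
    have : k = 1 := by omega
    subst this
    have : m = 0 ∨ m = 1 := by omega
    rcases this with rfl | rfl
    · norm_num at ht ⊢
      have : (t : ℝ) ≤ 200000 := by exact_mod_cast (ht.trans (by norm_num))
      linarith
    · have e : Nat.log 2 3 = 1 := by decide
      norm_num [e] at ht ⊢
      have : (t : ℝ) ≤ 200000 := by exact_mod_cast (ht.trans (by norm_num))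
      linarith
  · have hk1 : (1 : ℝ) ≤ k := by exact_mod_cast hk0 (by omega)
    have hlog2 := Real.log_two_gt_d9
    have hn' : (2 : ℝ) ≤ n := by exact_mod_cast hn
    have hln : Real.log 2 ≤ Real.log n := Real.log_le_log (by norm_num) hn'
    -- For `n ≥ 2` one has `1 + 2 * m ≤ 1 + 2 * n ^ 2 ≤ n ^ 4`, so the binary logarithm of the heap
    -- size is of the order of `log n`.
    have hpow : 2 ^ Nat.log 2 (1 + 2 * m) ≤ n ^ 4 := by
      refine (Nat.pow_log_le_self 2 (by omega)).trans ?_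
      have : 4 ≤ n * n := Nat.mul_le_mul hn hn
      nlinarith
    have hL : (Nat.log 2 (1 + 2 * m) : ℝ) * Real.log 2 ≤ 4 * Real.log n := by
      have : ((2 : ℝ) ^ Nat.log 2 (1 + 2 * m)) ≤ (n : ℝ) ^ 4 := by exact_mod_cast hpow
      have := Real.log_le_log (by positivity) this
      rwa [Real.log_pow, Real.log_pow, Nat.cast_ofNat] at this
    generalize hLn : Nat.log 2 (1 + 2 * m) = L at *
    generalize hl : Real.log n = l at *
    -- Here `4 / log 2 < 6`.
    have hL6 : (L : ℝ) ≤ 6 * l := by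
      have : (0 : ℝ) ≤ L := Nat.cast_nonneg _
      nlinarith
    have hl1 : 1 ≤ 2 * l := by linarith
    have ht' : (t : ℝ) ≤ 100 * m + 100 + 20 * n + (n * (20 * k + 50) +
        6000 * (k * (2 * m + n * (2 * L + 3)))) := by exact_mod_cast ht
    have hm0 : (0 : ℝ) ≤ m := Nat.cast_nonneg _
    have b1 : (m : ℝ) ≤ k * m := le_mul_of_one_le_left hm0 hk1
    have b2 : (k : ℝ) * n ≤ 2 * (k * (n * l)) := by
      have : (0 : ℝ) ≤ k * n := by positivity
      nlinarith
    have b3 : (n : ℝ) ≤ k * n := le_mul_of_one_le_left (by linarith) hk1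
    have b4 : (k : ℝ) * n * L ≤ 6 * (k * (n * l)) := by
      have : (0 : ℝ) ≤ k * n := by positivity
      nlinarith
    have b5 : (0 : ℝ) ≤ k * m := by positivity
    have b6 : (0 : ℝ) ≤ k * (n * l) := by nlinarith
    nlinarith

/-! ### Reading the input arrays. -/

section Input

variable {n m : ℕ} (src dst : Fin m → Fin n) (wt : Fin m → ℝ)

theorem initial_inputState (parent : Fin n → Option (Fin n)) :
    Initial n m (inputState src dst wt parent) := by
  refine ⟨rfl, rfl, fun x hx => ?_, fun x => rfl, fun a i ha => ?_⟩
  · simp only [inputState]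
    rw [if_neg (by omega), if_neg (by omega)]
  · simp only [inputState]
    rw [if_neg (by omega), if_neg (by omega), if_neg (by omega)]

theorem up_inputState (F : RootedForest (Fin n)) (v : Fin n) :
    (inputState src dst wt F.parent).iarr 2 v = F.up v := by
  simp [inputState, RootedForest.up]

theorem mem_lists_inputState {und : Bool} (parent : Fin n → Option (Fin n)) {u v : ℕ} {x : ℝ} :
    (v, x) ∈ lists und ((inputState src dst wt parent).iarr 0) ((inputState src dst wt parent).iarr 1)
      ((inputState src dst wt parent).rarr 0) m u ↔
    ∃ i : Fin m, x = wt i ∧ ((src i : ℕ) = u ∧ (dst i : ℕ) = v ∨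
      und = true ∧ (src i : ℕ) = v ∧ (dst i : ℕ) = u) := by
  rw [mem_lists]
  constructor
  · rintro ⟨i, hi, h⟩
    exact ⟨⟨i, hi⟩, by simpa [inputState, hi] using h⟩
  · rintro ⟨i, h⟩
    exact ⟨i, i.isLt, by simpa [inputState] using h⟩

theorem le_sq_of_injective (h : Function.Injective fun i => (src i, dst i)) : m ≤ n * n := by
  simpa using Fintype.card_le_of_injective _ h

end Input

theorem describes_undirected {n m : ℕ} {G : SimpleGraph (Fin n)} (w : Sym2 (Fin n) → ℝ)
    {src dst : Fin m → Fin n} (h : ListsEdges G src dst) (parent : Fin n → Option (Fin n)) :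
    let s := inputState src dst (fun i => w s(src i, dst i)) parent
    Describes (fun u v => ∃ hu hv, G.Adj ⟨u, hu⟩ ⟨v, hv⟩) (extendWeight fun u v => w s(u, v))
      (lists true (s.iarr 0) (s.iarr 1) (s.rarr 0) m) := by
  intro s u v x
  rw [mem_lists_inputState]
  have hadj : ∀ i, G.Adj (src i) (dst i) := fun i => by
    rw [← SimpleGraph.mem_edgeSet, ← h.2]; exact ⟨i, rfl⟩
  constructor
  · rintro ⟨i, rfl, ⟨rfl, rfl⟩ | ⟨-, rfl, rfl⟩⟩
    · refine ⟨⟨Fin.isLt _, Fin.isLt _, hadj i⟩, ?_⟩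
      rw [extendWeight_coe]
    · refine ⟨⟨Fin.isLt _, Fin.isLt _, (hadj i).symm⟩, ?_⟩
      rw [extendWeight_coe, Sym2.eq_swap]
  · rintro ⟨⟨hu, hv, ha⟩, rfl⟩
    rw [← SimpleGraph.mem_edgeSet, ← h.2] at ha
    obtain ⟨i, hi⟩ := ha
    have hi' : s(src i, dst i) = s(⟨u, hu⟩, ⟨v, hv⟩) := hi
    refine ⟨i, ?_, ?_⟩
    · rw [hi', extendWeight, dif_pos ⟨hu, hv⟩]
    · rcases Sym2.eq_iff.1 hi' with ⟨h1, h2⟩ | ⟨h1, h2⟩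
      · exact .inl ⟨by rw [h1], by rw [h2]⟩
      · exact .inr ⟨rfl, by rw [h1], by rw [h2]⟩

theorem describes_directed {n m : ℕ} {G : Digraph (Fin n)} (w : Fin n → Fin n → ℝ)
    {src dst : Fin m → Fin n} (h : ListsArcs G src dst) (parent : Fin n → Option (Fin n)) :
    let s := inputState src dst (fun i => w (src i) (dst i)) parent
    Describes (fun u v => ∃ hu hv, G.Adj ⟨u, hu⟩ ⟨v, hv⟩) (extendWeight w)
      (lists false (s.iarr 0) (s.iarr 1) (s.rarr 0) m) := by
  intro s u v x
  rw [mem_lists_inputState]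
  have hadj : ∀ i, G.Adj (src i) (dst i) := fun i => by
    have : (src i, dst i) ∈ {e : Fin n × Fin n | G.Adj e.1 e.2} := by rw [← h.2]; exact ⟨i, rfl⟩
    exact this
  constructor
  · rintro ⟨i, rfl, ⟨rfl, rfl⟩ | ⟨h', -⟩⟩
    · exact ⟨⟨Fin.isLt _, Fin.isLt _, hadj i⟩, (extendWeight_coe _ _ _).symm⟩
    · exact absurd h' (by decide)
  · rintro ⟨⟨hu, hv, ha⟩, rfl⟩
    have hm : ((⟨u, hu⟩, ⟨v, hv⟩) : Fin n × Fin n) ∈ {e : Fin n × Fin n | G.Adj e.1 e.2} := ha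
    rw [← h.2] at hm
    obtain ⟨i, hi⟩ := hm
    obtain ⟨h1, h2⟩ := Prod.mk.inj hi
    refine ⟨i, ?_, .inl ⟨by rw [h1], by rw [h2]⟩⟩
    rw [h1, h2, extendWeight, dif_pos ⟨hu, hv⟩]

theorem RootedForest.depth_pos {n : ℕ} (F : RootedForest (Fin n)) (hn : 0 < n) : 0 < F.depth :=
  (F.ncard_pos ⟨0, hn⟩).trans_le (F.ncard_le_depth _)

theorem outputsMinCycle {n : ℕ} {G : SimpleGraph (Fin n)} {w : Sym2 (Fin n) → ℝ} {s : State}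
    (h : ((∀ L f, ¬ Cyc true (fun u v => ∃ hu hv, G.Adj ⟨u, hu⟩ ⟨v, hv⟩) L f) ∧ s.ireg 0 = 0) ∨
      (Cyc true (fun u v => ∃ hu hv, G.Adj ⟨u, hu⟩ ⟨v, hv⟩) (s.ireg 0) (s.iarr 0) ∧
        ∀ L f, Cyc true (fun u v => ∃ hu hv, G.Adj ⟨u, hu⟩ ⟨v, hv⟩) L f →
          cycWeight (extendWeight fun u v => w s(u, v)) (s.ireg 0) (s.iarr 0) ≤
            cycWeight (extendWeight fun u v => w s(u, v)) L f)) :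
    OutputsMinCycle G w s := by
  rcases h with ⟨h1, h2⟩ | ⟨h1, h2⟩
  · exact .inl ⟨fun v p hp => h1 _ _ (cyc_of_walk G w hp).1, h2⟩
  · obtain ⟨u, p, hp, hlen, hget⟩ := walk_of_cyc G h1
    refine .inr ⟨u, p, ⟨hp, fun v q hq => ?_⟩, hlen.symm, fun i hi => (hget i (hlen ▸ hi)).symm⟩
    rw [← (cyc_of_walk G w hp).2, ← (cyc_of_walk G w hq).2, hlen, cycWeight_congr hget]
    exact h2 _ _ (cyc_of_walk G w hq).1

theorem outputsMinDiCycle {n : ℕ} {G : Digraph (Fin n)} {w : Fin n → Fin n → ℝ} {s : State}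
    (h : ((∀ L f, ¬ Cyc false (fun u v => ∃ hu hv, G.Adj ⟨u, hu⟩ ⟨v, hv⟩) L f) ∧ s.ireg 0 = 0) ∨
      (Cyc false (fun u v => ∃ hu hv, G.Adj ⟨u, hu⟩ ⟨v, hv⟩) (s.ireg 0) (s.iarr 0) ∧
        ∀ L f, Cyc false (fun u v => ∃ hu hv, G.Adj ⟨u, hu⟩ ⟨v, hv⟩) L f →
          cycWeight (extendWeight w) (s.ireg 0) (s.iarr 0) ≤ cycWeight (extendWeight w) L f)) :
    OutputsMinDiCycle G w s := by
  rcases h with ⟨h1, h2⟩ | ⟨h1, h2⟩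
  · exact .inl ⟨fun l c hc => h1 _ _ (cyc_of_diCycle G w hc).1, h2⟩
  · obtain ⟨l, c, hc, hlen, hget⟩ := diCycle_of_cyc G h1
    refine .inr ⟨l, c, ⟨hc, fun l' c' hc' => ?_⟩, hlen, fun i => (hget i).symm⟩
    have hget' : ∀ i < l + 1, (c (Fin.ofNat (l + 1) i) : ℕ) = s.iarr 0 i := fun i hi => by
      rw [hget, Fin.val_ofNat, Nat.mod_eq_of_lt hi]
    rw [← (cyc_of_diCycle G w hc).2, ← (cyc_of_diCycle G w hc').2, cycWeight_congr hget', ← hlen]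
    exact h2 _ _ (cyc_of_diCycle G w hc').1

end TreeDepthCycle

theorem theorem6 :
    (∃ (P : TreeDepthCycle.Prog) (C : ℝ),
      ∀ (n m k : ℕ) (G : SimpleGraph (Fin n)) (w : Sym2 (Fin n) → ℝ)
        (F : TreeDepthCycle.RootedForest (Fin n)) (src dst : Fin m → Fin n),
        (∀ e ∈ G.edgeSet, 0 ≤ w e) →
        F.IsElimination G.Adj → F.depth = k →
        TreeDepthCycle.ListsEdges G src dst →
        ∃ (t : ℕ) (s : TreeDepthCycle.State),
          TreeDepthCycle.Exec P
            (TreeDepthCycle.inputState src dst (fun i => w s(src i, dst i)) F.parent) t s ∧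
          (t : ℝ) ≤ C * (k * (m + n * Real.log n) + 1) ∧
          TreeDepthCycle.OutputsMinCycle G w s) ∧
    (∃ (P : TreeDepthCycle.Prog) (C : ℝ),
      ∀ (n m k : ℕ) (G : Digraph (Fin n)) (w : Fin n → Fin n → ℝ)
        (F : TreeDepthCycle.RootedForest (Fin n)) (src dst : Fin m → Fin n),
        (∀ v, ¬ G.Adj v v) →
        (∀ u v, G.Adj u v → 0 ≤ w u v) →
        F.IsElimination G.Adj → F.depth = k →
        TreeDepthCycle.ListsArcs G src dst →
        ∃ (t : ℕ) (s : TreeDepthCycle.State),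
          TreeDepthCycle.Exec P
            (TreeDepthCycle.inputState src dst (fun i => w (src i) (dst i)) F.parent) t s ∧
          (t : ℝ) ≤ C * (k * (m + n * Real.log n) + 1) ∧
          TreeDepthCycle.OutputsMinDiCycle G w s) := by
  open TreeDepthCycle in
  refine ⟨⟨pMain true, 200000, ?_⟩, pMain false, 200000, ?_⟩
  · intro n m k G w F src dst hw hF hk hlist
    subst hk
    have hA := describes_undirected w hlist F.parent
    have hadj := AdjOK.of_describes (n := n) (und := true) hA (fun u v h => h.2.1)
      (by
        rintro u v ⟨hu, hv, h⟩
        rw [extendWeight, dif_pos ⟨hu, hv⟩]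
        exact hw _ h)
      (by rintro u v ⟨hu, hv, h⟩ rfl; exact h.ne rfl)
      (by
        rintro - u v ⟨hu, hv, h⟩
        refine ⟨⟨hv, hu, h.symm⟩, ?_⟩
        rw [extendWeight, extendWeight, dif_pos ⟨hv, hu⟩, dif_pos ⟨hu, hv⟩, Sym2.eq_swap])
    obtain ⟨t, s, hexec, hout, ht⟩ := wp_main (initial_inputState src dst _ F.parent) hadj hA
      (F.forestOK hF (up_inputState src dst _ F)) (fun u v h => h.1)
    rw [zero_add] at ht
    refine ⟨t, s, hexec, time_bound ?_ F.depth_le F.depth_pos ht, outputsMinCycle hout⟩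
    refine le_sq_of_injective src dst fun i j h => hlist.1 ?_
    obtain ⟨h1, h2⟩ := Prod.mk.inj h
    simp only [h1, h2]
  · intro n m k G w F src dst hloop hw hF hk hlist
    subst hk
    have hA := describes_directed w hlist F.parent
    have hadj := AdjOK.of_describes (n := n) (und := false) hA (fun u v h => h.2.1)
      (by
        rintro u v ⟨hu, hv, h⟩
        rw [extendWeight, dif_pos ⟨hu, hv⟩]
        exact hw _ _ h)
      (by rintro u v ⟨hu, hv, h⟩ rfl; exact hloop _ h)
      (by simp)
    obtain ⟨t, s, hexec, hout, ht⟩ := wp_main (initial_inputState src dst _ F.parent) hadj hA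
      (F.forestOK hF (up_inputState src dst _ F)) (fun u v h => h.1)
    rw [zero_add] at ht
    exact ⟨t, s, hexec, time_bound (le_sq_of_injective src dst hlist.1) F.depth_le F.depth_pos ht,
      outputsMinDiCycle hout⟩
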